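/- **Setting.** Let $d\ge 1$ and $\lambda\ge\mu\ge 1$ be integers, let $c_m>0$, $c_\sigma,c_c\in(0,1]$, $c_1,c_\mu\ge 0$ with $0<c_1+c_\mu<1$, and let $\mathbf w_m=(w^m_1\ge\dots\ge w^m_\mu>0)$ and $(w^c_1\ge\dots\ge w^c_\mu>0)$ be weights with $\sum_i w^m_i=\sum_i w^c_i=1$; put $\mu_{\mathrm{eff}}=1/\|\mathbf w_m\|^2$. Write $\mathcal S^d$ for the real symmetric $d\times d$ matrices and $\mathcal S^d_{++}$ for the positive definite ones. For $v=(v_1,\dots,v_\mu)\in\mathsf V=(\mathbb R^d)^\mu$ write $\mathbf w_m^\top v=\sum_i w^m_i v_i$. Consider $f\colon\mathbb R^d\to\mathbb R$, $x^*\in\mathbb R^d$, $R,\rho\colon\mathcal S^d_{++}\to(0,\infty)$, $\Gamma\colon\mathbb R^d\to(0,\infty)$ and a probability measure $P$ on $\mathbb R^d$ such that - $f=g\circ h$ with $h\colon\mathbb R^d\to\mathbb R$ continuous with Lebesgue negligible level sets and $g$ strictly increasing on the range of $h$; and $f(x^*+x)\le f(x^*+y)\iff f(x^*+sx)\le f(x^*+sy)$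 for all $x,y\in\mathbb R^d$, $s>0$; - $R(sA)=sR(A)$ for all $A\in\mathcal S^d_{++}$, $s>0$; $R$ is locally Lipschitz, and differentiable on some nonempty open subset of $\mathcal S^d_{++}$; - $\rho(sA)=s\rho(A)$ for all $A\in\mathcal S^d_{++}$, $s>0$; $\rho(\mathbf I_d)=1$, and $\rho$ is $C^\infty$; - $\Gamma$ is locally Lipschitz, and differentiable at every nonzero vector; $\Gamma(0)<1$; and, if $c_c\ne 1$, $\liminf_{\|p\|\to\infty}\Gamma(p)>(1-c_c)^{-1}$; - $P$ has a continuous, everywhere positive density with respect to the Lebesgue measure. **Control model.** Let $\mathsf X=\mathbb R^d\times\mathbb R^d\times\mathbb R^d\times\rho^{-1}(\{1\})\times(0,\infty)$, a smooth manifold of dimension $3d+d(d+1)/2$, with tangent space $\mathbb R^d\times\mathbb R^d\times\mathbb R^d\times \mathrm T_{\hat\Sigma}\rho^{-1}(\{1\})\times\mathbb R$ at $(z,p,q,\hat\Sigma,r)$, where $\mathrm T_{\hat\Sigma}\rho^{-1}(\{1\})=\ker\mathcal D\rho(\hat\Sigma)\subset\mathcal S^d$. For $\theta=(z,p,q,\hat\Sigma,r)\in\mathsf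 X$ and $v\in\mathsf V$ put $\Sigma=\hat\Sigma/R(\hat\Sigma)$ and let $F_\Theta(\theta,v)=(z^+,p^+,q^+,\hat\Sigma^+,r^+)$ with $$p^+=(1-c_\sigma)p+\sqrt{c_\sigma(2-c_\sigma)\mu_{\mathrm{eff}}}\,\Sigma^{-1/2}\mathbf w_m^\top v,\qquad q^+=(1-c_c)r^{-1/2}q+\sqrt{c_c(2-c_c)\mu_{\mathrm{eff}}}\,\mathbf w_m^\top v,$$ $$C=(1-c_1-c_\mu)\Sigma+c_1q^+(q^+)^\top+c_\mu\sum_{i=1}^\mu w^c_iv_iv_i^\top,\qquad \hat\Sigma^+=\frac{C}{\rho(C)},\qquad r^+=R(C),\qquad z^+=\frac{z+c_m\mathbf w_m^\top v}{\sqrt{r^+}\,\Gamma(p^+)}.$$ For $\theta\in\mathsf X$ and $u=(u^1,\dots,u^\lambda)\in(\mathbb R^d)^\lambda$ let $\alpha_\Theta(\theta,u)=(\sqrt\Sigma\,u^{s(1)},\dots,\sqrt\Sigma\,u^{s(\mu)})$, where $s$ is the permutation that sorts the values $f(x^*+z+\sqrt\Sigma\,u^i)$, $i=1,\dots,\lambda$,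 increasingly (ties broken by the index). Let $p_\theta$ be a Lebesgue density of $\alpha_\Theta(\theta,U)$, $U\sim P^{\otimes\lambda}$, such that $(\theta,v)\mapsto p_\theta(v)$ is lower semicontinuous on $\mathsf X\times\mathsf V$. Define $S^0_\theta=\theta$, $S^k_\theta(v_{1:k})=F_\Theta(S^{k-1}_\theta(v_{1:k-1}),v_k)$, and $p^k_\theta(v_{1:k})=\prod_{j=1}^k p_{S^{j-1}_\theta(v_{1:j-1})}(v_j)$; the control sets are $\mathcal O^k_\theta=\{v_{1:k}\in\mathsf V^k : p^k_\theta(v_{1:k})>0\}$. A state $\theta^*\in\mathsf X$ is *steadily attracting* if for every $\theta\in\mathsf X$ and every neighborhood $\mathsf N$ of $\theta^*$ in $\mathsf X$ there is $T>0$ such that for every $k\ge T$ there is $v_{1:k}\in\mathcal O^k_\theta$ with $S^k_\theta(v_{1:k})\in\mathsf N$. **Proposition 5.10.** Densities $p_\theta$ as above exist, and for each choice of them there exist a steadily attracting state $\theta_0\in\mathsf X$, an integer $T>0$ and $v_{1:T}\in\overline{\mathcal O^T_{\theta_0}}$ such that $S^T_{\theta_0}$ is differentiable at $v_{1:T}$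 and, denoting $(z_T,p_T,q_T,\hat\Sigma_T,r_T)=S^T_{\theta_0}(v_{1:T})$: - (a) if $c_c\ne1$, $c_\sigma\ne1$, $1-c_c\ne(1-c_\sigma)\sqrt{1-c_1-c_\mu}$ and $c_\mu>0$, then $\mathcal DS^T_{\theta_0}(v_{1:T})$ has maximal rank, that is, rank $\dim\mathsf X$; - (b) if $c_c=1$ and $c_\sigma\ne1$, then for every $(z,p,A)\in\mathbb R^d\times\mathbb R^d\times\mathrm T_{\hat\Sigma_T}\rho^{-1}(\{1\})$ there are $q\in\mathbb R^d$, $r\in\mathbb R$ with $(z,p,q,A,r)\in\operatorname{rge}\mathcal DS^T_{\theta_0}(v_{1:T})$; - (c) if $c_c\ne1$, $c_\sigma=1$ and $c_\mu>0$, then for every $(z,q,A,r)\in\mathbb R^d\times\mathbb R^d\times\mathrm T_{\hat\Sigma_T}\rho^{-1}(\{1\})\times\mathbb R$ there is $p\in\mathbb R^d$ with $(z,p,q,A,r)\in\operatorname{rge}\mathcal DS^T_{\theta_0}(v_{1:T})$; - (d) if $c_c=c_\sigma=1$, then for every $(z,A)\in\mathbb R^d\times\mathrm T_{\hat\Sigma_T}\rho^{-1}(\{1\})$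 there are $p,q\in\mathbb R^d$, $r\in\mathbb R$ with $(z,p,q,A,r)\in\operatorname{rge}\mathcal DS^T_{\theta_0}(v_{1:T})$. -/

import Mathlib

open MeasureTheory Set Filter Topology
open scoped Matrix ContDiff

noncomputable section

namespace CMAES

/-- Column vectors of `ℝ^d`. Only the topology, the Lebesgue measure and differentiability are
used on this space, so that the choice of the norm on it is immaterial. -/
abbrev Vec (d : ℕ) := Fin d → ℝ

/-- The symmetric positive semidefinite square root of a symmetric positive semidefinite real
matrix (the square root is applied to the eigenvalues). -/
def sqrtMat {d : ℕ} (A : Matrix (Fin d) (Fin d) ℝ) : Matrix (Fin d) (Fin d) ℝ :=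
  cfc Real.sqrt A

/-- The real vector space of symmetric `d × d` matrices. -/
def symMat (d : ℕ) : Submodule ℝ (Matrix (Fin d) (Fin d) ℝ) where
  carrier := {A | A.IsSymm}
  add_mem' := fun hA hB => Matrix.IsSymm.add hA hB
  zero_mem' := Matrix.isSymm_zero
  smul_mem' := fun c _ hA => Matrix.IsSymm.smul hA c

/- Any norm on the finite-dimensional space of matrices would do (here: the largest absolute value
of an entry); it induces the usual topology. -/
attribute [local instance] Matrix.normedAddCommGroup Matrix.normedSpace

/-- Symmetric `d × d` matrices. -/
abbrev Sym (d : ℕ) := symMat d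

/-- The identity matrix as a symmetric matrix. -/
def symOne (d : ℕ) : Sym d := ⟨1, Matrix.isSymm_one⟩

/-- The rank-one symmetric matrix `v vᵀ`. -/
def outer {d : ℕ} (v : Vec d) : Sym d :=
  ⟨Matrix.vecMulVec v v, Matrix.IsSymm.ext fun i j => mul_comm (v j) (v i)⟩

/-- The (open) cone of symmetric positive definite matrices. -/
def posDefCone (d : ℕ) : Set (Sym d) := {A | (A : Matrix (Fin d) (Fin d) ℝ).PosDef}

/-- The vector space containing the states `(z, p, q, Σ̂, r)`. -/
abbrev State (d : ℕ) := Vec d × Vec d × Vec d × Sym d × ℝ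

/-- The space of controls `v = (v₁, …, v_μ) ∈ (ℝ^d)^μ`. -/
abbrev Ctrl (d mu : ℕ) := Fin mu → Vec d

/-- The data of the normalized CMA-ES: `mu` parents are selected among `lam` candidate solutions
in dimension `d`. The normalization functions `R` and `rho` are only relevant on the cone of
positive definite matrices. -/
structure Data (d lam mu : ℕ) where
  /-- learning rate of the mean -/
  cm : ℝ
  /-- decay factor of the stepsize path -/
  cs : ℝ
  /-- decay factor of the path of the rank-one update -/
  cc : ℝ
  /-- learning rate of the rank-one update -/
  c1 : ℝ
  /-- learning rate of the rank-mu update -/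
  cmu : ℝ
  /-- weights of the mean update -/
  wm : Fin mu → ℝ
  /-- weights of the rank-mu update -/
  wc : Fin mu → ℝ
  /-- objective function -/
  f : Vec d → ℝ
  /-- reference point for the scaling-invariance of the objective function -/
  xstar : Vec d
  /-- normalization function `R` -/
  R : Sym d → ℝ
  /-- smooth normalization function `ρ` -/
  rho : Sym d → ℝ
  /-- stepsize change -/
  Gam : Vec d → ℝ
  /-- sampling distribution -/
  P : Measure (Vec d)

namespace Data

variable {d lam mu : ℕ} (M : Data d lam mu)

/-! ### Assumptions -/

/-- Standing assumptions on the hyperparameters. -/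
structure Hyper : Prop where
  dim_pos : 0 < d
  mu_le : mu ≤ lam
  cm_pos : 0 < M.cm
  cs_pos : 0 < M.cs
  cs_le : M.cs ≤ 1
  cc_pos : 0 < M.cc
  cc_le : M.cc ≤ 1
  c1_nonneg : 0 ≤ M.c1
  cmu_nonneg : 0 ≤ M.cmu
  c_pos : 0 < M.c1 + M.cmu
  c_lt : M.c1 + M.cmu < 1
  wm_anti : Antitone M.wm
  wm_pos : ∀ i, 0 < M.wm i
  wm_sum : ∑ i, M.wm i = 1
  wc_anti : Antitone M.wc
  wc_pos : ∀ i, 0 < M.wc i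
  wc_sum : ∑ i, M.wc i = 1

/-- Assumptions on the objective function: it is a strictly increasing transformation of a
continuous function with Lebesgue negligible level sets, and it is scaling-invariant with respect
to `xstar`. -/
structure ObjectiveOK : Prop where
  negligible_level_sets : ∃ (h : Vec d → ℝ) (g : ℝ → ℝ), Continuous h ∧
    (∀ c : ℝ, volume (h ⁻¹' {c}) = 0) ∧ StrictMonoOn g (range h) ∧ M.f = g ∘ h
  scaling_invariant : ∀ (x y : Vec d) (s : ℝ), 0 < s →
    (M.f (x + M.xstar) ≤ M.f (y + M.xstar) ↔ M.f (s • x + M.xstar) ≤ M.f (s • y + M.xstar))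

/-- Assumptions on the normalization function `R`. -/
structure RNormOK : Prop where
  pos : ∀ A ∈ posDefCone d, 0 < M.R A
  homogeneous : ∀ A ∈ posDefCone d, ∀ s : ℝ, 0 < s → M.R (s • A) = s * M.R A
  locallyLipschitz : LocallyLipschitzOn (posDefCone d) M.R
  differentiable : ∃ O : Set (Sym d), IsOpen O ∧ O.Nonempty ∧ O ⊆ posDefCone d ∧
    DifferentiableOn ℝ M.R O

/-- Assumptions on the smooth normalization function `ρ`. -/
structure RhoOK : Prop where
  pos : ∀ A ∈ posDefCone d, 0 < M.rho A
  homogeneous : ∀ A ∈ posDefCone d, ∀ s : ℝ, 0 < s → M.rho (s • A) = s * M.rho A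
  one : M.rho (symOne d) = 1
  smooth : ContDiffOn ℝ ∞ M.rho (posDefCone d)

/-- Assumptions on the stepsize change. `growth` says that the lower limit of `Γ(p)` as `‖p‖ → ∞`
is larger than `1 / (1 - c_c)`; it is only required when this quantity makes sense. -/
structure StepsizeOK : Prop where
  pos : ∀ p, 0 < M.Gam p
  locallyLipschitz : LocallyLipschitz M.Gam
  differentiable : ∀ p, p ≠ 0 → DifferentiableAt ℝ M.Gam p
  growth : M.cc ≠ 1 → ∃ a : ℝ, (1 - M.cc)⁻¹ < a ∧ ∀ᶠ p in cocompact (Vec d), a ≤ M.Gam p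
  zero_lt_one : M.Gam 0 < 1

/-- Assumption on the sampling distribution: it is a probability measure with a continuous,
everywhere positive Lebesgue density. -/
structure SamplingOK : Prop where
  isProb : IsProbabilityMeasure M.P
  density : ∃ g : Vec d → ℝ, Continuous g ∧ (∀ x, 0 < g x) ∧
    M.P = volume.withDensity fun x => ENNReal.ofReal (g x)

/-! ### The control model -/

/-- The state space `X = ℝ^d × ℝ^d × ℝ^d × ρ⁻¹({1}) × (0, ∞)`. -/
def X : Set (State d) :=
  {θ | θ.2.2.2.1 ∈ posDefCone d ∧ M.rho θ.2.2.2.1 = 1 ∧ 0 < θ.2.2.2.2}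

/-- The tangent space of `ρ⁻¹({1})` at one of its points `A`. It is the kernel of `Dρ(A)`,
since `1` is a regular value of `ρ` (by homogeneity, `Dρ(A) A = ρ(A) ≠ 0`). -/
def tangentCov (A : Sym d) : Submodule ℝ (Sym d) := LinearMap.ker (fderiv ℝ M.rho A).toLinearMap

/-- The tangent space of `X` at one of its points `θ`. -/
def tangentX (θ : State d) : Submodule ℝ (State d) :=
  (⊤ : Submodule ℝ (Vec d)).prod <| (⊤ : Submodule ℝ (Vec d)).prod <|
    (⊤ : Submodule ℝ (Vec d)).prod <| (M.tangentCov θ.2.2.2.1).prod (⊤ : Submodule ℝ ℝ)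

/-- `μ_eff = 1 / ‖w_m‖²`. -/
def mueff : ℝ := 1 / ∑ i, M.wm i ^ 2

/-- The matrix `Σ = Σ̂ / R(Σ̂)`. -/
def normCov (A : Sym d) : Sym d := (M.R A)⁻¹ • A

/-- The weighted recombination `w_mᵀ v = ∑ᵢ wᵢ vᵢ`. -/
def recomb (v : Ctrl d mu) : Vec d := ∑ i, M.wm i • v i

/-- `p⁺ = (1 - c_σ) p + √(c_σ (2 - c_σ) μ_eff) Σ^{-1/2} w_mᵀ v`. -/
def nextP (θ : State d) (v : Ctrl d mu) : Vec d :=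
  (1 - M.cs) • θ.2.1 + Real.sqrt (M.cs * (2 - M.cs) * M.mueff) •
    ((sqrtMat (M.normCov θ.2.2.2.1 : Matrix (Fin d) (Fin d) ℝ))⁻¹ *ᵥ M.recomb v)

/-- `q⁺ = (1 - c_c) r^{-1/2} q + √(c_c (2 - c_c) μ_eff) w_mᵀ v`. -/
def nextQ (θ : State d) (v : Ctrl d mu) : Vec d :=
  (1 - M.cc) • ((Real.sqrt θ.2.2.2.2)⁻¹ • θ.2.2.1) +
    Real.sqrt (M.cc * (2 - M.cc) * M.mueff) • M.recomb v

/-- The updated covariance matrix before normalization,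
`(1 - c_1 - c_μ) Σ + c_1 q⁺ (q⁺)ᵀ + c_μ ∑ᵢ wᵢᶜ vᵢ vᵢᵀ`. -/
def nextCov (θ : State d) (v : Ctrl d mu) : Sym d :=
  (1 - M.c1 - M.cmu) • M.normCov θ.2.2.2.1 + M.c1 • outer (M.nextQ θ v) +
    M.cmu • ∑ i, M.wc i • outer (v i)

/-- `z⁺ = (z + c_m w_mᵀ v) / (√r⁺ Γ(p⁺))`, where `r⁺` is the `R`-value of `nextCov`. -/
def nextZ (θ : State d) (v : Ctrl d mu) : Vec d :=
  (Real.sqrt (M.R (M.nextCov θ v)) * M.Gam (M.nextP θ v))⁻¹ • (θ.1 + M.cm • M.recomb v)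

/-- The update function `F_Θ`. -/
def F (θ : State d) (v : Ctrl d mu) : State d :=
  (M.nextZ θ v, M.nextP θ v, M.nextQ θ v,
    (M.rho (M.nextCov θ v))⁻¹ • M.nextCov θ v, M.R (M.nextCov θ v))

/-- The function `α_Θ`: the `mu` best steps `√Σ uᵢ`, ranked by the objective function.
`Tuple.sort` is the permutation sorting increasingly, ties being broken by the index. -/
def alpha (h : mu ≤ lam) (θ : State d) (u : Fin lam → Vec d) : Ctrl d mu := fun i =>
  sqrtMat (M.normCov θ.2.2.2.1 : Matrix (Fin d) (Fin d) ℝ) *ᵥ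
    u (Tuple.sort (fun j => M.f (M.xstar + θ.1 +
      sqrtMat (M.normCov θ.2.2.2.1 : Matrix (Fin d) (Fin d) ℝ) *ᵥ u j)) (Fin.castLE h i))

/-- `p θ` is, for each state `θ`, a Lebesgue density of the random variable `α_Θ(θ, U)` with
`U ∼ P^{⊗ lam}`, and `(θ, v) ↦ p θ v` is lower semicontinuous. -/
structure IsLscDensity (h : mu ≤ lam) (p : State d → Ctrl d mu → ℝ) : Prop where
  nonneg : ∀ θ ∈ M.X, ∀ v, 0 ≤ p θ v
  density : ∀ θ ∈ M.X, (Measure.pi fun _ : Fin lam => M.P).map (M.alpha h θ) =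
    volume.withDensity fun v => ENNReal.ofReal (p θ v)
  lsc : LowerSemicontinuousOn (fun x : State d × Ctrl d mu => p x.1 x.2) (M.X ×ˢ univ)

/-- The extended transition map `S^k_θ : V^k → X`. -/
def S (θ : State d) : (k : ℕ) → (Fin k → Ctrl d mu) → State d
  | 0, _ => θ
  | k + 1, v => M.F (S θ k fun i => v i.castSucc) (v (Fin.last k))

/-- The extended probability density `p^k_θ : V^k → [0, ∞)`. -/
def extDensity (p : State d → Ctrl d mu → ℝ) (θ : State d) :
    (k : ℕ) → (Fin k → Ctrl d mu) → ℝ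
  | 0, _ => 1
  | k + 1, v => extDensity p θ k (fun i => v i.castSucc) *
      p (M.S θ k fun i => v i.castSucc) (v (Fin.last k))

/-- The control set `O^k_θ`. -/
def controlSet (p : State d → Ctrl d mu → ℝ) (θ : State d) (k : ℕ) :
    Set (Fin k → Ctrl d mu) :=
  {v | 0 < M.extDensity p θ k v}

/-- Steadily attracting states of the control model. -/
def SteadilyAttracting (p : State d → Ctrl d mu → ℝ) (θs : State d) : Prop :=
  θs ∈ M.X ∧ ∀ θ ∈ M.X, ∀ U ∈ 𝓝[M.X] θs, ∃ T : ℕ, 0 < T ∧ ∀ k ≥ T,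
    ∃ v ∈ M.controlSet p θ k, M.S θ k v ∈ U

end Data

end CMAES

end

/-!
The proof rests on three observations.

**Densities.** The density of the `mu` best steps at `v` is, up to a factor, the density of `mu`
unranked steps at `v` times the probability that further steps continue `v` with increasing values
of the objective function. It is lower semicontinuous because strict inequalities persist under
small perturbations; ties are negligible because the level sets are (`exists_isLscDensity`). Near
each control `(w, …, w)` there is an open set of controls with increasing values that can be
continued in this way, as the objective function is not constant on any ball. Each version of the
density is positive almost everywhere on this open set. Consequently all sequences of controls with
equal components belong to the closure of the control sets (`diag_mem_closure_controlSet`), and only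
such controls are used below.

**Steady attraction.** Without the normalizations by `R` and `ρ`, a control `(w, …, w)` acts by the
simple map `dstep` on states `(z, p, q, C)`, and the normalized system is conjugate to this one
(`DynamicsOK.F_normalize`). Let `γ = 1 - c_c`. From any state one first makes `q` vanish; the steps
`x z` and `-γ x z`, with `x` solving the scalar equation `IsZeroing`, then make both `z` and `q`
vanish, and waiting sends `p` to `0`: one arrives at a rest point (`exists_leadsTo_rest`). From the
rest point with covariance matrix `A`, the steps `ε e`, `-γ ε e`, followed by the two zeroing steps,
lead to the rest point with covariance matrix `A + χ e eᵀ` for some small `χ > 0`. By continuous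
induction, all rest points lead to each other, and hence are steadily attracting
(`DynamicsOK.steadilyAttracting_rest`).

**Rank.** Start at rest, at a covariance matrix near which `R` is differentiable, and follow the
tangent directions that are attained by varying the controls (`Traj`, `Traj.step`). A block of two
small steps `w`, `-s w` whose variations are `y`, `-γ y` provides the direction `w yᵀ + y wᵀ` of the
covariance matrix; blocks along the basis vectors provide all of them
(`DynamicsOK.exists_traj_covTangent`). Return to `z = q = 0` (`DynamicsOK.exists_traj_zeroed`).
There, three steps `0` provide the directions of `z`, `p`, `q`: writing `β = (1 - c_σ) √(1 - c_1 -
c_μ)` and `g_i` for `1 / Γ` at the successive paths, the variations `u₁, u₂, u₃` of these steps act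
on `q`, `p`, `z` through `γ² u₁ + γ u₂ + u₃`, `β² u₁ + β u₂ + u₃` and `g₁ g₂ u₁ + g₂ u₂ + u₃`, which
are independent if `γ ≠ β` (`Traj.exists_fullTangent`). If `c_c = 1` or `c_σ = 1`, then `q` or `p`
has no memory and need not be controlled. A last generic step recovers the direction of `r`, which
does not enter the unnormalized dynamics (`Traj.exists_range_S`). The stepsize change `Γ` need not be
differentiable at `0`, so that the steps are chosen such that the path `p` does not vanish, unless
`z` vanishes after the step.
-/

noncomputable section

namespace CMAES

attribute [local instance] Matrix.normedAddCommGroup Matrix.normedSpace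

/-! ### Square roots of symmetric positive definite matrices -/

section SquareRoot

variable {d : ℕ}

theorem Sym.isHermitian (A : Sym d) : (A : Matrix (Fin d) (Fin d) ℝ).IsHermitian := by
  have h : (A : Matrix (Fin d) (Fin d) ℝ)ᵀ = A := A.2
  rw [Matrix.IsHermitian, Matrix.conjTranspose_eq_transpose_of_trivial, h]

open scoped MatrixOrder in
theorem sqrtMat_posSemidef (A : Matrix (Fin d) (Fin d) ℝ) : (sqrtMat A).PosSemidef :=
  Matrix.nonneg_iff_posSemidef.1 (cfc_nonneg fun _ _ => Real.sqrt_nonneg _)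

open scoped MatrixOrder in
theorem sqrtMat_eq_sqrt {A : Matrix (Fin d) (Fin d) ℝ} (hA : A.PosSemidef) :
    sqrtMat A = CFC.sqrt A := by
  have h0 : 0 ≤ A := Matrix.nonneg_iff_posSemidef.2 hA
  rw [CFC.sqrt_eq_real_sqrt A h0, sqrtMat, cfcₙ_eq_cfc]

open scoped MatrixOrder in
theorem sqrtMat_mul_self {A : Matrix (Fin d) (Fin d) ℝ} (hA : A.PosSemidef) :
    sqrtMat A * sqrtMat A = A := by
  rw [sqrtMat_eq_sqrt hA]
  exact CFC.sqrt_mul_sqrt_self A (Matrix.nonneg_iff_posSemidef.2 hA)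

open scoped MatrixOrder in
theorem sqrtMat_unique {A B : Matrix (Fin d) (Fin d) ℝ} (hB : B.PosSemidef) (h : B * B = A) :
    sqrtMat A = B := by
  have hA : A.PosSemidef := by
    rw [← h]
    have := Matrix.posSemidef_conjTranspose_mul_self B
    rwa [hB.isHermitian.eq] at this
  rw [sqrtMat_eq_sqrt hA]
  exact CFC.sqrt_unique h (Matrix.nonneg_iff_posSemidef.2 hB)

theorem sqrtMat_isUnit_det {A : Matrix (Fin d) (Fin d) ℝ} (hA : A.PosDef) :
    IsUnit (sqrtMat A).det := by
  have h : (sqrtMat A).det * (sqrtMat A).det = A.det := by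
    rw [← Matrix.det_mul, sqrtMat_mul_self hA.posSemidef]
  have := hA.det_pos.ne'
  exact isUnit_iff_ne_zero.2 fun h0 => this (by rw [← h, h0, zero_mul])

open scoped MatrixOrder in
theorem sqrtMat_posDef {A : Matrix (Fin d) (Fin d) ℝ} (hA : A.PosDef) : (sqrtMat A).PosDef :=
  ((sqrtMat_posSemidef A).posDef_iff_isUnit).2
    ((Matrix.isUnit_iff_isUnit_det _).2 (sqrtMat_isUnit_det hA))

theorem sqrtMat_smul {A : Matrix (Fin d) (Fin d) ℝ} (hA : A.PosSemidef) {s : ℝ} (hs : 0 ≤ s) :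
    sqrtMat (s • A) = Real.sqrt s • sqrtMat A :=
  sqrtMat_unique ((sqrtMat_posSemidef A).smul (Real.sqrt_nonneg s)) (by
    rw [smul_mul_smul_comm, Real.mul_self_sqrt hs, sqrtMat_mul_self hA])

theorem posDef_iff_pos {A : Sym d} :
    A ∈ posDefCone d ↔ ∀ x : Vec d, x ≠ 0 → 0 < x ⬝ᵥ ((A : Matrix (Fin d) (Fin d) ℝ) *ᵥ x) := by
  rw [posDefCone, Set.mem_ofPred_eq, Matrix.posDef_iff_dotProduct_mulVec]
  simp only [star_trivial]
  exact ⟨fun h x hx => h.2 hx, fun h => ⟨Sym.isHermitian A, fun x hx => h x hx⟩⟩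

theorem isOpen_posDefCone : IsOpen (posDefCone d) := by
  rw [isOpen_iff_mem_nhds]
  intro A hA
  have hK : IsCompact (Metric.sphere (0 : Vec d) 1) := isCompact_sphere 0 1
  have hcont : Continuous fun q : Sym d × Vec d =>
      q.2 ⬝ᵥ ((q.1 : Matrix (Fin d) (Fin d) ℝ) *ᵥ q.2) := by
    refine Continuous.dotProduct continuous_snd (Continuous.matrix_mulVec ?_ continuous_snd)
    exact continuous_subtype_val.comp continuous_fst
  have hev : ∀ᶠ B : Sym d in 𝓝 A, ∀ x ∈ Metric.sphere (0 : Vec d) 1,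
      0 < x ⬝ᵥ ((B : Matrix (Fin d) (Fin d) ℝ) *ᵥ x) := by
    refine hK.eventually_forall_of_forall_eventually fun x hx => ?_
    have hx0 : x ≠ 0 := by
      rintro rfl
      simp at hx
    exact (hcont.continuousAt (x := (A, x))).eventually
      (lt_mem_nhds (posDef_iff_pos.1 hA x hx0))
  filter_upwards [hev] with B hB
  rw [posDef_iff_pos]
  intro x hx
  have hn : 0 < ‖x‖ := norm_pos_iff.2 hx
  have h1 := hB (‖x‖⁻¹ • x) (by
    rw [mem_sphere_zero_iff_norm, norm_smul, norm_inv, norm_norm, inv_mul_cancel₀ hn.ne'])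
  rw [Matrix.mulVec_smul, smul_dotProduct, dotProduct_smul, smul_eq_mul, smul_eq_mul] at h1
  exact pos_of_mul_pos_right (pos_of_mul_pos_right h1 (inv_pos.2 hn).le) (inv_pos.2 hn).le

theorem posDefCone_smul {A : Sym d} (hA : A ∈ posDefCone d) {s : ℝ} (hs : 0 < s) :
    s • A ∈ posDefCone d :=
  Matrix.PosDef.smul (x := (A : Matrix (Fin d) (Fin d) ℝ)) hA hs

theorem outer_posSemidef (x : Vec d) : (outer x : Matrix (Fin d) (Fin d) ℝ).PosSemidef := by
  have := Matrix.posSemidef_vecMulVec_self_star x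
  rwa [star_trivial] at this

theorem posDefCone_add {A B : Sym d} (hA : A ∈ posDefCone d)
    (hB : (B : Matrix (Fin d) (Fin d) ℝ).PosSemidef) : A + B ∈ posDefCone d :=
  Matrix.PosDef.add_posSemidef (A := (A : Matrix (Fin d) (Fin d) ℝ)) hA hB

theorem posDefCone_add_smul_outer {A : Sym d} (hA : A ∈ posDefCone d) {s : ℝ} (hs : 0 ≤ s)
    (x : Vec d) : A + s • outer x ∈ posDefCone d :=
  posDefCone_add hA ((outer_posSemidef x).smul hs)

/-- The symmetrization `X ↦ (X + Xᵀ) / 2`, a projection of the matrices onto the symmetric ones. -/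
def symmetrize (d : ℕ) : Matrix (Fin d) (Fin d) ℝ →ₗ[ℝ] Sym d where
  toFun X := ⟨(1 / 2 : ℝ) • (X + Xᵀ), by
    change ((1 / 2 : ℝ) • (X + Xᵀ))ᵀ = (1 / 2 : ℝ) • (X + Xᵀ)
    rw [Matrix.transpose_smul, Matrix.transpose_add, Matrix.transpose_transpose, add_comm]⟩
  map_add' X Y := by
    ext1
    simp only [Submodule.coe_add, Matrix.transpose_add, ← smul_add]
    congr 1
    abel
  map_smul' c X := by
    ext1
    simp only [Submodule.coe_smul, Matrix.transpose_smul, ← smul_add, RingHom.id_apply]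
    rw [smul_comm]

/-- The symmetrized product `(A B + B A) / 2` of symmetric matrices. -/
def symMul (d : ℕ) : Sym d →ₗ[ℝ] Sym d →ₗ[ℝ] Sym d :=
  LinearMap.mk₂ ℝ
    (fun A B => symmetrize d ((A : Matrix (Fin d) (Fin d) ℝ) * (B : Matrix (Fin d) (Fin d) ℝ)))
    (fun A A' B => by simp only [Submodule.coe_add, add_mul, map_add])
    (fun c A B => by simp only [Submodule.coe_smul, smul_mul_assoc, map_smul])
    (fun A B B' => by simp only [Submodule.coe_add, mul_add, map_add])
    (fun c A B => by simp only [Submodule.coe_smul, mul_smul_comm, map_smul])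

theorem symMul_apply_coe (A B : Sym d) : (symMul d A B : Matrix (Fin d) (Fin d) ℝ) =
    (1 / 2 : ℝ) • ((A : Matrix (Fin d) (Fin d) ℝ) * B + (B : Matrix (Fin d) (Fin d) ℝ) * A) := by
  change (1 / 2 : ℝ) • ((A : Matrix (Fin d) (Fin d) ℝ) * B +
    ((A : Matrix (Fin d) (Fin d) ℝ) * (B : Matrix (Fin d) (Fin d) ℝ))ᵀ) = _
  rw [Matrix.transpose_mul, show (A : Matrix (Fin d) (Fin d) ℝ)ᵀ = A from A.2,
    show (B : Matrix (Fin d) (Fin d) ℝ)ᵀ = B from B.2]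

theorem symMul_self_coe (A : Sym d) : (symMul d A A : Matrix (Fin d) (Fin d) ℝ) =
    (A : Matrix (Fin d) (Fin d) ℝ) * A := by
  rw [symMul_apply_coe, ← two_smul ℝ, smul_smul]
  norm_num

theorem symMul_comm (A B : Sym d) : symMul d A B = symMul d B A := by
  ext1
  rw [symMul_apply_coe, symMul_apply_coe, add_comm]

/-- The Lyapunov operator of a positive definite matrix is injective. -/
theorem symMul_injective {A : Sym d} (hA : A ∈ posDefCone d) : Function.Injective (symMul d A) := by
  rw [injective_iff_map_eq_zero]
  intro H hH
  have h1 : (A : Matrix (Fin d) (Fin d) ℝ) * H + (H : Matrix (Fin d) (Fin d) ℝ) * A = 0 := by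
    have := congrArg (Subtype.val) hH
    rw [symMul_apply_coe] at this
    exact (smul_eq_zero.1 this).resolve_left (by norm_num)
  -- the quadratic form of `A` vanishes on the columns of `H`, by `tr (H A H) = - tr (H H A)`
  have htr : ((H : Matrix (Fin d) (Fin d) ℝ)ᵀ * (A : Matrix (Fin d) (Fin d) ℝ) * H).trace = 0 := by
    have h2 := congrArg (fun X => ((H : Matrix (Fin d) (Fin d) ℝ) * X).trace) h1
    simp only [mul_add, Matrix.trace_add, mul_zero, Matrix.trace_zero] at h2
    have h3 : ((H : Matrix (Fin d) (Fin d) ℝ) * ((H : Matrix (Fin d) (Fin d) ℝ) * A)).trace =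
        ((H : Matrix (Fin d) (Fin d) ℝ) * ((A : Matrix (Fin d) (Fin d) ℝ) * H)).trace := by
      rw [Matrix.trace_mul_comm, Matrix.mul_assoc]
    rw [h3] at h2
    rw [show (H : Matrix (Fin d) (Fin d) ℝ)ᵀ = H from H.2, Matrix.mul_assoc]
    linarith
  have hcol : ∀ j, (fun i => (H : Matrix (Fin d) (Fin d) ℝ) i j) = 0 := by
    intro j
    by_contra hne
    have hnonneg : ∀ k, 0 ≤ ((H : Matrix (Fin d) (Fin d) ℝ)ᵀ *
        (A : Matrix (Fin d) (Fin d) ℝ) * H) k k := by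
      intro k
      have := Matrix.PosSemidef.conjTranspose_mul_mul_same (Matrix.PosDef.posSemidef hA)
        (H : Matrix (Fin d) (Fin d) ℝ)
      rw [Matrix.conjTranspose_eq_transpose_of_trivial] at this
      exact this.diag_nonneg
    have h0 := (Finset.sum_eq_zero_iff_of_nonneg fun k _ => hnonneg k).1 htr j (Finset.mem_univ j)
    have hpos := posDef_iff_pos.1 hA _ hne
    rw [Matrix.mul_assoc, Matrix.mul_apply] at h0
    refine hpos.ne' ?_
    rw [← h0]
    rfl
  ext i j
  exact congrFun (hcol j) i

/-- The symmetric square root as a map between spaces of symmetric matrices. -/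
def sqrtSym (A : Sym d) : Sym d :=
  ⟨sqrtMat (A : Matrix (Fin d) (Fin d) ℝ), by
    have := (sqrtMat_posSemidef (A : Matrix (Fin d) (Fin d) ℝ)).isHermitian
    rwa [Matrix.IsHermitian, Matrix.conjTranspose_eq_transpose_of_trivial] at this⟩

theorem sqrtSym_mem {A : Sym d} (hA : A ∈ posDefCone d) : sqrtSym A ∈ posDefCone d :=
  sqrtMat_posDef hA

theorem sqrtSym_eq {A B : Sym d} (hB : B ∈ posDefCone d) (h : symMul d B B = A) :
    sqrtSym A = B := by
  ext1
  refine sqrtMat_unique (Matrix.PosDef.posSemidef hB) ?_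
  rw [← h, symMul_self_coe]

theorem symMul_sqrtSym {A : Sym d} (hA : A ∈ posDefCone d) :
    symMul d (sqrtSym A) (sqrtSym A) = A := by
  ext1
  rw [symMul_self_coe]
  exact sqrtMat_mul_self (Matrix.PosDef.posSemidef hA)

/-- The inverse function theorem, applied to `B ↦ B²`. -/
theorem differentiableAt_sqrtSym {A : Sym d} (hA : A ∈ posDefCone d) :
    DifferentiableAt ℝ (sqrtSym (d := d)) A := by
  set B := sqrtSym A with hBdef
  have hB : B ∈ posDefCone d := sqrtSym_mem hA
  let L := (symMul d).toContinuousBilinearMap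
  have hL : HasStrictFDerivAt (fun X : Sym d => L X X) ((2 : ℝ) • L B) B := by
    have h := L.hasStrictFDerivAt_of_bilinear (hasStrictFDerivAt_id B) (hasStrictFDerivAt_id B)
    refine h.congr_fderiv ?_
    ext1 H
    change symMul d B H + symMul d H B = (2 : ℝ) • symMul d B H
    rw [symMul_comm H B, two_smul]
  have hinj : Function.Injective ((2 : ℝ) • L B) := by
    intro x y hxy
    have h2 : (2 : ℝ) • symMul d B x = (2 : ℝ) • symMul d B y := hxy
    exact symMul_injective hB (smul_right_injective _ (two_ne_zero (α := ℝ)) h2)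
  let e : Sym d ≃L[ℝ] Sym d :=
    (LinearEquiv.ofInjectiveEndo ((2 : ℝ) • L B).toLinearMap hinj).toContinuousLinearEquiv
  have hL' : HasStrictFDerivAt (fun X : Sym d => L X X) (e : Sym d →L[ℝ] Sym d) B := by
    refine hL.congr_fderiv ?_
    ext1 H
    rfl
  have hBA : L B B = A := symMul_sqrtSym hA
  have h1 := hL'.to_localInverse.hasFDerivAt.differentiableAt
  have h2 := hL'.eventually_right_inverse
  have h3 := hL'.localInverse_tendsto
  simp only [hBA] at h1 h2 h3
  refine h1.congr_of_eventuallyEq ?_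
  filter_upwards [h2, h3.eventually (isOpen_posDefCone.mem_nhds hB)] with X hX hX'
  exact sqrtSym_eq hX' hX

/-- The matrix `A^{-1/2}`. -/
def invSqrt (A : Sym d) : Matrix (Fin d) (Fin d) ℝ :=
  (sqrtMat (A : Matrix (Fin d) (Fin d) ℝ))⁻¹

theorem invSqrt_smul {A : Sym d} (hA : A ∈ posDefCone d) {s : ℝ} (hs : 0 < s) :
    invSqrt (s • A) = (Real.sqrt s)⁻¹ • invSqrt A := by
  have h0 : Real.sqrt s ≠ 0 := (Real.sqrt_pos.2 hs).ne'
  have h1 := sqrtMat_isUnit_det hA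
  have h2 : sqrtMat ((s • A : Sym d) : Matrix (Fin d) (Fin d) ℝ) =
      Real.sqrt s • sqrtMat (A : Matrix (Fin d) (Fin d) ℝ) :=
    sqrtMat_smul (Matrix.PosDef.posSemidef hA) hs.le
  rw [invSqrt, invSqrt, h2]
  refine Matrix.inv_eq_left_inv ?_
  rw [smul_mul_smul_comm, inv_mul_cancel₀ h0, Matrix.nonsing_inv_mul _ h1, one_smul]

theorem invSqrt_mulVec_ne_zero {A : Sym d} (hA : A ∈ posDefCone d) {x : Vec d} (hx : x ≠ 0) :
    invSqrt A *ᵥ x ≠ 0 := by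
  intro h
  apply hx
  have h1 := congrArg (fun y => sqrtMat (A : Matrix (Fin d) (Fin d) ℝ) *ᵥ y) h
  simpa [invSqrt, Matrix.mulVec_mulVec, Matrix.mul_nonsing_inv _ (sqrtMat_isUnit_det hA)] using h1

theorem contDiff_matrix_det :
    ContDiff ℝ ∞ fun X : Matrix (Fin d) (Fin d) ℝ => X.det := by
  simp only [Matrix.det_apply]
  refine ContDiff.sum fun σ _ => ContDiff.const_smul _ (contDiff_prod fun i _ => ?_)
  exact contDiff_apply_apply ℝ ℝ (σ i) i

theorem contDiff_matrix_adjugate :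
    ContDiff ℝ ∞ fun X : Matrix (Fin d) (Fin d) ℝ => X.adjugate := by
  refine contDiff_pi.2 fun i => contDiff_pi.2 fun j => ?_
  simp only [Matrix.adjugate_apply]
  refine contDiff_matrix_det.comp ?_
  refine contDiff_pi.2 fun k => contDiff_pi.2 fun l => ?_
  simp only [Matrix.updateRow_apply]
  split_ifs
  · exact contDiff_const
  · exact contDiff_apply_apply ℝ ℝ k l

theorem differentiableAt_matrix_inv {X : Matrix (Fin d) (Fin d) ℝ} (hX : IsUnit X.det) :
    DifferentiableAt ℝ (fun Y : Matrix (Fin d) (Fin d) ℝ => Y⁻¹) X := by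
  have h : (fun Y : Matrix (Fin d) (Fin d) ℝ => Y⁻¹) = fun Y => Y.det⁻¹ • Y.adjugate := by
    funext Y
    rw [Matrix.inv_def, Ring.inverse_eq_inv']
  rw [h]
  exact ((contDiff_matrix_det.differentiable (by simp)).differentiableAt.inv hX.ne_zero).smul
    (contDiff_matrix_adjugate.differentiable (by simp)).differentiableAt

theorem differentiableAt_invSqrt {A : Sym d} (hA : A ∈ posDefCone d) :
    DifferentiableAt ℝ (invSqrt (d := d)) A := by
  have h1 : DifferentiableAt ℝ
      (fun X : Sym d => (sqrtSym X : Matrix (Fin d) (Fin d) ℝ)) A :=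
    (symMat d).subtypeL.differentiableAt.comp A (differentiableAt_sqrtSym hA)
  exact DifferentiableAt.comp A (g := fun Y : Matrix (Fin d) (Fin d) ℝ => Y⁻¹)
    (differentiableAt_matrix_inv (sqrtMat_isUnit_det hA)) h1

theorem continuousAt_invSqrt {A : Sym d} (hA : A ∈ posDefCone d) :
    ContinuousAt (invSqrt (d := d)) A :=
  (differentiableAt_invSqrt hA).continuousAt

theorem continuousAt_sqrtMat {A : Sym d} (hA : A ∈ posDefCone d) :
    ContinuousAt (fun X : Sym d => sqrtMat (X : Matrix (Fin d) (Fin d) ℝ)) A :=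
  continuous_subtype_val.continuousAt.comp (differentiableAt_sqrtSym hA).continuousAt

/-! ### Symmetric products of vectors -/

/-- The symmetric product `x yᵀ + y xᵀ`, as a bilinear map. -/
def symProd (d : ℕ) : Vec d →ₗ[ℝ] Vec d →ₗ[ℝ] Sym d :=
  LinearMap.mk₂ ℝ (fun x y => (2 : ℝ) • symmetrize d (Matrix.vecMulVec x y))
    (fun x x' y => by rw [Matrix.add_vecMulVec, map_add, smul_add])
    (fun c x y => by rw [Matrix.smul_vecMulVec, map_smul, smul_comm])
    (fun x y y' => by rw [Matrix.vecMulVec_add, map_add, smul_add])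
    (fun c x y => by rw [Matrix.vecMulVec_smul, map_smul, smul_comm])

theorem symProd_apply (x y : Vec d) (i j : Fin d) :
    (symProd d x y : Matrix (Fin d) (Fin d) ℝ) i j = x i * y j + x j * y i := by
  change (2 : ℝ) • ((1 / 2 : ℝ) • (Matrix.vecMulVec x y + (Matrix.vecMulVec x y)ᵀ) i j) = _
  simp [Matrix.vecMulVec_apply, mul_comm (y i)]

theorem outer_eq_symProd (x : Vec d) : outer x = (1 / 2 : ℝ) • symProd d x x := by
  ext i j
  change x i * x j = (1 / 2 : ℝ) * (symProd d x x : Matrix (Fin d) (Fin d) ℝ) i j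
  rw [symProd_apply]
  ring

theorem symProd_comm (x y : Vec d) : symProd d x y = symProd d y x := by
  ext i j
  rw [symProd_apply, symProd_apply]
  ring

theorem outer_smul (s : ℝ) (x : Vec d) : outer (s • x) = s ^ 2 • outer x := by
  simp only [outer_eq_symProd, map_smul, LinearMap.smul_apply, smul_smul]
  congr 1
  ring

theorem outer_zero : outer (0 : Vec d) = 0 := by
  simp [outer_eq_symProd]

/-- The derivative of `x ↦ x xᵀ` at `x`, that is, `u ↦ x uᵀ + u xᵀ`. -/
def symProdL (x : Vec d) : Vec d →L[ℝ] Sym d := (symProd d).toContinuousBilinearMap x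

theorem hasFDerivAt_outer (x : Vec d) : HasFDerivAt (outer (d := d)) (symProdL x) x := by
  have h := ((symProd d).toContinuousBilinearMap.hasFDerivAt_of_bilinear
    (hasFDerivAt_id x) (hasFDerivAt_id x)).const_smul (1 / 2 : ℝ)
  have he : (outer (d := d)) = fun y => (1 / 2 : ℝ) • (symProd d).toContinuousBilinearMap y y := by
    funext y
    exact outer_eq_symProd y
  rw [he]
  refine h.congr_fderiv ?_
  ext1 u
  change (1 / 2 : ℝ) • (symProd d x u + symProd d u x) = symProd d x u
  rw [symProd_comm u x, ← two_smul ℝ, smul_smul]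
  norm_num

theorem continuous_outer : Continuous (outer (d := d)) :=
  continuous_iff_continuousAt.2 fun x => (hasFDerivAt_outer x).continuousAt

/-- Every symmetric matrix is a combination of symmetric products with the basis vectors. -/
theorem sum_symProd_single (A : Sym d) :
    ∑ i, symProd d (Pi.single i 1)
      ((1 / 2 : ℝ) • fun j => (A : Matrix (Fin d) (Fin d) ℝ) i j) = A := by
  ext k l
  have hs : (A : Matrix (Fin d) (Fin d) ℝ) l k = (A : Matrix (Fin d) (Fin d) ℝ) k l :=
    congrFun (congrFun (show (A : Matrix (Fin d) (Fin d) ℝ)ᵀ = A from A.2) k) l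
  rw [Submodule.coe_sum, Matrix.sum_apply]
  simp only [symProd_apply, Pi.smul_apply, smul_eq_mul, Pi.single_apply]
  simp only [ite_mul, one_mul, zero_mul, Finset.sum_add_distrib, Finset.sum_ite_eq,
    Finset.mem_univ, if_true]
  rw [hs]
  ring

/-- A positive semidefinite symmetric matrix is a sum of `d` rank-one matrices. -/
theorem exists_sum_outer {A : Sym d} (hA : (A : Matrix (Fin d) (Fin d) ℝ).PosSemidef) :
    ∃ x : Fin d → Vec d, A = ∑ i, outer (x i) := by
  refine ⟨fun i j => sqrtMat (A : Matrix (Fin d) (Fin d) ℝ) i j, ?_⟩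
  have h := sqrtMat_mul_self hA
  have hsymm : (sqrtMat (A : Matrix (Fin d) (Fin d) ℝ))ᵀ = sqrtMat A := (sqrtSym A).2
  ext k l
  rw [Submodule.coe_sum, Matrix.sum_apply]
  conv_lhs => rw [← h, Matrix.mul_apply]
  refine Finset.sum_congr rfl fun i _ => ?_
  change _ = sqrtMat (A : Matrix (Fin d) (Fin d) ℝ) i k * sqrtMat (A : Matrix (Fin d) (Fin d) ℝ) i l
  rw [show sqrtMat (A : Matrix (Fin d) (Fin d) ℝ) k i = sqrtMat (A : Matrix (Fin d) (Fin d) ℝ) i k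
    from congrFun (congrFun hsymm i) k]

end SquareRoot

/-! ### The unnormalized system -/

namespace Data

variable {d lam mu : ℕ} (M : Data d lam mu)

/-- The assumptions on the normalized algorithm that do not involve sampling and ranking. -/
structure DynamicsOK : Prop where
  hyper : M.Hyper
  rnorm : M.RNormOK
  rho : M.RhoOK
  stepsize : M.StepsizeOK

/-- The coefficient of the new step in the update of the path `p`. -/
def coefP : ℝ := Real.sqrt (M.cs * (2 - M.cs) * M.mueff)

/-- The coefficient of the new step in the update of the path `q`. -/
def coefQ : ℝ := Real.sqrt (M.cc * (2 - M.cc) * M.mueff)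

/-- The factor `1 - c_1 - c_μ` by which the covariance matrix decays. -/
def decayC : ℝ := 1 - M.c1 - M.cmu

/-- States `(z, p, q, C)` of the system without normalization of the covariance matrix. Such a
state stands for the same sampling distribution as `(s z, p, s q, s² C)` for each `s > 0`. -/
abbrev TState (d : ℕ) := Vec d × Vec d × Vec d × Sym d

/-- The update of the path `p` in the unnormalized system. -/
def stepP (θ : TState d) (w : Vec d) : Vec d :=
  (1 - M.cs) • θ.2.1 + M.coefP • (invSqrt θ.2.2.2 *ᵥ w)

/-- The update of the path `q` in the unnormalized system. -/
def stepQ (θ : TState d) (w : Vec d) : Vec d := (1 - M.cc) • θ.2.2.1 + M.coefQ • w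

/-- One update of the unnormalized system, when the recombined step is `w` and the weighted sum of
the outer products of the steps is `B`. No normalization function `R` or `ρ` enters. -/
def stepWith (θ : TState d) (w : Vec d) (B : Sym d) : TState d :=
  ((M.Gam (M.stepP θ w))⁻¹ • (θ.1 + M.cm • w), M.stepP θ w, M.stepQ θ w,
    M.decayC • θ.2.2.2 + M.c1 • outer (M.stepQ θ w) + M.cmu • B)

/-- The weighted sum of the outer products of the steps. -/
def outerSum (v : Ctrl d mu) : Sym d := ∑ i, M.wc i • outer (v i)

/-- The update of the unnormalized system for a general control. -/
def tstep (θ : TState d) (v : Ctrl d mu) : TState d := M.stepWith θ (M.recomb v) (M.outerSum v)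

/-- The update of the unnormalized system for the control `(w, …, w)`. -/
def dstep (θ : TState d) (w : Vec d) : TState d := M.stepWith θ w (outer w)

/-- The normalized state of an unnormalized one. The additional argument `r` is the last
component of the normalized state, which depends on the preceding covariance matrix. -/
def normalize (θ : TState d) (r : ℝ) : State d :=
  ((Real.sqrt (M.R θ.2.2.2))⁻¹ • θ.1, θ.2.1,
    (Real.sqrt r / Real.sqrt (M.R θ.2.2.2)) • θ.2.2.1, (M.rho θ.2.2.2)⁻¹ • θ.2.2.2, r)

/-- The control all whose components are `w`. -/
def diag (mu : ℕ) (w : Vec d) : Ctrl d mu := fun _ => w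

/-- The rest point with covariance matrix proportional to `A`, which is fixed under the control
`0`. -/
def rest (A : Sym d) : State d := M.normalize (0, 0, 0, A) M.decayC

variable {M}

theorem Hyper.mueff_pos (h : M.Hyper) : 0 < M.mueff := by
  have hs : ∑ i, M.wm i ^ 2 ≠ 0 := by
    intro h0
    have h1 := (Finset.sum_eq_zero_iff_of_nonneg fun i _ => sq_nonneg (M.wm i)).1 h0
    have h2 : ∑ i, M.wm i = 0 := Finset.sum_eq_zero fun i hi => pow_eq_zero_iff two_ne_zero |>.1
      (h1 i hi)
    rw [h.wm_sum] at h2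
    exact one_ne_zero h2
  exact one_div_pos.2 (lt_of_le_of_ne (Finset.sum_nonneg fun i _ => sq_nonneg _) hs.symm)

theorem Hyper.coefP_pos (h : M.Hyper) : 0 < M.coefP :=
  Real.sqrt_pos.2 (mul_pos (mul_pos h.cs_pos (by linarith [h.cs_le])) h.mueff_pos)

theorem Hyper.coefQ_pos (h : M.Hyper) : 0 < M.coefQ :=
  Real.sqrt_pos.2 (mul_pos (mul_pos h.cc_pos (by linarith [h.cc_le])) h.mueff_pos)

theorem Hyper.decayC_pos (h : M.Hyper) : 0 < M.decayC := by
  have := h.c_lt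
  rw [decayC]
  linarith

theorem Hyper.decayC_lt (h : M.Hyper) : M.decayC < 1 := by
  have := h.c_pos
  rw [decayC]
  linarith

/-- The rank-one contribution of one step is positive, as `c₁` and `c_μ` do not both vanish. -/
theorem Hyper.gain_pos (h : M.Hyper) : 0 < M.c1 * M.coefQ ^ 2 + M.cmu := by
  have hb := pow_pos h.coefQ_pos 2
  rcases h.cmu_nonneg.lt_or_eq with h1 | h1
  · exact add_pos_of_nonneg_of_pos (mul_nonneg h.c1_nonneg hb.le) h1
  · have := h.c_pos
    rw [← h1, add_zero] at this ⊢
    exact mul_pos this hb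

theorem Hyper.recomb_diag (h : M.Hyper) (w : Vec d) : M.recomb (diag mu w) = w := by
  simp only [recomb, diag, ← Finset.sum_smul, h.wm_sum, one_smul]

theorem Hyper.outerSum_diag (h : M.Hyper) (w : Vec d) : M.outerSum (diag mu w) = outer w := by
  simp only [outerSum, diag, ← Finset.sum_smul, h.wc_sum, one_smul]

theorem Hyper.tstep_diag (h : M.Hyper) (θ : TState d) (w : Vec d) :
    M.tstep θ (diag mu w) = M.dstep θ w := by
  rw [tstep, dstep, h.recomb_diag, h.outerSum_diag]

theorem recomb_smul (s : ℝ) (v : Ctrl d mu) : M.recomb (s • v) = s • M.recomb v := by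
  simp only [recomb, Finset.smul_sum, Pi.smul_apply, smul_comm s]

theorem outerSum_smul (s : ℝ) (v : Ctrl d mu) : M.outerSum (s • v) = s ^ 2 • M.outerSum v := by
  simp only [outerSum, Finset.smul_sum, Pi.smul_apply, outer_smul, smul_comm (s ^ 2)]

theorem Hyper.outerSum_posSemidef (h : M.Hyper) (v : Ctrl d mu) :
    (M.outerSum v : Matrix (Fin d) (Fin d) ℝ).PosSemidef := by
  rw [outerSum, Submodule.coe_sum]
  exact Matrix.posSemidef_sum _ fun i _ => (outer_posSemidef (v i)).smul (h.wc_pos i).le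

theorem Hyper.tstep_mem (h : M.Hyper) {θ : TState d} (hθ : θ.2.2.2 ∈ posDefCone d)
    (v : Ctrl d mu) : (M.tstep θ v).2.2.2 ∈ posDefCone d :=
  posDefCone_add (posDefCone_add_smul_outer (posDefCone_smul hθ h.decayC_pos) h.c1_nonneg _)
    ((h.outerSum_posSemidef v).smul h.cmu_nonneg)

theorem Hyper.dstep_mem (h : M.Hyper) {θ : TState d} (hθ : θ.2.2.2 ∈ posDefCone d)
    (w : Vec d) : (M.dstep θ w).2.2.2 ∈ posDefCone d := by
  rw [← h.tstep_diag]
  exact h.tstep_mem hθ _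

theorem normCov_normalize (hR : M.RNormOK) (hrho : M.RhoOK) {θ : TState d}
    (hθ : θ.2.2.2 ∈ posDefCone d) (r : ℝ) :
    M.normCov (M.normalize θ r).2.2.2.1 = (M.R θ.2.2.2)⁻¹ • θ.2.2.2 := by
  have h1 := hrho.pos _ hθ
  have h2 := hR.pos _ hθ
  rw [normCov, normalize, hR.homogeneous _ hθ _ (inv_pos.2 h1), smul_smul]
  congr 1
  field_simp

/-- The transition map is conjugate to the unnormalized update, with rescaled controls. -/
theorem DynamicsOK.F_normalize (h : M.DynamicsOK) {θ : TState d} (hθ : θ.2.2.2 ∈ posDefCone d)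
    {r : ℝ} (hr : 0 < r) (v : Ctrl d mu) :
    M.F (M.normalize θ r) v =
      M.normalize (M.tstep θ (Real.sqrt (M.R θ.2.2.2) • v))
        (M.R (M.tstep θ (Real.sqrt (M.R θ.2.2.2) • v)).2.2.2 / M.R θ.2.2.2) := by
  have hRp := h.rnorm.pos _ hθ
  set s := Real.sqrt (M.R θ.2.2.2) with hs
  have hs0 : 0 < s := Real.sqrt_pos.2 hRp
  have hs2 : s ^ 2 = M.R θ.2.2.2 := Real.sq_sqrt hRp.le
  have hsq : (M.R θ.2.2.2)⁻¹ = (s⁻¹) ^ 2 := by rw [← hs2, inv_pow]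
  have hsr : 0 < Real.sqrt r := Real.sqrt_pos.2 hr
  set θ' := M.tstep θ (s • v) with hθ'
  have hmem : θ'.2.2.2 ∈ posDefCone d := h.hyper.tstep_mem hθ _
  have hcov := normCov_normalize h.rnorm h.rho hθ r
  have hP : M.nextP (M.normalize θ r) v = θ'.2.1 := by
    change _ = M.stepP θ (M.recomb (s • v))
    have hi : (sqrtMat (M.normCov (M.normalize θ r).2.2.2.1 : Matrix (Fin d) (Fin d) ℝ))⁻¹ =
        s • invSqrt θ.2.2.2 := by
      rw [hcov]
      change invSqrt ((M.R θ.2.2.2)⁻¹ • θ.2.2.2) = _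
      rw [invSqrt_smul hθ (inv_pos.2 hRp), Real.sqrt_inv, inv_inv]
    rw [nextP, hi, stepP, recomb_smul, Matrix.mulVec_smul, Matrix.smul_mulVec]
    rfl
  have hQ : M.nextQ (M.normalize θ r) v = s⁻¹ • θ'.2.2.1 := by
    change _ = s⁻¹ • M.stepQ θ (M.recomb (s • v))
    rw [stepQ, recomb_smul, smul_add, smul_comm s⁻¹ M.coefQ, smul_smul s⁻¹ s,
      inv_mul_cancel₀ hs0.ne', one_smul]
    rw [nextQ, normalize, ← hs]
    simp only [smul_smul]
    congr 2
    field_simp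
  have hC : M.nextCov (M.normalize θ r) v = (M.R θ.2.2.2)⁻¹ • θ'.2.2.2 := by
    change _ = (M.R θ.2.2.2)⁻¹ • (M.decayC • θ.2.2.2 + M.c1 • outer (M.stepQ θ (M.recomb (s • v)))
      + M.cmu • M.outerSum (s • v))
    have hQ' : M.nextQ (M.normalize θ r) v = s⁻¹ • M.stepQ θ (M.recomb (s • v)) := hQ
    rw [nextCov, hcov, hQ', outer_smul, outerSum_smul, hsq]
    simp only [smul_add, smul_smul]
    congr 1
    · congr 1
      · rw [mul_comm]
        rfl
      · rw [mul_comm]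
    · rw [outerSum]
      congr 1
      field_simp
  have hRC : M.R (M.nextCov (M.normalize θ r) v) = M.R θ'.2.2.2 / M.R θ.2.2.2 := by
    rw [hC, h.rnorm.homogeneous _ hmem _ (inv_pos.2 hRp), div_eq_inv_mul]
  have hRp' := h.rnorm.pos _ hmem
  have hdiv : Real.sqrt (M.R θ'.2.2.2 / M.R θ.2.2.2) = Real.sqrt (M.R θ'.2.2.2) / s := by
    rw [Real.sqrt_div hRp'.le]
  have hsp : 0 < Real.sqrt (M.R θ'.2.2.2) := Real.sqrt_pos.2 hRp'
  have hG : 0 < M.Gam θ'.2.1 := h.stepsize.pos _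
  have hZ : M.nextZ (M.normalize θ r) v = (Real.sqrt (M.R θ'.2.2.2))⁻¹ • θ'.1 := by
    have e1 : θ'.1 = (M.Gam θ'.2.1)⁻¹ • (θ.1 + M.cm • M.recomb (s • v)) := rfl
    have e2 : (M.normalize θ r).1 = s⁻¹ • θ.1 := rfl
    rw [nextZ, hRC, hP, hdiv, e1, e2, recomb_smul]
    simp only [smul_add, smul_smul]
    congr 2 <;> field_simp
  rw [F, hZ, hP, hQ, hRC, hC, h.rho.homogeneous _ hmem _ (inv_pos.2 hRp), normalize, hdiv]
  have hρ := h.rho.pos _ hmem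
  refine Prod.ext rfl (Prod.ext rfl (Prod.ext ?_ (Prod.ext ?_ rfl)))
  · dsimp only
    congr 1
    field_simp
  · dsimp only
    rw [smul_smul]
    congr 1
    field_simp

theorem DynamicsOK.normalize_mem (h : M.DynamicsOK) {θ : TState d}
    (hθ : θ.2.2.2 ∈ posDefCone d) {r : ℝ} (hr : 0 < r) : M.normalize θ r ∈ M.X := by
  have h1 := h.rho.pos _ hθ
  refine ⟨posDefCone_smul hθ (inv_pos.2 h1), ?_, hr⟩
  change M.rho ((M.rho θ.2.2.2)⁻¹ • θ.2.2.2) = 1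
  rw [h.rho.homogeneous _ hθ _ (inv_pos.2 h1), inv_mul_cancel₀ h1.ne']

theorem DynamicsOK.exists_normalize (h : M.DynamicsOK) {θ : State d} (hθ : θ ∈ M.X) :
    ∃ ψ : TState d, ψ.2.2.2 ∈ posDefCone d ∧ 0 < θ.2.2.2.2 ∧
      M.normalize ψ θ.2.2.2.2 = θ := by
  obtain ⟨z, p, q, A, r⟩ := θ
  obtain ⟨hA, hA1, hr⟩ := hθ
  dsimp only at hA hA1 hr
  have h1 := Real.sqrt_pos.2 (h.rnorm.pos _ hA)
  have h2 := Real.sqrt_pos.2 hr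
  refine ⟨(Real.sqrt (M.R A) • z, p, (Real.sqrt (M.R A) / Real.sqrt r) • q, A), hA, hr, ?_⟩
  rw [normalize]
  refine Prod.ext ?_ (Prod.ext rfl (Prod.ext ?_ (Prod.ext ?_ rfl)))
  · dsimp only
    rw [smul_smul, inv_mul_cancel₀ h1.ne', one_smul]
  · dsimp only
    rw [smul_smul, div_mul_div_cancel₀ h1.ne', div_self h2.ne', one_smul]
  · dsimp only
    rw [hA1, inv_one, one_smul]

theorem DynamicsOK.F_mem (h : M.DynamicsOK) {θ : State d} (hθ : θ ∈ M.X) (v : Ctrl d mu) :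
    M.F θ v ∈ M.X := by
  obtain ⟨ψ, hψ, hr, he⟩ := h.exists_normalize hθ
  rw [← he, h.F_normalize hψ hr]
  have hm := h.hyper.tstep_mem hψ (Real.sqrt (M.R ψ.2.2.2) • v)
  exact h.normalize_mem hm (div_pos (h.rnorm.pos _ hm) (h.rnorm.pos _ hψ))

theorem DynamicsOK.F_normalize_diag (h : M.DynamicsOK) {θ : TState d}
    (hθ : θ.2.2.2 ∈ posDefCone d) {r : ℝ} (hr : 0 < r) (w : Vec d) :
    M.F (M.normalize θ r) (diag mu ((Real.sqrt (M.R θ.2.2.2))⁻¹ • w)) =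
      M.normalize (M.dstep θ w) (M.R (M.dstep θ w).2.2.2 / M.R θ.2.2.2) := by
  have h1 := Real.sqrt_pos.2 (h.rnorm.pos _ hθ)
  have h2 : Real.sqrt (M.R θ.2.2.2) • (diag mu ((Real.sqrt (M.R θ.2.2.2))⁻¹ • w) : Ctrl d mu) =
      diag mu w := by
    funext i
    change Real.sqrt (M.R θ.2.2.2) • (Real.sqrt (M.R θ.2.2.2))⁻¹ • w = w
    rw [smul_smul, mul_inv_cancel₀ h1.ne', one_smul]
  rw [h.F_normalize hθ hr, h2, h.hyper.tstep_diag]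

theorem DynamicsOK.normalize_smul (h : M.DynamicsOK) {A : Sym d} (hA : A ∈ posDefCone d) {s : ℝ}
    (hs : 0 < s) (p : Vec d) (r : ℝ) :
    M.normalize (0, p, 0, s • A) r = M.normalize (0, p, 0, A) r := by
  have h1 := h.rho.pos _ hA
  simp only [normalize, smul_zero, h.rho.homogeneous _ hA _ hs, smul_smul]
  refine Prod.ext rfl (Prod.ext rfl (Prod.ext rfl (Prod.ext ?_ rfl)))
  dsimp only
  congr 1
  field_simp

theorem dstep_zero (p : Vec d) (A : Sym d) :
    M.dstep (0, p, 0, A) 0 = (0, (1 - M.cs) • p, 0, M.decayC • A) := by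
  simp [dstep, stepWith, stepP, stepQ, outer_zero]

/-! ### Continuity of the transition maps -/

theorem RNormOK.continuousOn (hR : M.RNormOK) : ContinuousOn M.R (posDefCone d) :=
  hR.locallyLipschitz.continuousOn

theorem RNormOK.continuousAt (hR : M.RNormOK) {A : Sym d} (hA : A ∈ posDefCone d) :
    ContinuousAt M.R A :=
  hR.continuousOn.continuousAt (isOpen_posDefCone.mem_nhds hA)

theorem RhoOK.continuousAt (hrho : M.RhoOK) {A : Sym d} (hA : A ∈ posDefCone d) :
    ContinuousAt M.rho A :=
  hrho.smooth.continuousOn.continuousAt (isOpen_posDefCone.mem_nhds hA)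

theorem RhoOK.differentiableAt (hrho : M.RhoOK) {A : Sym d} (hA : A ∈ posDefCone d) :
    DifferentiableAt ℝ M.rho A :=
  (hrho.smooth.differentiableOn (by simp)).differentiableAt (isOpen_posDefCone.mem_nhds hA)

theorem continuous_recomb : Continuous M.recomb := by
  unfold recomb
  fun_prop

theorem continuousAt_nextP (hR : M.RNormOK) {θ : State d} (hθ : θ ∈ M.X) (v : Ctrl d mu) :
    ContinuousAt (fun x : State d × Ctrl d mu => M.nextP x.1 x.2) (θ, v) := by
  have hA : θ.2.2.2.1 ∈ posDefCone d := hθ.1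
  have hRpos := hR.pos _ hA
  have cA : ContinuousAt (fun x : State d × Ctrl d mu => x.1.2.2.2.1) (θ, v) := by fun_prop
  have cN : ContinuousAt (fun x : State d × Ctrl d mu => M.normCov x.1.2.2.2.1) (θ, v) :=
    ((ContinuousAt.comp' (f := fun x : State d × Ctrl d mu => x.1.2.2.2.1)
      (hR.continuousAt hA) cA).inv₀ hRpos.ne').smul cA
  have cS : ContinuousAt (fun x : State d × Ctrl d mu => invSqrt (M.normCov x.1.2.2.2.1)) (θ, v) :=
    ContinuousAt.comp' (f := fun x : State d × Ctrl d mu => M.normCov x.1.2.2.2.1)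
      (continuousAt_invSqrt (posDefCone_smul hA (inv_pos.2 hRpos))) cN
  have hm : Continuous fun y : Matrix (Fin d) (Fin d) ℝ × Vec d => y.1 *ᵥ y.2 :=
    continuous_fst.matrix_mulVec continuous_snd
  have cw : ContinuousAt (fun x : State d × Ctrl d mu => M.recomb x.2) (θ, v) :=
    (continuous_recomb.comp continuous_snd).continuousAt
  have c1 : ContinuousAt (fun x : State d × Ctrl d mu => (1 - M.cs) • x.1.2.1) (θ, v) := by
    fun_prop
  exact c1.fun_add ((hm.continuousAt.comp (cS.prodMk cw)).fun_const_smul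
    (Real.sqrt (M.cs * (2 - M.cs) * M.mueff)))

theorem continuousAt_nextQ {θ : State d} (hθ : θ ∈ M.X) (v : Ctrl d mu) :
    ContinuousAt (fun x : State d × Ctrl d mu => M.nextQ x.1 x.2) (θ, v) := by
  have c1 : ContinuousAt (fun x : State d × Ctrl d mu => (Real.sqrt x.1.2.2.2.2)⁻¹) (θ, v) :=
    ContinuousAt.inv₀ (Real.continuous_sqrt.comp (by fun_prop)).continuousAt
      (Real.sqrt_pos.2 hθ.2.2).ne'
  have c2 : ContinuousAt (fun x : State d × Ctrl d mu => x.1.2.2.1) (θ, v) := by fun_prop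
  have cw : ContinuousAt (fun x : State d × Ctrl d mu => M.recomb x.2) (θ, v) :=
    (continuous_recomb.comp continuous_snd).continuousAt
  exact ((c1.smul c2).fun_const_smul (1 - M.cc)).fun_add
    (cw.fun_const_smul (Real.sqrt (M.cc * (2 - M.cc) * M.mueff)))

theorem continuous_outerSum : Continuous M.outerSum := by
  refine continuous_finsetSum _ fun i _ => ?_
  exact (continuous_outer.comp (continuous_apply i)).fun_const_smul (M.wc i)

theorem continuousAt_nextCov (hR : M.RNormOK) {θ : State d} (hθ : θ ∈ M.X) (v : Ctrl d mu) :
    ContinuousAt (fun x : State d × Ctrl d mu => M.nextCov x.1 x.2) (θ, v) := by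
  have cA : ContinuousAt (fun x : State d × Ctrl d mu => x.1.2.2.2.1) (θ, v) := by fun_prop
  have cN : ContinuousAt (fun x : State d × Ctrl d mu => M.normCov x.1.2.2.2.1) (θ, v) :=
    ((ContinuousAt.comp' (f := fun x : State d × Ctrl d mu => x.1.2.2.2.1)
      (hR.continuousAt hθ.1) cA).inv₀ (hR.pos _ hθ.1).ne').smul cA
  have cO : ContinuousAt (fun x : State d × Ctrl d mu => M.outerSum x.2) (θ, v) :=
    (continuous_outerSum.comp continuous_snd).continuousAt
  have cQ : ContinuousAt (fun x : State d × Ctrl d mu => outer (M.nextQ x.1 x.2)) (θ, v) :=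
    continuous_outer.continuousAt.comp (continuousAt_nextQ hθ v)
  exact ((cN.fun_const_smul (1 - M.c1 - M.cmu)).fun_add (cQ.fun_const_smul M.c1)).fun_add
    (cO.fun_const_smul M.cmu)

theorem DynamicsOK.nextCov_mem (h : M.DynamicsOK) {θ : State d} (hθ : θ ∈ M.X)
    (v : Ctrl d mu) : M.nextCov θ v ∈ posDefCone d :=
  posDefCone_add (posDefCone_add_smul_outer (posDefCone_smul
    (posDefCone_smul hθ.1 (inv_pos.2 (h.rnorm.pos _ hθ.1))) h.hyper.decayC_pos)
      h.hyper.c1_nonneg _) ((h.hyper.outerSum_posSemidef v).smul h.hyper.cmu_nonneg)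

theorem DynamicsOK.continuousAt_F (h : M.DynamicsOK) {θ : State d} (hθ : θ ∈ M.X)
    (v : Ctrl d mu) : ContinuousAt (fun x : State d × Ctrl d mu => M.F x.1 x.2) (θ, v) := by
  have cP := continuousAt_nextP h.rnorm hθ v
  have cQ := continuousAt_nextQ hθ v
  have cC := continuousAt_nextCov h.rnorm hθ v
  have hCmem := h.nextCov_mem hθ v
  have cRC : ContinuousAt (fun x : State d × Ctrl d mu => M.R (M.nextCov x.1 x.2)) (θ, v) :=
    ContinuousAt.comp' (f := fun x : State d × Ctrl d mu => M.nextCov x.1 x.2)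
      (h.rnorm.continuousAt hCmem) cC
  have cρ : ContinuousAt (fun x : State d × Ctrl d mu => M.rho (M.nextCov x.1 x.2)) (θ, v) :=
    ContinuousAt.comp' (f := fun x : State d × Ctrl d mu => M.nextCov x.1 x.2)
      (h.rho.continuousAt hCmem) cC
  have cG : ContinuousAt (fun x : State d × Ctrl d mu => M.Gam (M.nextP x.1 x.2)) (θ, v) :=
    ContinuousAt.comp' (f := fun x : State d × Ctrl d mu => M.nextP x.1 x.2)
      h.stepsize.locallyLipschitz.continuous.continuousAt cP
  have cw : ContinuousAt (fun x : State d × Ctrl d mu => M.recomb x.2) (θ, v) :=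
    (continuous_recomb.comp continuous_snd).continuousAt
  have cz : ContinuousAt (fun x : State d × Ctrl d mu => x.1.1) (θ, v) := by fun_prop
  have cZ : ContinuousAt (fun x : State d × Ctrl d mu => M.nextZ x.1 x.2) (θ, v) := by
    have cs : ContinuousAt (fun x : State d × Ctrl d mu =>
        (Real.sqrt (M.R (M.nextCov x.1 x.2)) * M.Gam (M.nextP x.1 x.2))⁻¹) (θ, v) :=
      ContinuousAt.inv₀ ((Real.continuous_sqrt.continuousAt.comp cRC).mul cG)
        (mul_pos (Real.sqrt_pos.2 (h.rnorm.pos _ hCmem)) (h.stepsize.pos _)).ne'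
    exact cs.smul (cz.fun_add (cw.fun_const_smul M.cm))
  exact cZ.prodMk (cP.prodMk (cQ.prodMk (((cρ.inv₀ (h.rho.pos _ hCmem).ne').smul cC).prodMk cRC)))

theorem DynamicsOK.S_mem (h : M.DynamicsOK) {θ : State d} (hθ : θ ∈ M.X) :
    ∀ (k : ℕ) (v : Fin k → Ctrl d mu), M.S θ k v ∈ M.X
  | 0, _ => hθ
  | k + 1, _ => h.F_mem (h.S_mem hθ k _) _

theorem DynamicsOK.continuous_S (h : M.DynamicsOK) {θ : State d} (hθ : θ ∈ M.X) :
    ∀ k : ℕ, Continuous fun v : Fin k → Ctrl d mu => M.S θ k v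
  | 0 => continuous_const
  | k + 1 => by
    refine continuous_iff_continuousAt.2 fun v => ?_
    have h1 : Continuous fun v : Fin (k + 1) → Ctrl d mu =>
        M.S θ k fun i => v i.castSucc := (h.continuous_S hθ k).comp (by fun_prop)
    have h2 : Continuous fun v : Fin (k + 1) → Ctrl d mu => v (Fin.last k) := by fun_prop
    exact ContinuousAt.comp
      (f := fun v : Fin (k + 1) → Ctrl d mu => ((M.S θ k fun i => v i.castSucc), v (Fin.last k)))
      (h.continuousAt_F (h.S_mem hθ k _) _) (h1.prodMk h2).continuousAt

end Data

/-! ### The law of the best elements of a sample -/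

theorem comp_append {E F : Type*} {m n : ℕ} (φ : E → F) (a : Fin m → E) (b : Fin n → E) :
    φ ∘ (Fin.append a b) = Fin.append (φ ∘ a) (φ ∘ b) := by
  funext i
  induction i using Fin.addCases with
  | left i => simp
  | right i => simp

section OrderStatistics

variable {E : Type*} [MeasurableSpace E]

theorem lintegral_pi_prod (ν : Measure E) [SigmaFinite ν] :
    ∀ (n : ℕ) (f : Fin n → E → ENNReal), (∀ i, Measurable (f i)) →
      ∫⁻ x, ∏ i, f i (x i) ∂(Measure.pi fun _ : Fin n => ν) = ∏ i, ∫⁻ x, f i x ∂ν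
  | 0, f, _ => by simp
  | n + 1, f, hf => by
    have hm : Measurable fun x : E × (Fin n → E) => f 0 x.1 * ∏ i : Fin n, f i.succ (x.2 i) := by
      refine ((hf 0).comp measurable_fst).mul (Finset.measurable_prod _ fun i _ => ?_)
      exact (hf i.succ).comp ((measurable_pi_apply i).comp measurable_snd)
    have h1 := (measurePreserving_piFinSuccAbove (fun _ : Fin (n + 1) => ν) 0).lintegral_comp hm
    have h2 : ∀ x : Fin (n + 1) → E, ∏ i, f i (x i) =
        f 0 (MeasurableEquiv.piFinSuccAbove (fun _ => E) 0 x).1 *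
          ∏ i : Fin n, f i.succ ((MeasurableEquiv.piFinSuccAbove (fun _ => E) 0 x).2 i) := by
      intro x
      rw [Fin.prod_univ_succ]
      rfl
    simp only [h2]
    rw [h1, Fin.prod_univ_succ, ← lintegral_pi_prod ν n (fun i => f i.succ) fun i => hf i.succ]
    refine lintegral_prod_mul (μ := ν) (ν := Measure.pi fun _ : Fin n => ν)
      (g := fun x => ∏ i : Fin n, f i.succ (x i)) (hf 0).aemeasurable (Measurable.aemeasurable ?_)
    exact Finset.measurable_prod _ fun i _ => (hf i.succ).comp (measurable_pi_apply i)

theorem pi_withDensity (ν : Measure E) [SigmaFinite ν] (n : ℕ) {q : E → ENNReal}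
    (hq : Measurable q) [SigmaFinite (ν.withDensity q)] :
    (Measure.pi fun _ : Fin n => ν.withDensity q) =
      (Measure.pi fun _ : Fin n => ν).withDensity fun x => ∏ i, q (x i) := by
  refine Measure.pi_eq fun s hs => ?_
  rw [withDensity_apply _ (MeasurableSet.univ_pi hs), ← lintegral_indicator
    (MeasurableSet.univ_pi hs)]
  have h1 : ∀ x : Fin n → E, (Set.univ.pi s).indicator (fun x => ∏ i, q (x i)) x =
      ∏ i, (s i).indicator q (x i) := by
    intro x
    by_cases hx : x ∈ Set.univ.pi s
    · rw [indicator_of_mem hx]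
      exact Finset.prod_congr rfl fun i _ => (indicator_of_mem (hx i trivial) q).symm
    · rw [indicator_of_notMem hx]
      obtain ⟨i, hi⟩ : ∃ i, x i ∉ s i := by
        by_contra! h0
        exact hx fun i _ => h0 i
      exact (Finset.prod_eq_zero (Finset.mem_univ i) (indicator_of_notMem hi q)).symm
  simp only [h1]
  rw [lintegral_pi_prod ν n _ fun i => hq.indicator (hs i)]
  refine Finset.prod_congr rfl fun i _ => ?_
  rw [lintegral_indicator (hs i), withDensity_apply _ (hs i)]

theorem measurable_finAppend (m n : ℕ) :
    Measurable fun x : (Fin m → E) × (Fin n → E) => (Fin.append x.1 x.2 : Fin (m + n) → E) := by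
  refine measurable_pi_iff.2 fun i => ?_
  induction i using Fin.addCases with
  | left i =>
    simp only [Fin.append_left]
    exact (measurable_pi_apply i).comp measurable_fst
  | right i =>
    simp only [Fin.append_right]
    exact (measurable_pi_apply i).comp measurable_snd

theorem measurePreserving_finAppend (ν : Measure E) [SigmaFinite ν] (m n : ℕ) :
    MeasurePreserving
      (fun x : (Fin m → E) × (Fin n → E) => (Fin.append x.1 x.2 : Fin (m + n) → E))
      ((Measure.pi fun _ => ν).prod (Measure.pi fun _ => ν)) (Measure.pi fun _ => ν) := by
  refine ⟨measurable_finAppend m n, (Measure.pi_eq fun s hs => ?_).symm⟩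
  rw [Measure.map_apply (measurable_finAppend m n) (MeasurableSet.univ_pi hs)]
  have h1 : (fun x : (Fin m → E) × (Fin n → E) => (Fin.append x.1 x.2 : Fin (m + n) → E)) ⁻¹'
      (Set.univ.pi s) = (Set.univ.pi fun i => s (Fin.castAdd n i)) ×ˢ
        (Set.univ.pi fun i => s (Fin.natAdd m i)) := by
    ext x
    simp only [mem_preimage, mem_univ_pi, mem_prod]
    constructor
    · intro h
      refine ⟨fun i => ?_, fun i => ?_⟩
      · simpa using h (Fin.castAdd n i)
      · simpa using h (Fin.natAdd m i)
    · rintro ⟨h, h'⟩ i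
      induction i using Fin.addCases with
      | left i => simpa using h i
      | right i => simpa using h' i
  rw [h1, Measure.prod_prod, Measure.pi_pi, Measure.pi_pi, Fin.prod_univ_add]

theorem measurePreserving_comp_perm (ν : Measure E) [SigmaFinite ν] {n : ℕ}
    (σ : Equiv.Perm (Fin n)) :
    MeasurePreserving (fun u : Fin n → E => u ∘ σ) (Measure.pi fun _ => ν)
      (Measure.pi fun _ => ν) := by
  have hm : Measurable fun u : Fin n → E => u ∘ σ :=
    measurable_pi_iff.2 fun i => measurable_pi_apply (σ i)
  refine ⟨hm, (Measure.pi_eq fun s hs => ?_).symm⟩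
  rw [Measure.map_apply hm (MeasurableSet.univ_pi hs)]
  have h1 : (fun u : Fin n → E => u ∘ σ) ⁻¹' (Set.univ.pi s) =
      Set.univ.pi fun i => s (σ.symm i) := by
    ext u
    simp only [mem_preimage, mem_univ_pi, Function.comp]
    exact ⟨fun h i => by simpa using h (σ.symm i), fun h i => by simpa using h (σ i)⟩
  rw [h1, Measure.pi_pi]
  exact Equiv.prod_comp σ.symm fun i => ν (s i)

/-- The `m` elements of the sample `u` with the smallest values of `φ`. -/
def best (m n : ℕ) (φ : E → ℝ) (u : Fin (m + n) → E) : Fin m → E :=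
  fun i => u (Tuple.sort (φ ∘ u) (Fin.castAdd n i))

theorem measurableSet_sort_eq {n : ℕ} {φ : E → ℝ} (hφ : Measurable φ) (σ : Equiv.Perm (Fin n)) :
    MeasurableSet {u : Fin n → E | Tuple.sort (φ ∘ u) = σ} := by
  have hc : ∀ i, Measurable fun u : Fin n → E => φ (u i) :=
    fun i => hφ.comp (measurable_pi_apply i)
  have h1 : {u : Fin n → E | Tuple.sort (φ ∘ u) = σ} =
      (⋂ i, ⋂ j, ⋂ (_ : i ≤ j), {u : Fin n → E | φ (u (σ i)) ≤ φ (u (σ j))}) ∩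
      (⋂ i, ⋂ j, ⋂ (_ : i < j), {u : Fin n → E | φ (u (σ i)) = φ (u (σ j)) → σ i < σ j}) := by
    ext u
    simp only [Set.mem_ofPred_eq, mem_inter_iff, mem_iInter]
    rw [eq_comm, Tuple.eq_sort_iff]
    exact Iff.rfl
  rw [h1]
  refine MeasurableSet.inter ?_ ?_
  · exact MeasurableSet.iInter fun i => MeasurableSet.iInter fun j => MeasurableSet.iInter fun _ =>
      measurableSet_le (hc _) (hc _)
  · refine MeasurableSet.iInter fun i => MeasurableSet.iInter fun j => MeasurableSet.iInter
      fun _ => ?_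
    by_cases hij : σ i < σ j
    · simp [hij]
    · simp only [hij, imp_false]
      exact (measurableSet_eq_fun (hc _) (hc _)).compl

theorem measurable_best (m n : ℕ) {φ : E → ℝ} (hφ : Measurable φ) :
    Measurable (best m n φ) := by
  refine measurable_pi_iff.2 fun i s hs => ?_
  have h1 : (fun u => best m n φ u i) ⁻¹' s = ⋃ σ : Equiv.Perm (Fin (m + n)),
      {u : Fin (m + n) → E | Tuple.sort (φ ∘ u) = σ} ∩
        (fun u => u (σ (Fin.castAdd n i))) ⁻¹' s := by
    ext u
    simp only [mem_preimage, mem_iUnion, mem_inter_iff, Set.mem_ofPred_eq, best]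
    exact ⟨fun h => ⟨_, rfl, h⟩, by rintro ⟨σ, rfl, h⟩; exact h⟩
  rw [h1]
  exact MeasurableSet.iUnion fun σ => (measurableSet_sort_eq hφ σ).inter
    (measurable_pi_apply _ hs)

theorem ae_injective_comp (ν : Measure E) [IsProbabilityMeasure ν] (n : ℕ) {φ : E → ℝ}
    (hφ : Measurable φ) (h0 : ∀ c, ν (φ ⁻¹' {c}) = 0) :
    ∀ᵐ u ∂(Measure.pi fun _ : Fin n => ν), Function.Injective (φ ∘ u) := by
  have hpair : ∀ i j : Fin n, i ≠ j →
      ∀ᵐ u ∂(Measure.pi fun _ : Fin n => ν), φ (u i) ≠ φ (u j) := by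
    intro i j hij
    have hind := (ProbabilityTheory.iIndepFun_pi (μ := fun _ : Fin n => ν)
      (X := fun _ => (id : E → E)) fun _ => aemeasurable_id).indepFun hij
    have hmap := (ProbabilityTheory.indepFun_iff_map_prod_eq_prod_map_map
      (measurable_pi_apply i).aemeasurable (measurable_pi_apply j).aemeasurable).1 hind
    have hev : ∀ k : Fin n, (Measure.pi fun _ : Fin n => ν).map (fun u => u k) = ν :=
      fun k => (measurePreserving_eval (fun _ : Fin n => ν) k).map_eq
    have hset : MeasurableSet {x : E × E | φ x.1 = φ x.2} :=
      measurableSet_eq_fun (hφ.comp measurable_fst) (hφ.comp measurable_snd)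
    have hnull : (ν.prod ν) {x : E × E | φ x.1 = φ x.2} = 0 := by
      rw [Measure.measure_prod_null hset]
      refine Eventually.of_forall fun x => ?_
      refine measure_mono_null ?_ (h0 (φ x))
      intro y hy
      exact Eq.symm hy
    have hmap' : (Measure.pi fun _ : Fin n => ν).map (fun u => (u i, u j)) = ν.prod ν := by
      refine hmap.trans ?_
      congr 1
      · exact hev i
      · exact hev j
    rw [← hmap', Measure.map_apply (by fun_prop) hset] at hnull
    exact measure_eq_zero_iff_ae_notMem.1 hnull
  have hall : ∀ᵐ u ∂(Measure.pi fun _ : Fin n => ν), ∀ i j, i ≠ j → φ (u i) ≠ φ (u j) := by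
    refine ae_all_iff.2 fun i => ae_all_iff.2 fun j => ?_
    by_cases hij : i = j
    · exact Eventually.of_forall fun u h => absurd hij h
    · filter_upwards [hpair i j hij] with u hu _ using hu
  filter_upwards [hall] with u hu i j hij
  by_contra hne
  exact hu i j hne hij

theorem measurableSet_strictMono_comp {n : ℕ} {φ : E → ℝ} (hφ : Measurable φ) :
    MeasurableSet {u : Fin n → E | StrictMono (φ ∘ u)} := by
  have h1 : {u : Fin n → E | StrictMono (φ ∘ u)} =
      ⋂ i, ⋂ j, ⋂ (_ : i < j), {u : Fin n → E | φ (u i) < φ (u j)} := by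
    ext u
    simp only [Set.mem_ofPred_eq, mem_iInter]
    exact Iff.rfl
  rw [h1]
  exact MeasurableSet.iInter fun i => MeasurableSet.iInter fun j => MeasurableSet.iInter fun _ =>
    measurableSet_lt (hφ.comp (measurable_pi_apply i)) (hφ.comp (measurable_pi_apply j))

/-- The law of the `m` best elements of a sample, relative to the law of a sample of size `m`:
the density is the number of orders of the sample times the probability that `n` further elements
continue the given `m` ones increasingly. -/
theorem map_best (ν : Measure E) [IsProbabilityMeasure ν] (m n : ℕ) {φ : E → ℝ}
    (hφ : Measurable φ) (h0 : ∀ c, ν (φ ⁻¹' {c}) = 0) :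
    (Measure.pi fun _ : Fin (m + n) => ν).map (best m n φ) =
      (Measure.pi fun _ : Fin m => ν).withDensity fun a =>
        ((m + n).factorial : ENNReal) * (Measure.pi fun _ : Fin n => ν)
          {b | StrictMono (Fin.append (φ ∘ a) (φ ∘ b))} := by
  ext B hB
  set T : Set (Fin (m + n) → E) := {u | StrictMono (φ ∘ u)} ∩
    (fun u i => u (Fin.castAdd n i)) ⁻¹' B with hT
  have hmT : Measurable fun (u : Fin (m + n) → E) (i : Fin m) => u (Fin.castAdd n i) :=
    measurable_pi_iff.2 fun i => measurable_pi_apply _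
  have hTm : MeasurableSet T := (measurableSet_strictMono_comp hφ).inter (hmT hB)
  have hsort : ∀ (σ : Equiv.Perm (Fin (m + n))) (u : Fin (m + n) → E),
      StrictMono (φ ∘ (u ∘ σ)) → Tuple.sort (φ ∘ u) = σ := by
    intro σ u hu
    symm
    rw [Tuple.eq_sort_iff]
    exact ⟨hu.monotone, fun i j hij he => absurd he (hu hij).ne⟩
  -- almost surely there are no ties, and then the sample is increasing in a unique order
  have hdecomp : (best m n φ) ⁻¹' B =ᵐ[Measure.pi fun _ : Fin (m + n) => ν]
      ⋃ σ : Equiv.Perm (Fin (m + n)), (fun u => u ∘ σ) ⁻¹' T := by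
    filter_upwards [ae_injective_comp ν (m + n) hφ h0] with u hu
    refine propext ?_
    change best m n φ u ∈ B ↔ u ∈ ⋃ σ : Equiv.Perm (Fin (m + n)), (fun u => u ∘ σ) ⁻¹' T
    simp only [mem_iUnion, mem_preimage]
    constructor
    · intro hb
      refine ⟨Tuple.sort (φ ∘ u), ?_, hb⟩
      exact (Tuple.monotone_sort (φ ∘ u)).strictMono_of_injective
        (hu.comp (Equiv.injective _))
    · rintro ⟨σ, hσ, hb⟩
      have := hsort σ u hσ
      change (fun i => u (Tuple.sort (φ ∘ u) (Fin.castAdd n i))) ∈ B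
      rw [this]
      exact hb
  have hdisj : Pairwise (Function.onFun Disjoint
      fun σ : Equiv.Perm (Fin (m + n)) => (fun u : Fin (m + n) → E => u ∘ σ) ⁻¹' T) := by
    intro σ τ hne
    refine Set.disjoint_left.2 fun u hσ hτ => hne ?_
    rw [← hsort σ u hσ.1, ← hsort τ u hτ.1]
  rw [Measure.map_apply (measurable_best m n hφ) hB, measure_congr hdecomp,
    measure_iUnion hdisj fun σ => (measurePreserving_comp_perm ν σ).measurable hTm]
  simp only [(measurePreserving_comp_perm ν _).measure_preimage hTm.nullMeasurableSet]
  rw [tsum_fintype, Finset.sum_const, Finset.card_univ, Fintype.card_perm, Fintype.card_fin,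
    nsmul_eq_mul, ← (measurePreserving_finAppend ν m n).measure_preimage hTm.nullMeasurableSet,
    Measure.prod_apply ((measurable_finAppend m n) hTm), withDensity_apply _ hB]
  rw [lintegral_const_mul' _ _ (ENNReal.natCast_ne_top _), ← lintegral_indicator hB]
  congr 1
  refine lintegral_congr fun a => ?_
  by_cases ha : a ∈ B
  · rw [indicator_of_mem ha]
    congr 1
    ext b
    simp only [mem_preimage, hT, mem_inter_iff, Set.mem_ofPred_eq, comp_append, Fin.append_left]
    exact ⟨fun h => h.1, fun h => ⟨h, ha⟩⟩
  · rw [indicator_of_notMem ha]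
    convert measure_empty (μ := Measure.pi fun _ : Fin n => ν)
    ext b
    simp only [mem_preimage, hT, mem_inter_iff, Fin.append_left, mem_empty_iff_false,
      iff_false]
    exact fun h => ha h.2

end OrderStatistics

/-! ### Densities of the selected steps -/

section LinearImage

variable {d : ℕ}

theorem continuous_mulVec (A : Matrix (Fin d) (Fin d) ℝ) : Continuous fun x : Vec d => A *ᵥ x :=
  Continuous.matrix_mulVec continuous_const continuous_id

theorem map_mulVec_volume {A : Matrix (Fin d) (Fin d) ℝ} (hA : IsUnit A.det) :
    (volume : Measure (Vec d)).map (fun x => A *ᵥ x) = ENNReal.ofReal |(A⁻¹).det| • volume := by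
  have h := Real.map_matrix_volume_pi_eq_smul_volume_pi hA.ne_zero
  rw [Matrix.det_nonsing_inv, Ring.inverse_eq_inv', ← h]
  rfl

/-- The image under an invertible matrix `A` of the measure with density `g` has the density
`|det A⁻¹| g(A⁻¹ y)`. -/
theorem map_mulVec_withDensity {A : Matrix (Fin d) (Fin d) ℝ} (hA : IsUnit A.det)
    {g : Vec d → ℝ} (hg : Continuous g) :
    ((volume : Measure (Vec d)).withDensity fun x => ENNReal.ofReal (g x)).map
      (fun x => A *ᵥ x) =
      volume.withDensity fun y => ENNReal.ofReal (|(A⁻¹).det| * g (A⁻¹ *ᵥ y)) := by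
  have hm : Measurable fun x : Vec d => A *ᵥ x := (continuous_mulVec A).measurable
  have hm' : Measurable fun y : Vec d => ENNReal.ofReal (g (A⁻¹ *ᵥ y)) :=
    (hg.comp (continuous_mulVec A⁻¹)).measurable.ennreal_ofReal
  ext B hB
  rw [Measure.map_apply hm hB, withDensity_apply _ (hm hB), withDensity_apply _ hB]
  have h1 : ∀ x : Vec d, ENNReal.ofReal (g x) = ENNReal.ofReal (g (A⁻¹ *ᵥ (A *ᵥ x))) := by
    intro x
    rw [Matrix.mulVec_mulVec, Matrix.nonsing_inv_mul _ hA, Matrix.one_mulVec]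
  simp only [ENNReal.ofReal_mul (abs_nonneg _)]
  rw [lintegral_const_mul _ hm', lintegral_congr h1, ← setLIntegral_map hB hm' hm,
    map_mulVec_volume hA, Measure.restrict_smul, lintegral_smul_measure, smul_eq_mul]

end LinearImage

/-- Near each point, a continuous function on `ℝ^d` with negligible level sets takes any number of
values in strictly increasing order. -/
theorem exists_strictMono_near {d : ℕ} {φ : Vec d → ℝ} (hφ : Continuous φ)
    (h0 : ∀ c, volume (φ ⁻¹' {c}) = 0) (x : Vec d) {δ : ℝ} (hδ : 0 < δ) (n : ℕ) :
    ∃ y : Fin n → Vec d, (∀ i, y i ∈ Metric.ball x δ) ∧ StrictMono (φ ∘ y) := by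
  obtain ⟨x', hx', hne⟩ : ∃ x' ∈ Metric.ball x δ, φ x' ≠ φ x := by
    by_contra! hc
    have h1 : Metric.ball x δ ⊆ φ ⁻¹' {φ x} := fun y hy => hc y hy
    exact (Metric.measure_ball_pos volume x hδ).ne' (measure_mono_null h1 (h0 _))
  have hconn : (φ '' Metric.ball x δ).OrdConnected :=
    ((convex_ball x δ).isPreconnected.image φ hφ.continuousOn).ordConnected
  have hsub : Icc (min (φ x) (φ x')) (max (φ x) (φ x')) ⊆ φ '' Metric.ball x δ := by
    rw [← uIcc]
    exact hconn.uIcc_subset ⟨x, Metric.mem_ball_self hδ, rfl⟩ ⟨x', hx', rfl⟩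
  have hlt : min (φ x) (φ x') < max (φ x) (φ x') := min_lt_max.2 hne.symm
  set a := min (φ x) (φ x')
  set b := max (φ x) (φ x')
  have hn : (0 : ℝ) < n + 1 := by positivity
  have hval : ∀ i : Fin n, a + (b - a) * ((i : ℝ) / (n + 1)) ∈ Icc a b := by
    intro i
    have h1 : (0 : ℝ) ≤ (i : ℝ) / (n + 1) := by positivity
    have h2 : (i : ℝ) / (n + 1) ≤ 1 := by
      rw [div_le_one hn]
      have : (i : ℝ) < n := by exact_mod_cast i.2
      linarith
    constructor <;> nlinarith
  choose y hy hy' using fun i : Fin n => hsub (hval i)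
  refine ⟨y, hy, fun i j hij => ?_⟩
  have hij' : (i : ℝ) < j := by exact_mod_cast hij
  simp only [Function.comp, hy']
  have : (i : ℝ) / (n + 1) < (j : ℝ) / (n + 1) := by gcongr
  nlinarith

namespace Data

variable {d mu n : ℕ} {M : Data d (mu + n) mu}

theorem DynamicsOK.normCov_mem {lam : ℕ} {M : Data d lam mu} (h : M.DynamicsOK) {θ : State d}
    (hθ : θ ∈ M.X) : M.normCov θ.2.2.2.1 ∈ posDefCone d :=
  posDefCone_smul hθ.1 (inv_pos.2 (h.rnorm.pos _ hθ.1))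

theorem DynamicsOK.continuousAt_normCov {lam : ℕ} {M : Data d lam mu} (h : M.DynamicsOK)
    {θ : State d} (hθ : θ ∈ M.X) :
    ContinuousAt (fun ψ : State d => M.normCov ψ.2.2.2.1) θ := by
  have cA : ContinuousAt (fun x : State d => x.2.2.2.1) θ := by fun_prop
  exact ((ContinuousAt.comp' (f := fun x : State d => x.2.2.2.1)
    (h.rnorm.continuousAt hθ.1) cA).inv₀ (h.rnorm.pos _ hθ.1).ne').smul cA

/-- The density of `√Σ U` with `U` of density `g`, where `Σ` is the covariance matrix at `θ`. -/
def stepDensity (M : Data d (mu + n) mu) (g : Vec d → ℝ) (θ : State d) (y : Vec d) : ℝ :=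
  |(invSqrt (M.normCov θ.2.2.2.1)).det| * g (invSqrt (M.normCov θ.2.2.2.1) *ᵥ y)

/-- The value of the (continuous) objective function at the step `y` from the mean of `θ`. -/
def objective (M : Data d (mu + n) mu) (φ : Vec d → ℝ) (θ : State d) (y : Vec d) : ℝ :=
  φ (M.xstar + θ.1 + y)

/-- The probability that `n` further steps continue the steps `v` with increasing values. -/
def tailProb (M : Data d (mu + n) mu) (φ : Vec d → ℝ) (θ : State d) (v : Ctrl d mu) : ENNReal :=
  (Measure.pi fun _ : Fin n => M.P) {u | StrictMono (Fin.append (M.objective φ θ ∘ v)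
    (M.objective φ θ ∘ fun j => sqrtMat (M.normCov θ.2.2.2.1 : Matrix (Fin d) (Fin d) ℝ) *ᵥ u j))}

/-- The density of the selected steps. -/
def selDensity (M : Data d (mu + n) mu) (φ g : Vec d → ℝ) (θ : State d) (v : Ctrl d mu) : ℝ :=
  (∏ i, M.stepDensity g θ (v i)) * ((mu + n).factorial * (M.tailProb φ θ v).toReal)

theorem alpha_eq_best {φ : Vec d → ℝ} {g : ℝ → ℝ} (hg : StrictMonoOn g (range φ)) (hf : M.f = g ∘ φ)
    (h : mu ≤ mu + n) (θ : State d) (u : Fin (mu + n) → Vec d) :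
    M.alpha h θ u = best mu n (M.objective φ θ)
      (fun j => sqrtMat (M.normCov θ.2.2.2.1 : Matrix (Fin d) (Fin d) ℝ) *ᵥ u j) := by
  set A := sqrtMat (M.normCov θ.2.2.2.1 : Matrix (Fin d) (Fin d) ℝ) with hA
  have hsort : Tuple.sort (fun j => M.f (M.xstar + θ.1 + A *ᵥ u j)) =
      Tuple.sort (M.objective φ θ ∘ fun j => A *ᵥ u j) := by
    rw [Tuple.eq_sort_iff]
    set s := Tuple.sort (fun j => M.f (M.xstar + θ.1 + A *ᵥ u j)) with hs
    obtain ⟨h1, h2⟩ := Tuple.eq_sort_iff.1 hs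
    refine ⟨fun i j hij => ?_, fun i j hij he => h2 i j hij ?_⟩
    · have := h1 hij
      simp only [Function.comp, hf] at this
      exact (hg.le_iff_le (mem_range_self _) (mem_range_self _)).1 this
    · rw [hf]
      exact congrArg g he
  funext i
  rw [alpha, best, ← hA, hsort]
  rfl

/-- The law of the selected steps has the density `selDensity`. -/
theorem map_alpha_eq (h : M.DynamicsOK) {φ ψ : Vec d → ℝ} {g : ℝ → ℝ}
    (hφ : Continuous φ) (h0 : ∀ c, volume (φ ⁻¹' {c}) = 0) (hg : StrictMonoOn g (range φ)) (hf : M.f = g ∘ φ)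
    (hprob : IsProbabilityMeasure M.P) (hψ : Continuous ψ) (hψpos : ∀ x, 0 < ψ x)
    (hP : M.P = volume.withDensity fun x => ENNReal.ofReal (ψ x))
    (hle : mu ≤ mu + n) {θ : State d} (hθ : θ ∈ M.X) :
    (Measure.pi fun _ : Fin (mu + n) => M.P).map (M.alpha hle θ) =
      volume.withDensity fun v => ENNReal.ofReal (M.selDensity φ ψ θ v) := by
  set A := sqrtMat (M.normCov θ.2.2.2.1 : Matrix (Fin d) (Fin d) ℝ) with hA
  have hAdet : IsUnit A.det := sqrtMat_isUnit_det (h.normCov_mem hθ)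
  have hAm : Measurable fun x : Vec d => A *ᵥ x := (continuous_mulVec A).measurable
  set ν : Measure (Vec d) := M.P.map fun x => A *ᵥ x with hν
  have : IsProbabilityMeasure ν := Measure.isProbabilityMeasure_map hAm.aemeasurable
  have hνd : ν = volume.withDensity fun y => ENNReal.ofReal (M.stepDensity ψ θ y) := by
    rw [hν, hP, map_mulVec_withDensity hAdet hψ]
    rfl
  have hobj : Continuous (M.objective φ θ) := by
    unfold objective
    fun_prop
  have hnull : ∀ c, ν (M.objective φ θ ⁻¹' {c}) = 0 := by
    intro c
    rw [hνd]
    refine withDensity_absolutelyContinuous _ _ ?_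
    have : M.objective φ θ ⁻¹' {c} = (fun y => (M.xstar + θ.1) + y) ⁻¹' (φ ⁻¹' {c}) := rfl
    rw [this, measure_preimage_add, h0]
  have hpi : ∀ k : ℕ, (Measure.pi fun _ : Fin k => M.P).map (fun u j => A *ᵥ u j) =
      Measure.pi fun _ : Fin k => ν := by
    intro k
    have : ∀ i : Fin k, SigmaFinite ((fun _ : Fin k => M.P.map fun x => A *ᵥ x) i) :=
      fun i => (inferInstance : SigmaFinite ν)
    exact Measure.pi_map_pi (μ := fun _ : Fin k => M.P) (f := fun _ x => A *ᵥ x)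
      fun _ => hAm.aemeasurable
  have hmk : ∀ k : ℕ, Measurable fun (u : Fin k → Vec d) (j : Fin k) => A *ᵥ u j :=
    fun k => measurable_pi_iff.2 fun j => hAm.comp (measurable_pi_apply j)
  have halpha : M.alpha hle θ = best mu n (M.objective φ θ) ∘ fun u j => A *ᵥ u j := by
    funext u
    exact alpha_eq_best hg hf hle θ u
  have hqm : Measurable fun y => ENNReal.ofReal (M.stepDensity ψ θ y) := by
    refine Measurable.ennreal_ofReal (Continuous.measurable ?_)
    exact continuous_const.mul (hψ.comp (continuous_mulVec _))
  have : SigmaFinite ((volume : Measure (Vec d)).withDensity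
      fun y => ENNReal.ofReal (M.stepDensity ψ θ y)) := by
    rw [← hνd]
    infer_instance
  rw [halpha, ← Measure.map_map (measurable_best mu n hobj.measurable) (hmk _), hpi,
    map_best ν mu n hobj.measurable hnull]
  have hpid : (Measure.pi fun _ : Fin mu => ν) = (volume : Measure (Ctrl d mu)).withDensity
      fun x => ∏ i, ENNReal.ofReal (M.stepDensity ψ θ (x i)) := by
    have := pi_withDensity (volume : Measure (Vec d)) mu hqm
    rw [← hνd] at this
    exact this
  have htail : ∀ a : Ctrl d mu, (Measure.pi fun _ : Fin n => ν)
      {b | StrictMono (Fin.append (M.objective φ θ ∘ a) (M.objective φ θ ∘ b))} =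
      M.tailProb φ θ a := by
    intro a
    rw [← hpi n, Measure.map_apply (hmk n)]
    · rfl
    · have hm2 : Measurable fun b : Fin n → Vec d =>
          (Fin.append a b : Fin (mu + n) → Vec d) :=
        (measurable_finAppend mu n).comp (measurable_const.prodMk measurable_id)
      have := hm2 (measurableSet_strictMono_comp hobj.measurable)
      simpa only [preimage, Set.mem_ofPred_eq, comp_append] using this
  simp only [htail]
  have hKm : Measurable fun a : Ctrl d mu =>
      ((mu + n).factorial : ENNReal) * M.tailProb φ θ a := by
    refine Measurable.const_mul ?_ _
    have hset : MeasurableSet {x : (Fin mu → Vec d) × (Fin n → Vec d) |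
        StrictMono (M.objective φ θ ∘ (Fin.append x.1 x.2 : Fin (mu + n) → Vec d))} :=
      measurable_finAppend mu n (measurableSet_strictMono_comp hobj.measurable)
    have hm3 := measurable_measure_prodMk_left (ν := Measure.pi fun _ : Fin n => ν) hset
    convert hm3 using 2 with a
    rw [← htail]
    congr 1
    ext b
    simp only [mem_preimage, Set.mem_ofPred_eq, comp_append]
  have hqpm : Measurable fun x : Ctrl d mu => ∏ i, ENNReal.ofReal (M.stepDensity ψ θ (x i)) :=
    Finset.measurable_prod _ fun i _ => hqm.comp (measurable_pi_apply i)
  rw [hpid, ← withDensity_mul _ hqpm hKm]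
  congr 1
  funext v
  have hq0 : ∀ i, 0 ≤ M.stepDensity ψ θ (v i) := fun i =>
    mul_nonneg (abs_nonneg _) (hψpos _).le
  have hfin : M.tailProb φ θ v ≠ ⊤ := measure_ne_top _ _
  rw [selDensity, ENNReal.ofReal_mul (Finset.prod_nonneg fun i _ => hq0 i),
    ENNReal.ofReal_prod_of_nonneg fun i _ => hq0 i, ENNReal.ofReal_mul (by positivity),
    ENNReal.ofReal_toReal hfin, ENNReal.ofReal_natCast]
  rfl

theorem _root_.CMAES.isOpen_strictMono (m : ℕ) : IsOpen {x : Fin m → ℝ | StrictMono x} := by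
  have h1 : {x : Fin m → ℝ | StrictMono x} = ⋂ i, ⋂ j, ⋂ (_ : i < j), {x | x i < x j} := by
    ext x
    simp only [Set.mem_ofPred_eq, mem_iInter]
    exact Iff.rfl
  rw [h1]
  exact isOpen_iInter_of_finite fun i => isOpen_iInter_of_finite fun j =>
    isOpen_iInter_of_finite fun _ => isOpen_lt (continuous_apply i) (continuous_apply j)

theorem _root_.CMAES.continuous_finAppend {F : Type*} [TopologicalSpace F] (m k : ℕ) :
    Continuous fun x : (Fin m → F) × (Fin k → F) => (Fin.append x.1 x.2 : Fin (m + k) → F) := by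
  refine continuous_pi fun i => ?_
  induction i using Fin.addCases with
  | left i =>
    simp only [Fin.append_left]
    fun_prop
  | right i =>
    simp only [Fin.append_right]
    fun_prop

/-- Lower semicontinuity: a compact part of the event persists under small perturbations. -/
theorem eventually_lt_tailProb (h : M.DynamicsOK) {φ : Vec d → ℝ} (hφ : Continuous φ)
    (hprob : IsProbabilityMeasure M.P) {θ : State d} (hθ : θ ∈ M.X) (v : Ctrl d mu) {c : ENNReal}
    (hc : c < M.tailProb φ θ v) :
    ∀ᶠ x : State d × Ctrl d mu in 𝓝 (θ, v), c < M.tailProb φ x.1 x.2 := by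
  set G : (State d × Ctrl d mu) × (Fin n → Vec d) → Fin (mu + n) → ℝ := fun x =>
    Fin.append (M.objective φ x.1.1 ∘ x.1.2) (M.objective φ x.1.1 ∘ fun j =>
      sqrtMat (M.normCov x.1.1.2.2.2.1 : Matrix (Fin d) (Fin d) ℝ) *ᵥ x.2 j) with hG
  have hGc : ∀ u, ContinuousAt G ((θ, v), u) := by
    intro u
    have c1 : Continuous fun x : (State d × Ctrl d mu) × (Fin n → Vec d) =>
        M.objective φ x.1.1 ∘ x.1.2 := by
      refine continuous_pi fun i => ?_
      simp only [Function.comp, objective]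
      fun_prop
    have c2 : ContinuousAt (fun x : (State d × Ctrl d mu) × (Fin n → Vec d) =>
        sqrtMat (M.normCov x.1.1.2.2.2.1 : Matrix (Fin d) (Fin d) ℝ)) ((θ, v), u) := by
      have c3 : ContinuousAt (fun x : (State d × Ctrl d mu) × (Fin n → Vec d) =>
          M.normCov x.1.1.2.2.2.1) ((θ, v), u) :=
        ContinuousAt.comp' (f := fun x : (State d × Ctrl d mu) × (Fin n → Vec d) => x.1.1)
          (h.continuousAt_normCov hθ) (by fun_prop)
      exact ContinuousAt.comp' (f := fun x : (State d × Ctrl d mu) × (Fin n → Vec d) =>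
          M.normCov x.1.1.2.2.2.1) (continuousAt_sqrtMat (h.normCov_mem hθ)) c3
    have c4 : ContinuousAt (fun x : (State d × Ctrl d mu) × (Fin n → Vec d) =>
        M.objective φ x.1.1 ∘ fun j =>
          sqrtMat (M.normCov x.1.1.2.2.2.1 : Matrix (Fin d) (Fin d) ℝ) *ᵥ x.2 j) ((θ, v), u) := by
      refine continuousAt_pi.2 fun j => hφ.continuousAt.comp ?_
      have hm : Continuous fun y : Matrix (Fin d) (Fin d) ℝ × Vec d => y.1 *ᵥ y.2 :=
        continuous_fst.matrix_mulVec continuous_snd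
      have c5 : ContinuousAt (fun x : (State d × Ctrl d mu) × (Fin n → Vec d) => x.2 j)
          ((θ, v), u) := by fun_prop
      have c6 : ContinuousAt (fun x : (State d × Ctrl d mu) × (Fin n → Vec d) =>
          M.xstar + x.1.1.1) ((θ, v), u) := by fun_prop
      exact c6.add (hm.continuousAt.comp (c2.prodMk c5))
    exact (continuous_finAppend mu n).continuousAt.comp (c1.continuousAt.prodMk c4)
  have hopen : IsOpen {u : Fin n → Vec d | StrictMono (G ((θ, v), u))} := by
    have hc' : Continuous fun u => G ((θ, v), u) :=
      continuous_iff_continuousAt.2 fun u => (hGc u).comp (by fun_prop)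
    exact (isOpen_strictMono _).preimage hc'
  obtain ⟨K, hK, hKc, hcK⟩ := hopen.exists_lt_isCompact (μ := Measure.pi fun _ : Fin n => M.P) hc
  have hev : ∀ᶠ x : State d × Ctrl d mu in 𝓝 (θ, v), ∀ u ∈ K, StrictMono (G (x, u)) := by
    refine hKc.eventually_forall_of_forall_eventually fun u hu => ?_
    exact (hGc u).eventually ((isOpen_strictMono _).mem_nhds (hK hu))
  filter_upwards [hev] with x hx
  exact hcK.trans_le (measure_mono hx)

theorem continuousAt_stepDensity (h : M.DynamicsOK) {ψ : Vec d → ℝ} (hψ : Continuous ψ)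
    {θ : State d} (hθ : θ ∈ M.X) (v : Ctrl d mu) :
    ContinuousAt (fun x : State d × Ctrl d mu => ∏ i, M.stepDensity ψ x.1 (x.2 i)) (θ, v) := by
  have cS : ContinuousAt (fun x : State d × Ctrl d mu => invSqrt (M.normCov x.1.2.2.2.1)) (θ, v) :=
    ContinuousAt.comp' (f := fun x : State d × Ctrl d mu => M.normCov x.1.2.2.2.1)
      (continuousAt_invSqrt (h.normCov_mem hθ))
      (ContinuousAt.comp' (f := fun x : State d × Ctrl d mu => x.1)
        (h.continuousAt_normCov hθ) (by fun_prop))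
  have hdet : Continuous fun X : Matrix (Fin d) (Fin d) ℝ => |X.det| :=
    (contDiff_matrix_det.continuous).abs
  have hm : Continuous fun y : Matrix (Fin d) (Fin d) ℝ × Vec d => y.1 *ᵥ y.2 :=
    continuous_fst.matrix_mulVec continuous_snd
  refine tendsto_finsetProd _ fun i _ => ?_
  have c5 : ContinuousAt (fun x : State d × Ctrl d mu => x.2 i) (θ, v) := by fun_prop
  exact (hdet.continuousAt.comp cS).mul
    (hψ.continuousAt.comp (hm.continuousAt.comp (cS.prodMk c5)))

theorem stepDensity_pos (h : M.DynamicsOK) {ψ : Vec d → ℝ} (hψpos : ∀ x, 0 < ψ x)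
    {θ : State d} (hθ : θ ∈ M.X) (y : Vec d) : 0 < M.stepDensity ψ θ y := by
  refine mul_pos (abs_pos.2 ?_) (hψpos _)
  exact ((Matrix.isUnit_nonsing_inv_det_iff).2 (sqrtMat_isUnit_det (h.normCov_mem hθ))).ne_zero

theorem lowerSemicontinuousOn_selDensity (h : M.DynamicsOK) {φ ψ : Vec d → ℝ} (hφ : Continuous φ)
    (hprob : IsProbabilityMeasure M.P) (hψ : Continuous ψ) (hψpos : ∀ x, 0 < ψ x) :
    LowerSemicontinuousOn (fun x : State d × Ctrl d mu => M.selDensity φ ψ x.1 x.2)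
      (M.X ×ˢ univ) := by
  rintro ⟨θ, v⟩ ⟨hθ, -⟩ y hy
  refine Filter.Eventually.filter_mono nhdsWithin_le_nhds ?_
  dsimp only at hθ hy
  set a := ∏ i, M.stepDensity ψ θ (v i) with ha
  have ha0 : 0 < a := Finset.prod_pos fun i _ => stepDensity_pos h hψpos hθ _
  have hca := continuousAt_stepDensity h hψ hθ v
  have hapos := hca.eventually (lt_mem_nhds ha0)
  rcases lt_or_ge y 0 with hy0 | hy0
  · filter_upwards [hapos] with x hx
    exact hy0.trans_le (mul_nonneg hx.le (by positivity))
  set t := (M.tailProb φ θ v).toReal with ht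
  have hN : (0 : ℝ) < (mu + n).factorial := by exact_mod_cast Nat.factorial_pos _
  -- split the inequality `y < a (N t)` into inequalities for the two factors
  have hy' : y < a * ((mu + n).factorial * t) := hy
  have htpos : 0 < t := by
    by_contra! h0
    have : t = 0 := le_antisymm h0 ENNReal.toReal_nonneg
    rw [this, mul_zero, mul_zero] at hy'
    exact absurd hy' (not_lt.2 hy0)
  obtain ⟨c, hc, hct⟩ : ∃ c, y / (a * (mu + n).factorial) < c ∧ c < t := by
    refine exists_between ?_
    rw [div_lt_iff₀ (mul_pos ha0 hN)]
    linarith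
  have hc0 : 0 < c := lt_of_le_of_lt (div_nonneg hy0 (mul_pos ha0 hN).le) hc
  have h1 : ∀ᶠ x : State d × Ctrl d mu in 𝓝 (θ, v),
      y / ((mu + n).factorial * c) < ∏ i, M.stepDensity ψ x.1 (x.2 i) := by
    refine hca.eventually (lt_mem_nhds ?_)
    rw [div_lt_iff₀ (mul_pos ha0 hN)] at hc
    change _ < a
    rw [div_lt_iff₀ (mul_pos hN hc0)]
    linarith
  have h2 := eventually_lt_tailProb h hφ hprob hθ v
    ((ENNReal.ofReal_lt_iff_lt_toReal hc0.le (measure_ne_top _ _)).2 hct)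
  filter_upwards [h1, h2] with x hx1 hx2
  have h3 : c < (M.tailProb φ x.1 x.2).toReal :=
    (ENNReal.ofReal_lt_iff_lt_toReal hc0.le (measure_ne_top _ _)).1 hx2
  rw [div_lt_iff₀ (mul_pos hN hc0)] at hx1
  have hp : 0 ≤ ∏ i, M.stepDensity ψ x.1 (x.2 i) := by
    by_contra! hneg
    have := mul_neg_of_neg_of_pos hneg (mul_pos hN hc0)
    linarith
  refine hx1.trans_le (mul_le_mul_of_nonneg_left ?_ hp)
  exact mul_le_mul_of_nonneg_left h3.le hN.le

/-- Near each control `(w, …, w)` there are controls at which a given density is positive. -/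
theorem exists_density_pos_of_add (h : M.DynamicsOK) (hf : M.ObjectiveOK) (hP : M.SamplingOK)
    (hle : mu ≤ mu + n) {p : State d → Ctrl d mu → ℝ} (hp : M.IsLscDensity hle p)
    {θ : State d} (hθ : θ ∈ M.X) (w : Vec d) {N : Set (Ctrl d mu)} (hN : N ∈ 𝓝 (diag mu w)) :
    ∃ v ∈ N, 0 < p θ v := by
  obtain ⟨φ, g, hφ, h0, hg, hfe⟩ := hf.negligible_level_sets
  obtain ⟨ψ, hψ, hψpos, hPe⟩ := hP.density
  have hprob := hP.isProb
  obtain ⟨ε, hε, hεN⟩ := Metric.mem_nhds_iff.1 hN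
  have hobj : Continuous (M.objective φ θ) := by
    unfold objective
    fun_prop
  have hobj0 : ∀ c, volume (M.objective φ θ ⁻¹' {c}) = 0 := by
    intro c
    have : M.objective φ θ ⁻¹' {c} = (fun y => (M.xstar + θ.1) + y) ⁻¹' (φ ⁻¹' {c}) := rfl
    rw [this, measure_preimage_add, h0]
  obtain ⟨y, hy, hmono⟩ := exists_strictMono_near hobj hobj0 w (half_pos hε) (mu + n)
  set A := sqrtMat (M.normCov θ.2.2.2.1 : Matrix (Fin d) (Fin d) ℝ) with hA
  have hAdet : IsUnit A.det := sqrtMat_isUnit_det (h.normCov_mem hθ)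
  set v₀ : Ctrl d mu := fun i => y (Fin.castAdd n i) with hv₀
  have hv₀N : v₀ ∈ Metric.ball (diag mu w) ε := by
    rw [Metric.mem_ball, dist_pi_lt_iff hε]
    intro i
    exact (hy _).trans (half_lt_self hε)
  -- the event in `tailProb` is a nonempty open set at `v₀`
  have htail : 0 < M.tailProb φ θ v₀ := by
    have hopen : IsOpen {u : Fin n → Vec d | StrictMono (Fin.append (M.objective φ θ ∘ v₀)
        (M.objective φ θ ∘ fun j => A *ᵥ u j))} := by
      have hc : Continuous fun u : Fin n → Vec d => M.objective φ θ ∘ fun j => A *ᵥ u j :=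
        continuous_pi fun j => hobj.comp ((continuous_mulVec A).comp (continuous_apply j))
      exact (isOpen_strictMono _).preimage
        ((continuous_finAppend mu n).comp (continuous_const.prodMk hc))
    have hne : {u : Fin n → Vec d | StrictMono (Fin.append (M.objective φ θ ∘ v₀)
        (M.objective φ θ ∘ fun j => A *ᵥ u j))}.Nonempty := by
      refine ⟨fun j => A⁻¹ *ᵥ y (Fin.natAdd mu j), ?_⟩
      rw [Set.mem_ofPred_eq]
      simp only [Matrix.mulVec_mulVec, Matrix.mul_nonsing_inv _ hAdet, Matrix.one_mulVec]
      have he : M.objective φ θ ∘ y = Fin.append (M.objective φ θ ∘ v₀)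
          (M.objective φ θ ∘ fun j => y (Fin.natAdd mu j)) := by
        rw [← comp_append]
        congr 1
        funext i
        induction i using Fin.addCases with
        | left i => simp [hv₀]
        | right i => simp
      rwa [← he]
    have : M.P.IsOpenPosMeasure := by
      refine Measure.IsOpenPosMeasure.mk fun U hU hUne hU0 => ?_
      have hac : (volume : Measure (Vec d)) ≪ M.P := by
        rw [hPe]
        refine withDensity_absolutelyContinuous' hψ.measurable.ennreal_ofReal.aemeasurable ?_
        exact Eventually.of_forall fun x => (ENNReal.ofReal_pos.2 (hψpos x)).ne'
      exact (hU.measure_pos volume hUne).ne' (hac hU0)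
    have hpi : (Measure.pi fun _ : Fin n => M.P).IsOpenPosMeasure :=
      Measure.pi.isOpenPosMeasure (μ := fun _ : Fin n => M.P)
    exact hopen.measure_pos (Measure.pi fun _ : Fin n => M.P) hne
  -- hence the density is positive in a neighborhood of `v₀`
  have hpos0 : 0 < M.selDensity φ ψ θ v₀ := by
    refine mul_pos (Finset.prod_pos fun i _ => stepDensity_pos h hψpos hθ _) (mul_pos ?_ ?_)
    · exact_mod_cast Nat.factorial_pos _
    · exact ENNReal.toReal_pos htail.ne' (measure_ne_top _ _)
  have hev : ∀ᶠ v in 𝓝 v₀, 0 < M.selDensity φ ψ θ v := by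
    have hl := lowerSemicontinuousOn_selDensity h hφ hprob hψ hψpos (θ, v₀) ⟨hθ, mem_univ _⟩ 0 hpos0
    have ht : Tendsto (fun v : Ctrl d mu => (θ, v)) (𝓝 v₀) (𝓝[M.X ×ˢ univ] (θ, v₀)) := by
      refine tendsto_nhdsWithin_iff.2 ⟨?_, Eventually.of_forall fun v => ⟨hθ, mem_univ _⟩⟩
      exact (Continuous.prodMk_right θ).tendsto v₀
    exact ht.eventually hl
  have hU : {v | 0 < M.selDensity φ ψ θ v} ∩ Metric.ball (diag mu w) ε ∈ 𝓝 v₀ :=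
    inter_mem hev (Metric.isOpen_ball.mem_nhds hv₀N)
  -- the two densities agree almost everywhere
  have hsel := map_alpha_eq h hφ h0 hg hfe hprob hψ hψpos hPe hle hθ
  have hmeas : AEMeasurable (fun v => ENNReal.ofReal (M.selDensity φ ψ θ v)) volume := by
    have hl : LowerSemicontinuous fun v => M.selDensity φ ψ θ v := by
      intro v y hy
      have hl := lowerSemicontinuousOn_selDensity h hφ hprob hψ hψpos (θ, v) ⟨hθ, mem_univ _⟩ y hy
      have ht : Tendsto (fun v : Ctrl d mu => (θ, v)) (𝓝 v) (𝓝[M.X ×ˢ univ] (θ, v)) := by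
        refine tendsto_nhdsWithin_iff.2 ⟨?_, Eventually.of_forall fun v => ⟨hθ, mem_univ _⟩⟩
        exact (Continuous.prodMk_right θ).tendsto v
      exact ht.eventually hl
    exact hl.measurable.ennreal_ofReal.aemeasurable
  have hmeas' : AEMeasurable (fun v => ENNReal.ofReal (p θ v)) volume := by
    have hl : LowerSemicontinuous fun v => p θ v := by
      intro v y hy
      have hl := hp.lsc (θ, v) ⟨hθ, mem_univ _⟩ y hy
      have ht : Tendsto (fun v : Ctrl d mu => (θ, v)) (𝓝 v) (𝓝[M.X ×ˢ univ] (θ, v)) := by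
        refine tendsto_nhdsWithin_iff.2 ⟨?_, Eventually.of_forall fun v => ⟨hθ, mem_univ _⟩⟩
        exact (Continuous.prodMk_right θ).tendsto v
      exact ht.eventually hl
    exact hl.measurable.ennreal_ofReal.aemeasurable
  have hae : (fun v => ENNReal.ofReal (p θ v)) =ᵐ[volume]
      fun v => ENNReal.ofReal (M.selDensity φ ψ θ v) := by
    refine (withDensity_eq_iff hmeas' hmeas ?_).1 ((hp.density θ hθ).symm.trans hsel)
    have hfin : (volume.withDensity fun v => ENNReal.ofReal (p θ v)) univ ≠ ⊤ := by
      rw [← hp.density θ hθ]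
      exact measure_ne_top _ _
    rwa [withDensity_apply _ MeasurableSet.univ, Measure.restrict_univ] at hfin
  by_contra! hcon
  refine (Measure.measure_pos_of_mem_nhds volume hU).ne' (measure_mono_null ?_ hae)
  rintro v ⟨hv1, hv2⟩ hv3
  have h4 := hcon v (hεN hv2)
  have h5 : ENNReal.ofReal (p θ v) = ENNReal.ofReal (M.selDensity φ ψ θ v) := hv3
  rw [ENNReal.ofReal_eq_zero.2 h4] at h5
  exact (ENNReal.ofReal_pos.2 hv1).ne h5

/-- Lower semicontinuous densities exist. -/
theorem exists_isLscDensity {lam : ℕ} {M : Data d lam mu} (h : M.DynamicsOK) (hf : M.ObjectiveOK)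
    (hP : M.SamplingOK) (hle : mu ≤ lam) :
    ∃ p : State d → Ctrl d mu → ℝ, M.IsLscDensity hle p := by
  obtain ⟨n, rfl⟩ := Nat.exists_eq_add_of_le hle
  obtain ⟨φ, g, hφ, h0, hg, hfe⟩ := hf.negligible_level_sets
  obtain ⟨ψ, hψ, hψpos, hPe⟩ := hP.density
  refine ⟨M.selDensity φ ψ, fun θ hθ v => ?_, fun θ hθ => ?_, ?_⟩
  · exact mul_nonneg (Finset.prod_nonneg fun i _ => (stepDensity_pos h hψpos hθ _).le)
      (by positivity)
  · exact map_alpha_eq h hφ h0 hg hfe hP.isProb hψ hψpos hPe hle hθ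
  · exact lowerSemicontinuousOn_selDensity h hφ hP.isProb hψ hψpos

theorem exists_density_pos {lam : ℕ} {M : Data d lam mu} (h : M.DynamicsOK) (hf : M.ObjectiveOK)
    (hP : M.SamplingOK) {hle : mu ≤ lam} {p : State d → Ctrl d mu → ℝ}
    (hp : M.IsLscDensity hle p) {θ : State d} (hθ : θ ∈ M.X) (w : Vec d)
    {N : Set (Ctrl d mu)} (hN : N ∈ 𝓝 (diag mu w)) : ∃ v ∈ N, 0 < p θ v := by
  obtain ⟨n, rfl⟩ := Nat.exists_eq_add_of_le hle
  exact exists_density_pos_of_add h hf hP hle hp hθ w hN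

/-- Controls with all components equal are limits of controls at which the extended density is
positive. -/
theorem diag_mem_closure_controlSet {lam : ℕ} {M : Data d lam mu} (h : M.DynamicsOK)
    (hf : M.ObjectiveOK) (hP : M.SamplingOK) {hle : mu ≤ lam} {p : State d → Ctrl d mu → ℝ}
    (hp : M.IsLscDensity hle p) {θ : State d} (hθ : θ ∈ M.X) :
    ∀ (k : ℕ) (w : Fin k → Vec d), (fun i => diag mu (w i)) ∈ closure (M.controlSet p θ k)
  | 0, w => by
    refine subset_closure ?_
    change 0 < M.extDensity p θ 0 _
    exact one_pos
  | k + 1, w => by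
    refine mem_closure_iff_nhds.2 fun N hN => ?_
    have hsplit : Continuous fun x : (Fin k → Ctrl d mu) × Ctrl d mu =>
        (Fin.snoc x.1 x.2 : Fin (k + 1) → Ctrl d mu) := by
      refine continuous_pi fun i => ?_
      induction i using Fin.lastCases with
      | last =>
        simp only [Fin.snoc_last]
        fun_prop
      | cast i =>
        simp only [Fin.snoc_castSucc]
        fun_prop
    have he : (Fin.snoc (fun i : Fin k => diag mu (w i.castSucc)) (diag mu (w (Fin.last k))) :
        Fin (k + 1) → Ctrl d mu) = fun i => diag mu (w i) := by
      funext i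
      induction i using Fin.lastCases with
      | last => simp
      | cast i => simp
    have hN' := hsplit.continuousAt (x := ((fun i : Fin k => diag mu (w i.castSucc)),
      diag mu (w (Fin.last k)))) (by rw [he]; exact hN)
    obtain ⟨N₁, hN₁, N₂, hN₂, hsub⟩ := mem_nhds_prod_iff.1 hN'
    obtain ⟨v, hvN, hv⟩ := mem_closure_iff_nhds.1
      (diag_mem_closure_controlSet h hf hP hp hθ k fun i => w i.castSucc) N₁ hN₁
    obtain ⟨u, huN, hu⟩ := exists_density_pos h hf hP hp (h.S_mem hθ k v) (w (Fin.last k)) hN₂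
    refine ⟨Fin.snoc v u, hsub (mk_mem_prod hvN huN), ?_⟩
    change 0 < M.extDensity p θ (k + 1) (Fin.snoc v u)
    rw [extDensity]
    simp only [Fin.snoc_castSucc, Fin.snoc_last]
    exact mul_pos hv hu

end Data

/-! ### Steadily attracting states -/

namespace Data

variable {d lam mu : ℕ} {M : Data d lam mu}

/-- The states that can be reached from `θ` in `k` steps by controls with equal components. -/
def reach (M : Data d lam mu) (θ : State d) : ℕ → Set (State d)
  | 0 => {θ}
  | k + 1 => {χ | ∃ ψ ∈ M.reach θ k, ∃ w : Vec d, χ = M.F ψ (diag mu w)}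

theorem reach_trans {θ ψ : State d} {k : ℕ} (h1 : ψ ∈ M.reach θ k) :
    ∀ {m : ℕ} {χ : State d}, χ ∈ M.reach ψ m → χ ∈ M.reach θ (k + m)
  | 0, _, h2 => by
    obtain rfl : _ = ψ := h2
    exact h1
  | _ + 1, _, ⟨ξ, hξ, w, hw⟩ => ⟨ξ, reach_trans h1 hξ, w, hw⟩

theorem DynamicsOK.reach_subset (h : M.DynamicsOK) {θ : State d} (hθ : θ ∈ M.X) :
    ∀ {k : ℕ} {ψ : State d}, ψ ∈ M.reach θ k → ψ ∈ M.X
  | 0, _, h2 => by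
    obtain rfl : _ = θ := h2
    exact hθ
  | _ + 1, _, ⟨_, hξ, _, hw⟩ => hw ▸ h.F_mem (h.reach_subset hθ hξ) _

theorem exists_path_of_mem_reach {θ : State d} :
    ∀ {k : ℕ} {ψ : State d}, ψ ∈ M.reach θ k →
      ∃ w : Fin k → Vec d, M.S θ k (fun i => diag mu (w i)) = ψ
  | 0, _, h2 => ⟨Fin.elim0, Eq.symm h2⟩
  | k + 1, _, ⟨ξ, hξ, w, hw⟩ => by
    obtain ⟨u, hu⟩ := exists_path_of_mem_reach hξ
    refine ⟨Fin.snoc u w, ?_⟩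
    rw [S, hw, ← hu]
    simp only [Fin.snoc_castSucc, Fin.snoc_last]

theorem DynamicsOK.eventually_reach (h : M.DynamicsOK) {θ : State d} (hθ : θ ∈ M.X) :
    ∀ {k : ℕ} {ψ : State d} {U : Set (State d)}, ψ ∈ M.reach θ k → U ∈ 𝓝[M.X] ψ →
      ∀ᶠ θ' in 𝓝[M.X] θ, ∃ ψ' ∈ M.reach θ' k, ψ' ∈ U
  | 0, ψ, U, h2, hU => by
    obtain rfl : ψ = θ := h2
    filter_upwards [hU] with θ' hθ'
    exact ⟨θ', rfl, hθ'⟩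
  | k + 1, ψ, U, ⟨ξ, hξ, w, hw⟩, hU => by
    have hξX := h.reach_subset hθ hξ
    have hc : ContinuousAt (fun x : State d => M.F x (diag mu w)) ξ :=
      ContinuousAt.comp (f := fun x : State d => (x, diag mu w)) (h.continuousAt_F hξX _)
        (Continuous.prodMk_left _).continuousAt
    have ht : Tendsto (fun x : State d => M.F x (diag mu w)) (𝓝[M.X] ξ) (𝓝[M.X] ψ) := by
      rw [hw]
      refine tendsto_nhdsWithin_iff.2 ⟨hc.mono_left nhdsWithin_le_nhds, ?_⟩
      filter_upwards [self_mem_nhdsWithin] with x hx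
      exact h.F_mem hx _
    filter_upwards [h.eventually_reach hθ hξ (ht hU)] with θ' hθ'
    obtain ⟨ψ', h1, h2⟩ := hθ'
    exact ⟨_, ⟨ψ', h1, w, rfl⟩, h2⟩

/-- Controls with equal components steer `θ` into any given neighborhood of `ψ`, in any
sufficiently large number of steps. -/
def LeadsTo (M : Data d lam mu) (θ ψ : State d) : Prop :=
  ∀ U ∈ 𝓝[M.X] ψ, ∃ T : ℕ, ∀ k ≥ T, ∃ χ ∈ M.reach θ k, χ ∈ U

theorem DynamicsOK.leadsTo_trans (h : M.DynamicsOK) {θ ψ χ : State d} (hψ : ψ ∈ M.X)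
    (h1 : M.LeadsTo θ ψ) (h2 : M.LeadsTo ψ χ) : M.LeadsTo θ χ := by
  intro U hU
  obtain ⟨V, hV, hVo⟩ : ∃ V ∈ 𝓝[M.X] χ, ∀ x ∈ V, U ∈ 𝓝[M.X] x :=
    ⟨_, eventually_eventually_nhdsWithin.2 hU, fun x hx => hx⟩
  -- a path from `ψ` to `V` can be followed from the points close to `ψ`
  obtain ⟨T', hT'⟩ := h2 V hV
  obtain ⟨ξ', hξ', hξV⟩ := hT' T' le_rfl
  have hev := h.eventually_reach hψ hξ' (hVo ξ' hξV)
  obtain ⟨T₁, hT₁⟩ := h1 _ hev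
  refine ⟨T₁ + T', fun k hk => ?_⟩
  obtain ⟨η, hη, ψ', hψ', hψU⟩ := hT₁ (k - T') (by omega)
  refine ⟨ψ', ?_, hψU⟩
  have := reach_trans hη hψ'
  rwa [Nat.sub_add_cancel (by omega)] at this

theorem leadsTo_of_closure {θ χ : State d}
    (h : ∀ U ∈ 𝓝[M.X] χ, ∃ ψ ∈ U, ψ ∈ M.X ∧ M.LeadsTo θ ψ) : M.LeadsTo θ χ := by
  intro U hU
  obtain ⟨ψ, hψ, -, hl⟩ := h _ (eventually_eventually_nhdsWithin.2 hU)
  exact hl U hψ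

theorem leadsTo_of_mem_reach {θ ψ χ : State d} {k : ℕ} (h1 : ψ ∈ M.reach θ k)
    (h2 : M.LeadsTo ψ χ) : M.LeadsTo θ χ := by
  intro U hU
  obtain ⟨T, hT⟩ := h2 U hU
  refine ⟨k + T, fun m hm => ?_⟩
  obtain ⟨ξ, hξ, hξU⟩ := hT (m - k) (by omega)
  refine ⟨ξ, ?_, hξU⟩
  have := reach_trans h1 hξ
  rwa [Nat.add_sub_cancel' (by omega)] at this

theorem DynamicsOK.steadilyAttracting (h : M.DynamicsOK) (hf : M.ObjectiveOK) (hP : M.SamplingOK)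
    {hle : mu ≤ lam} {p : State d → Ctrl d mu → ℝ} (hp : M.IsLscDensity hle p) {ψ : State d}
    (hψ : ψ ∈ M.X) (hl : ∀ θ ∈ M.X, M.LeadsTo θ ψ) : M.SteadilyAttracting p ψ := by
  refine ⟨hψ, fun θ hθ U hU => ?_⟩
  obtain ⟨T, hT⟩ := hl θ hθ _ (eventually_eventually_nhdsWithin.2 hU)
  refine ⟨T + 1, Nat.succ_pos T, fun k hk => ?_⟩
  obtain ⟨χ, hχ, hχU⟩ := hT k (by omega)
  obtain ⟨w, hw⟩ := exists_path_of_mem_reach hχ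
  have ht : Tendsto (M.S θ k) (𝓝 fun i => diag mu (w i)) (𝓝[M.X] χ) := by
    refine tendsto_nhdsWithin_iff.2 ⟨?_, Eventually.of_forall fun v => h.S_mem hθ k v⟩
    rw [← hw]
    exact (h.continuous_S hθ k).tendsto _
  obtain ⟨v, hv, hv'⟩ := mem_closure_iff_nhds.1
    (diag_mem_closure_controlSet h hf hP hp hθ k w) _ (ht hχU)
  exact ⟨v, hv', hv⟩

/-! ### Steering to a rest point -/

theorem DynamicsOK.continuousAt_stepP {θ : TState d}
    (hθ : θ.2.2.2 ∈ posDefCone d) (w : Vec d) :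
    ContinuousAt (fun x : TState d × Vec d => M.stepP x.1 x.2) (θ, w) := by
  have hm : Continuous fun y : Matrix (Fin d) (Fin d) ℝ × Vec d => y.1 *ᵥ y.2 :=
    continuous_fst.matrix_mulVec continuous_snd
  have c1 : ContinuousAt (fun x : TState d × Vec d => invSqrt x.1.2.2.2) (θ, w) :=
    ContinuousAt.comp' (f := fun x : TState d × Vec d => x.1.2.2.2)
      (continuousAt_invSqrt hθ) (by fun_prop)
  have c2 : ContinuousAt (fun x : TState d × Vec d => x.2) (θ, w) := by fun_prop
  have c3 : ContinuousAt (fun x : TState d × Vec d => (1 - M.cs) • x.1.2.1) (θ, w) := by fun_prop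
  exact c3.fun_add ((hm.continuousAt.comp (c1.prodMk c2)).fun_const_smul M.coefP)

theorem StepsizeOK.continuous (hG : M.StepsizeOK) : Continuous M.Gam :=
  hG.locallyLipschitz.continuous

theorem DynamicsOK.continuousAt_dstep (h : M.DynamicsOK) {θ : TState d}
    (hθ : θ.2.2.2 ∈ posDefCone d) (w : Vec d) :
    ContinuousAt (fun x : TState d × Vec d => M.dstep x.1 x.2) (θ, w) := by
  have cP := DynamicsOK.continuousAt_stepP (M := M) hθ w
  have cG : ContinuousAt (fun x : TState d × Vec d => (M.Gam (M.stepP x.1 x.2))⁻¹) (θ, w) :=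
    ContinuousAt.inv₀ (ContinuousAt.comp' (f := fun x : TState d × Vec d => M.stepP x.1 x.2)
      h.stepsize.continuous.continuousAt cP) (h.stepsize.pos _).ne'
  have cQ : Continuous fun x : TState d × Vec d => M.stepQ x.1 x.2 := by
    unfold stepQ
    fun_prop
  have cz : Continuous fun x : TState d × Vec d => x.1.1 + M.cm • x.2 := by fun_prop
  have cA : Continuous fun x : TState d × Vec d => M.decayC • x.1.2.2.2 := by fun_prop
  have cC : Continuous fun x : TState d × Vec d => M.decayC • x.1.2.2.2 +
      M.c1 • outer (M.stepQ x.1 x.2) + M.cmu • outer x.2 :=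
    (cA.add ((continuous_outer.comp cQ).const_smul M.c1)).add
      ((continuous_outer.comp continuous_snd).const_smul M.cmu)
  exact (cG.smul cz.continuousAt).prodMk (cP.prodMk (cQ.continuousAt.prodMk cC.continuousAt))

theorem DynamicsOK.rest_mem (h : M.DynamicsOK) {A : Sym d} (hA : A ∈ posDefCone d) :
    M.rest A ∈ M.X := h.normalize_mem (θ := (0, 0, 0, A)) hA h.hyper.decayC_pos

theorem DynamicsOK.continuousAt_rest (h : M.DynamicsOK) {A : Sym d} (hA : A ∈ posDefCone d) :
    ContinuousAt M.rest A := by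
  have he : M.rest = fun A => ((0, 0, 0, (M.rho A)⁻¹ • A, M.decayC) : State d) := by
    funext A
    simp [rest, normalize]
  rw [he]
  have hc : ContinuousAt (fun A => (M.rho A)⁻¹ • A) A :=
    ((h.rho.continuousAt hA).inv₀ (h.rho.pos _ hA).ne').smul continuousAt_id
  exact continuousAt_const.prodMk (continuousAt_const.prodMk
    (continuousAt_const.prodMk (hc.prodMk continuousAt_const)))

theorem DynamicsOK.rest_smul (h : M.DynamicsOK) {A : Sym d} (hA : A ∈ posDefCone d) {s : ℝ}
    (hs : 0 < s) : M.rest (s • A) = M.rest A := h.normalize_smul hA hs 0 _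

/-- A step of the unnormalized system is realized by a control with equal components. -/
theorem DynamicsOK.reach_dstep (h : M.DynamicsOK) {θ₀ : State d} {k : ℕ} {θ : TState d}
    (hθ : θ.2.2.2 ∈ posDefCone d) (hr : ∃ r, 0 < r ∧ M.normalize θ r ∈ M.reach θ₀ k) (w : Vec d) :
    ∃ r, 0 < r ∧ M.normalize (M.dstep θ w) r ∈ M.reach θ₀ (k + 1) := by
  obtain ⟨r, hr, hmem⟩ := hr
  refine ⟨_, div_pos (h.rnorm.pos _ (h.hyper.dstep_mem hθ w)) (h.rnorm.pos _ hθ),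
    _, hmem, (Real.sqrt (M.R θ.2.2.2))⁻¹ • w, ?_⟩
  rw [h.F_normalize_diag hθ hr]

/-- Once `z = 0` and `q = 0`, waiting leads to the rest point, as the path `p` decays. -/
theorem DynamicsOK.leadsTo_rest (h : M.DynamicsOK) {A : Sym d} (hA : A ∈ posDefCone d)
    (p : Vec d) {r : ℝ} (hr : 0 < r) : M.LeadsTo (M.normalize (0, p, 0, A) r) (M.rest A) := by
  have hκ := h.hyper.decayC_pos
  have key : ∀ j : ℕ, M.normalize (0, (1 - M.cs) ^ (j + 1) • p, 0, A) M.decayC ∈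
      M.reach (M.normalize (0, p, 0, A) r) (j + 1) := by
    have hF : ∀ (p : Vec d) (r : ℝ), 0 < r → M.F (M.normalize (0, p, 0, A) r) (diag mu 0) =
        M.normalize (0, (1 - M.cs) • p, 0, A) M.decayC := by
      intro p r hr
      have h1 := h.F_normalize_diag (θ := (0, p, 0, A)) hA hr 0
      rw [smul_zero, dstep_zero, h.rnorm.homogeneous _ hA _ hκ,
        mul_div_cancel_right₀ _ (h.rnorm.pos _ hA).ne'] at h1
      rw [h1, h.normalize_smul hA hκ]
    intro j
    induction j with
    | zero => exact ⟨_, rfl, 0, by rw [hF p r hr, zero_add, pow_one]⟩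
    | succ j ih =>
      refine ⟨_, ih, 0, ?_⟩
      rw [hF _ _ hκ, smul_smul, ← pow_succ']
  have hlim : Tendsto (fun j : ℕ => M.normalize (0, (1 - M.cs) ^ (j + 1) • p, 0, A) M.decayC)
      atTop (𝓝[M.X] (M.rest A)) := by
    refine tendsto_nhdsWithin_iff.2 ⟨?_, Eventually.of_forall fun j =>
      h.normalize_mem (θ := (0, (1 - M.cs) ^ (j + 1) • p, 0, A)) hA hκ⟩
    have hp : Tendsto (fun j : ℕ => (1 - M.cs) ^ (j + 1) • p) atTop (𝓝 0) := by
      have h1 : Tendsto (fun j : ℕ => (1 - M.cs) ^ j) atTop (𝓝 0) :=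
        tendsto_pow_atTop_nhds_zero_of_lt_one (by linarith [h.hyper.cs_le])
          (by linarith [h.hyper.cs_pos])
      have h2 := (h1.comp (tendsto_add_atTop_nat 1)).smul_const p
      rwa [zero_smul] at h2
    exact tendsto_const_nhds.prodMk_nhds (hp.prodMk_nhds tendsto_const_nhds)
  intro U hU
  obtain ⟨T, hT⟩ := eventually_atTop.1 (hlim hU)
  refine ⟨T + 1, fun k hk => ?_⟩
  obtain ⟨j, rfl⟩ : ∃ j, k = j + 1 := ⟨k - 1, by omega⟩
  exact ⟨_, key j, hT j (by omega)⟩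

/-- The condition on `x` under which the steps `x z` and `-(1 - c_c) x z` annihilate `z` if `q` is
already annihilated. -/
def IsZeroing (M : Data d lam mu) (θ : TState d) (x : ℝ) : Prop :=
  ((1 - M.cc) * M.Gam (M.stepP θ (x • θ.1)) - 1) * x = 1 / M.cm

theorem IsZeroing.cancel (h : M.DynamicsOK) {θ : TState d} {x : ℝ} (hx : M.IsZeroing θ x) :
    (M.dstep θ (x • θ.1)).1 + M.cm • (-((1 - M.cc) * x) • θ.1) = 0 := by
  have hc := h.hyper.cm_pos
  have hG := h.stepsize.pos (M.stepP θ (x • θ.1))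
  have hx' := hx
  rw [IsZeroing, eq_div_iff hc.ne'] at hx'
  change (M.Gam (M.stepP θ (x • θ.1)))⁻¹ • (θ.1 + M.cm • x • θ.1) + _ = 0
  have e1 : θ.1 + M.cm • x • θ.1 = (1 + M.cm * x) • θ.1 := by
    rw [add_smul, one_smul, mul_smul]
  rw [e1, smul_smul, smul_smul, ← add_smul]
  have e2 : (M.Gam (M.stepP θ (x • θ.1)))⁻¹ * (1 + M.cm * x) + M.cm * -((1 - M.cc) * x) = 0 := by
    field_simp
    linarith
  rw [e2, zero_smul]

theorem IsZeroing.dstep_dstep (h : M.DynamicsOK) {θ : TState d} {x : ℝ} (hx : M.IsZeroing θ x)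
    (hq : (1 - M.cc) • θ.2.2.1 = 0) :
    ∃ p, M.dstep (M.dstep θ (x • θ.1)) (-((1 - M.cc) * x) • θ.1) =
      (0, p, 0, M.decayC ^ 2 • θ.2.2.2 +
        ((M.decayC * (M.c1 * M.coefQ ^ 2 + M.cmu) + M.cmu * (1 - M.cc) ^ 2) * x ^ 2) •
          outer θ.1) := by
  have hq1 : M.stepQ θ (x • θ.1) = (M.coefQ * x) • θ.1 := by
    rw [stepQ, hq, zero_add, smul_smul]
  have hq2 : M.stepQ (M.dstep θ (x • θ.1)) (-((1 - M.cc) * x) • θ.1) = 0 := by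
    change (1 - M.cc) • M.stepQ θ (x • θ.1) + M.coefQ • (-((1 - M.cc) * x) • θ.1) = 0
    rw [hq1, smul_smul, smul_smul, ← add_smul]
    convert zero_smul ℝ θ.1 using 2
    ring
  refine ⟨M.stepP (M.dstep θ (x • θ.1)) (-((1 - M.cc) * x) • θ.1), ?_⟩
  refine Prod.ext ?_ (Prod.ext rfl (Prod.ext hq2 ?_))
  · change (M.Gam _)⁻¹ • ((M.dstep θ (x • θ.1)).1 + M.cm • (-((1 - M.cc) * x) • θ.1)) = 0
    rw [hx.cancel h, smul_zero]
  · change M.decayC • (M.decayC • θ.2.2.2 + M.c1 • outer (M.stepQ θ (x • θ.1)) +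
      M.cmu • outer (x • θ.1)) + M.c1 • outer (M.stepQ _ (-((1 - M.cc) * x) • θ.1)) +
      M.cmu • outer (-((1 - M.cc) * x) • θ.1) = _
    rw [hq1, hq2]
    simp only [outer_smul, outer_zero]
    module

/-- The growth of `Γ` makes the coefficient in `IsZeroing` positive far away. -/
theorem DynamicsOK.exists_isZeroing (h : M.DynamicsOK) {θ : TState d}
    (hθ : θ.2.2.2 ∈ posDefCone d) (hz : θ.1 ≠ 0) : ∃ x, M.IsZeroing θ x := by
  have hc := h.hyper.cm_pos
  by_cases hcc : M.cc = 1
  · refine ⟨-(1 / M.cm), ?_⟩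
    rw [IsZeroing, hcc]
    ring
  obtain ⟨a, ha, hev⟩ := h.stepsize.growth hcc
  have hγ : 0 < 1 - M.cc := by
    have := lt_of_le_of_ne h.hyper.cc_le hcc
    linarith
  set P : Vec d := (1 - M.cs) • θ.2.1 with hP
  set v : Vec d := M.coefP • (invSqrt θ.2.2.2 *ᵥ θ.1) with hv
  have hv0 : v ≠ 0 := smul_ne_zero h.hyper.coefP_pos.ne' (invSqrt_mulVec_ne_zero hθ hz)
  have hstep : ∀ x : ℝ, M.stepP θ (x • θ.1) = P + x • v := by
    intro x
    rw [stepP, Matrix.mulVec_smul, smul_comm]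
  have htend : Tendsto (fun x : ℝ => P + x • v) atTop (cocompact (Vec d)) := by
    rw [← Metric.cobounded_eq_cocompact, ← tendsto_norm_atTop_iff_cobounded]
    have h1 : Tendsto (fun x : ℝ => x * ‖v‖ - ‖P‖) atTop atTop :=
      tendsto_atTop_add_const_right _ _ (tendsto_id.atTop_mul_const (norm_pos_iff.2 hv0))
    refine tendsto_atTop_mono' _ ?_ h1
    filter_upwards [eventually_ge_atTop 0] with x hx
    have h2 : ‖x • v‖ = x * ‖v‖ := by rw [norm_smul, Real.norm_of_nonneg hx]
    have h3 : ‖x • v‖ ≤ ‖P + x • v‖ + ‖P‖ := by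
      calc ‖x • v‖ = ‖(P + x • v) - P‖ := by congr 1; abel
        _ ≤ _ := norm_sub_le _ _
    linarith
  have hη : 0 < (1 - M.cc) * a - 1 := by
    rw [inv_lt_iff_one_lt_mul₀' hγ] at ha
    linarith
  obtain ⟨x₁, hx₁, hx₁', hx₁''⟩ := ((htend.eventually hev).and ((eventually_ge_atTop 0).and
    (eventually_ge_atTop (1 / M.cm / ((1 - M.cc) * a - 1))))).exists
  set F : ℝ → ℝ := fun x => ((1 - M.cc) * M.Gam (P + x • v) - 1) * x with hF
  have hFc : Continuous F := by
    have := h.stepsize.continuous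
    fun_prop
  have hF1 : 1 / M.cm ≤ F x₁ := by
    rw [div_le_iff₀ hη] at hx₁''
    have : (1 - M.cc) * a ≤ (1 - M.cc) * M.Gam (P + x₁ • v) :=
      mul_le_mul_of_nonneg_left hx₁ hγ.le
    calc 1 / M.cm ≤ x₁ * ((1 - M.cc) * a - 1) := hx₁''
      _ ≤ x₁ * ((1 - M.cc) * M.Gam (P + x₁ • v) - 1) :=
        mul_le_mul_of_nonneg_left (by linarith) hx₁'
      _ = F x₁ := mul_comm _ _
  have hF0 : F 0 ≤ 1 / M.cm := by
    simp only [hF, mul_zero]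
    positivity
  obtain ⟨x, -, hx⟩ := intermediate_value_Icc hx₁' hFc.continuousOn ⟨hF0, hF1⟩
  refine ⟨x, ?_⟩
  rw [IsZeroing, hstep]
  exact hx

/-- If `Γ ≤ 1` on the relevant segment, as near the path `p = 0`, then there is a negative and
bounded solution of `IsZeroing`. -/
theorem DynamicsOK.exists_isZeroing_small (h : M.DynamicsOK) {θ : TState d}
    (hΓ : ∀ x ∈ Icc (-(1 / (M.cm * M.cc))) 0, M.Gam (M.stepP θ (x • θ.1)) ≤ 1) :
    ∃ x ∈ Icc (-(1 / (M.cm * M.cc))) 0, M.IsZeroing θ x := by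
  have hc := h.hyper.cm_pos
  have hcc := h.hyper.cc_pos
  have hγ : 0 ≤ 1 - M.cc := by linarith [h.hyper.cc_le]
  set K := 1 / (M.cm * M.cc) with hK
  have hK0 : 0 < K := by positivity
  set F : ℝ → ℝ := fun x => ((1 - M.cc) * M.Gam (M.stepP θ (x • θ.1)) - 1) * x with hF
  have hFc : Continuous F := by
    have h1 := h.stepsize.continuous
    have h2 : Continuous fun x : ℝ => M.stepP θ (x • θ.1) := by
      have : ∀ x : ℝ, M.stepP θ (x • θ.1) =
          (1 - M.cs) • θ.2.1 + x • M.coefP • (invSqrt θ.2.2.2 *ᵥ θ.1) := by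
        intro x
        rw [stepP, Matrix.mulVec_smul, smul_comm]
      simp only [this]
      fun_prop
    fun_prop
  have hF1 : 1 / M.cm ≤ F (-K) := by
    have h1 := hΓ (-K) (left_mem_Icc.2 (by linarith))
    have h2 : (1 - M.cc) * M.Gam (M.stepP θ (-K • θ.1)) ≤ (1 - M.cc) * 1 :=
      mul_le_mul_of_nonneg_left h1 hγ
    have h3 : 1 / M.cm = M.cc * K := by
      rw [hK]
      field_simp
    simp only [hF]
    nlinarith
  have hF0 : F 0 ≤ 1 / M.cm := by
    simp only [hF, mul_zero]
    positivity
  obtain ⟨x, hxm, hx⟩ := intermediate_value_Icc' (by linarith) hFc.continuousOn ⟨hF0, hF1⟩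
  exact ⟨x, hxm, hx⟩

/-- One step annihilates `q`, two more annihilate `z`, and waiting annihilates `p`. -/
theorem DynamicsOK.exists_leadsTo_rest (h : M.DynamicsOK) {θ : State d} (hθ : θ ∈ M.X) :
    ∃ A ∈ posDefCone d, M.LeadsTo θ (M.rest A) := by
  obtain ⟨ψ, hψ, hr, he⟩ := h.exists_normalize hθ
  have hb := h.hyper.coefQ_pos
  set w : Vec d := -((1 - M.cc) / M.coefQ) • ψ.2.2.1 with hw
  set ψ₁ := M.dstep ψ w with hψ₁
  have hψ₁m : ψ₁.2.2.2 ∈ posDefCone d := h.hyper.dstep_mem hψ w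
  have hq : ψ₁.2.2.1 = 0 := by
    change (1 - M.cc) • ψ.2.2.1 + M.coefQ • w = 0
    rw [hw, smul_smul, ← add_smul]
    convert zero_smul ℝ ψ.2.2.1 using 2
    field_simp
    ring
  have hr1 : ∃ r, 0 < r ∧ M.normalize ψ₁ r ∈ M.reach θ (0 + 1) :=
    h.reach_dstep hψ ⟨_, hr, show _ ∈ M.reach θ 0 from he⟩ w
  by_cases hz : ψ₁.1 = 0
  · obtain ⟨r, hr0, hmem⟩ := hr1
    refine ⟨ψ₁.2.2.2, hψ₁m, leadsTo_of_mem_reach hmem ?_⟩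
    have : ψ₁ = (0, ψ₁.2.1, 0, ψ₁.2.2.2) := Prod.ext hz (Prod.ext rfl (Prod.ext hq rfl))
    rw [this]
    exact h.leadsTo_rest hψ₁m _ hr0
  · obtain ⟨x, hx⟩ := h.exists_isZeroing hψ₁m hz
    have hr2 := h.reach_dstep hψ₁m hr1 (x • ψ₁.1)
    have hm2 := h.hyper.dstep_mem hψ₁m (x • ψ₁.1)
    obtain ⟨r, hr0, hmem⟩ := h.reach_dstep hm2 hr2 (-((1 - M.cc) * x) • ψ₁.1)
    have hm3 := h.hyper.dstep_mem hm2 (-((1 - M.cc) * x) • ψ₁.1)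
    obtain ⟨p, hp⟩ := hx.dstep_dstep h (by rw [hq, smul_zero])
    rw [hp] at hmem hm3
    exact ⟨_, hm3, leadsTo_of_mem_reach hmem (h.leadsTo_rest hm3 p hr0)⟩

end Data

namespace Data

variable {d lam mu : ℕ} {M : Data d lam mu}

/-! ### Steering between rest points -/

/-- Two opposite steps of the unnormalized system: `w`, then `-s w`. -/
def blockStep (M : Data d lam mu) (s : ℝ) (θ : TState d) (w : Vec d) : TState d :=
  M.dstep (M.dstep θ w) (-s • w)

theorem DynamicsOK.continuousAt_blockStep (h : M.DynamicsOK) (s : ℝ) {θ : TState d}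
    (hθ : θ.2.2.2 ∈ posDefCone d) (w : Vec d) :
    ContinuousAt (fun x : TState d × Vec d => M.blockStep s x.1 x.2) (θ, w) := by
  have h1 := h.continuousAt_dstep hθ w
  have h2 := h.continuousAt_dstep (h.hyper.dstep_mem hθ w) (-s • w)
  have h3 : ContinuousAt (fun x : TState d × Vec d => -s • x.2) (θ, w) := by fun_prop
  exact ContinuousAt.comp (f := fun x : TState d × Vec d => (M.dstep x.1 x.2, -s • x.2)) h2
    (h1.prodMk h3)

/-- The effect of a block `e, -s e` started at `z = 0`, `q = 0`. -/
theorem blockStep_eq (s : ℝ) (p : Vec d) (A : Sym d) (e : Vec d) :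
    let g₁ := (M.Gam (M.stepP (0, p, 0, A) e))⁻¹
    let g₂ := (M.Gam (M.blockStep s (0, p, 0, A) e).2.1)⁻¹
    (M.blockStep s (0, p, 0, A) e).1 = (g₂ * (M.cm * (g₁ - s))) • e ∧
      (M.blockStep s (0, p, 0, A) e).2.2.1 = ((1 - M.cc - s) * M.coefQ) • e ∧
      (M.blockStep s (0, p, 0, A) e).2.2.2 = M.decayC ^ 2 • A +
        (M.decayC * (M.c1 * M.coefQ ^ 2 + M.cmu) +
          (M.c1 * ((1 - M.cc - s) * M.coefQ) ^ 2 + M.cmu * s ^ 2)) • outer e := by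
  intro g₁ g₂
  have hq1 : M.stepQ (0, p, 0, A) e = M.coefQ • e := by simp [stepQ]
  have hq2 : M.stepQ (M.dstep (0, p, 0, A) e) (-s • e) = ((1 - M.cc - s) * M.coefQ) • e := by
    change (1 - M.cc) • M.stepQ (0, p, 0, A) e + M.coefQ • (-s • e) = _
    rw [hq1]
    module
  refine ⟨?_, hq2, ?_⟩
  · change g₂ • (g₁ • (0 + M.cm • e) + M.cm • (-s • e)) = _
    module
  · change M.decayC • (M.decayC • A + M.c1 • outer (M.stepQ (0, p, 0, A) e) + M.cmu • outer e) +
      M.c1 • outer (M.stepQ (M.dstep (0, p, 0, A) e) (-s • e)) + M.cmu • outer (-s • e) = _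
    rw [hq1, hq2]
    simp only [outer_smul]
    module

theorem blockStep_zero (s : ℝ) (p : Vec d) (A : Sym d) :
    M.blockStep s (0, p, 0, A) 0 = (0, (1 - M.cs) ^ 2 • p, 0, M.decayC ^ 2 • A) := by
  rw [blockStep, smul_zero, dstep_zero, dstep_zero, smul_smul, smul_smul, pow_two, pow_two]

theorem DynamicsOK.continuousAt_Gam_stepP (h : M.DynamicsOK) {θ : ℝ → TState d} {t : ℝ}
    (hθ : ContinuousAt θ t) (hmem : (θ t).2.2.2 ∈ posDefCone d) (x : ℝ) :
    ContinuousAt (fun y : ℝ × ℝ => M.Gam (M.stepP (θ y.1) (y.2 • (θ y.1).1))) (t, x) := by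
  have c1 : ContinuousAt (fun y : ℝ × ℝ => θ y.1) (t, x) :=
    ContinuousAt.comp' (g := θ) (f := fun y : ℝ × ℝ => y.1) hθ continuousAt_fst
  have c2 : ContinuousAt (fun y : ℝ × ℝ => (θ y.1, y.2 • (θ y.1).1)) (t, x) :=
    c1.prodMk (continuousAt_snd.smul c1.fst)
  have c3 := DynamicsOK.continuousAt_stepP (M := M) hmem (x • (θ t).1)
  have c4 : ContinuousAt (fun y : ℝ × ℝ => M.stepP (θ y.1) (y.2 • (θ y.1).1)) (t, x) :=
    ContinuousAt.comp' (g := fun y : TState d × Vec d => M.stepP y.1 y.2)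
      (f := fun y : ℝ × ℝ => (θ y.1, y.2 • (θ y.1).1)) c3 c2
  exact ContinuousAt.comp' (g := M.Gam) h.stepsize.continuous.continuousAt c4

/-- A small multiple of `e eᵀ` can be added to the covariance matrix at rest. -/
theorem DynamicsOK.exists_rest_add_small (h : M.DynamicsOK) {A : Sym d} (hA : A ∈ posDefCone d)
    (e : Vec d) {δ : ℝ} (hδ : 0 < δ) :
    ∃ χ, 0 < χ ∧ χ < δ ∧ M.LeadsTo (M.rest A) (M.rest (A + χ • outer e)) := by
  have hκ := h.hyper.decayC_pos
  set γ := 1 - M.cc with hγ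
  set K := 1 / (M.cm * M.cc) with hK
  set gain := M.c1 * M.coefQ ^ 2 + M.cmu with hgain
  have hgain0 : 0 < gain := h.hyper.gain_pos
  set θ : ℝ → TState d := fun ε => M.blockStep γ (0, 0, 0, A) (ε • e) with hθ
  have hθ0 : θ 0 = (0, 0, 0, M.decayC ^ 2 • A) := by
    simp only [hθ, zero_smul, blockStep_zero, smul_zero]
  have hθmem : ∀ ε, (θ ε).2.2.2 ∈ posDefCone d := fun ε =>
    h.hyper.dstep_mem (h.hyper.dstep_mem hA _) _
  have hθc : ContinuousAt θ 0 := by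
    have h1 := h.continuousAt_blockStep γ (θ := (0, 0, 0, A)) hA ((0 : ℝ) • e)
    exact ContinuousAt.comp (f := fun ε : ℝ => (((0, 0, 0, A) : TState d), ε • e)) h1
      (by fun_prop)
  -- the coefficient `ζ` of the block, with `z = ζ e`
  set ζ : ℝ → ℝ := fun ε => (M.Gam (θ ε).2.1)⁻¹ *
    (M.cm * ((M.Gam (M.stepP (0, 0, 0, A) (ε • e)))⁻¹ - γ)) with hζ
  have hz : ∀ ε, (θ ε).1 = (ζ ε * ε) • e := by
    intro ε
    have := (blockStep_eq (M := M) γ 0 A (ε • e)).1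
    rw [mul_smul]
    exact this
  have hq : ∀ ε, (θ ε).2.2.1 = 0 := by
    intro ε
    have := (blockStep_eq (M := M) γ 0 A (ε • e)).2.1
    rw [← hγ, sub_self, zero_mul, zero_smul] at this
    exact this
  have hC : ∀ ε, (θ ε).2.2.2 = M.decayC ^ 2 • A +
      ((M.decayC * gain + M.cmu * γ ^ 2) * ε ^ 2) • outer e := by
    intro ε
    have := (blockStep_eq (M := M) γ 0 A (ε • e)).2.2
    rw [← hγ, sub_self, outer_smul, smul_smul] at this
    rw [show (θ ε).2.2.2 = _ from this]
    congr 2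
    ring
  have hζc : ContinuousAt ζ 0 := by
    have c1 : ContinuousAt (fun ε => M.Gam (θ ε).2.1) 0 :=
      h.stepsize.continuous.continuousAt.comp (by fun_prop)
    have c2 : ContinuousAt (fun ε : ℝ => M.stepP (0, 0, 0, A) (ε • e)) 0 :=
      ContinuousAt.comp (f := fun ε : ℝ => (((0, 0, 0, A) : TState d), ε • e))
        (DynamicsOK.continuousAt_stepP (M := M) (θ := (0, 0, 0, A)) hA _) (by fun_prop)
    have c3 : ContinuousAt (fun ε : ℝ => M.Gam (M.stepP (0, 0, 0, A) (ε • e))) 0 :=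
      h.stepsize.continuous.continuousAt.comp c2
    exact (c1.inv₀ (h.stepsize.pos _).ne').mul
      (((c3.inv₀ (h.stepsize.pos _).ne').sub continuousAt_const).const_mul _)
  set gain₂ := M.decayC * gain + M.cmu * γ ^ 2 with hgain₂
  have hgain₂0 : 0 < gain₂ := by
    have := h.hyper.cmu_nonneg
    positivity
  set χ : ℝ × ℝ → ℝ := fun y => (M.decayC ^ 2 * (gain₂ * y.1 ^ 2) +
    gain₂ * y.2 ^ 2 * (ζ y.1 * y.1) ^ 2) / M.decayC ^ 4 with hχ
  have hev1 : ∀ᶠ ε in 𝓝 (0 : ℝ), ∀ x ∈ Icc (-K) 0, M.Gam (M.stepP (θ ε) (x • (θ ε).1)) < 1 := by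
    refine isCompact_Icc.eventually_forall_of_forall_eventually fun x _ => ?_
    have c3 := h.continuousAt_Gam_stepP hθc (hθmem 0) x
    refine c3.eventually (gt_mem_nhds ?_)
    simp only [hθ0, stepP, smul_zero, Matrix.mulVec_zero, add_zero]
    exact h.stepsize.zero_lt_one
  have hev2 : ∀ᶠ ε in 𝓝 (0 : ℝ), ∀ x ∈ Icc (-K) 0, χ (ε, x) < δ := by
    refine isCompact_Icc.eventually_forall_of_forall_eventually fun x _ => ?_
    have c1 : ContinuousAt (fun y : ℝ × ℝ => ζ y.1) (0, x) :=
      ContinuousAt.comp' (g := ζ) (f := fun y : ℝ × ℝ => y.1) hζc continuousAt_fst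
    have c3 : ContinuousAt χ (0, x) := by
      have c4 : ContinuousAt (fun y : ℝ × ℝ => (ζ y.1 * y.1) ^ 2) (0, x) :=
        (c1.mul continuousAt_fst).pow 2
      have c5 : ContinuousAt (fun y : ℝ × ℝ => M.decayC ^ 2 * (gain₂ * y.1 ^ 2)) (0, x) := by
        fun_prop
      have c6 : ContinuousAt (fun y : ℝ × ℝ => gain₂ * y.2 ^ 2) (0, x) := by fun_prop
      exact (c5.add (c6.mul c4)).div_const _
    refine c3.eventually (gt_mem_nhds ?_)
    simp only [hχ, mul_zero]
    simpa using hδ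
  obtain ⟨ε, ⟨hε1, hε2⟩, hε0⟩ := (((hev1.and hev2).filter_mono
    (nhdsWithin_le_nhds (s := Ioi (0 : ℝ)))).and self_mem_nhdsWithin).exists
  obtain ⟨x, hxm, hx⟩ := h.exists_isZeroing_small (θ := θ ε) fun x hx => (hε1 x hx).le
  obtain ⟨p, hp⟩ := hx.dstep_dstep h (by rw [hq, smul_zero])
  refine ⟨χ (ε, x), ?_, hε2 x hxm, ?_⟩
  · exact div_pos (add_pos_of_pos_of_nonneg (by positivity) (by positivity)) (by positivity)
  have hr0 : ∃ r, 0 < r ∧ M.normalize (0, 0, 0, A) r ∈ M.reach (M.rest A) 0 :=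
    ⟨M.decayC, hκ, show _ ∈ M.reach (M.rest A) 0 from rfl⟩
  have hr2 := h.reach_dstep (h.hyper.dstep_mem hA (ε • e)) (h.reach_dstep (θ := (0, 0, 0, A)) hA
    hr0 (ε • e)) (-γ • ε • e)
  have hr3 := h.reach_dstep (hθmem ε) hr2 (x • (θ ε).1)
  have hm3 := h.hyper.dstep_mem (hθmem ε) (x • (θ ε).1)
  obtain ⟨r, hr, hmem⟩ := h.reach_dstep hm3 hr3 (-((1 - M.cc) * x) • (θ ε).1)
  have hm4 := h.hyper.dstep_mem hm3 (-((1 - M.cc) * x) • (θ ε).1)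
  rw [hp] at hmem hm4
  have hfin : M.decayC ^ 2 • (θ ε).2.2.2 + ((M.decayC * gain + M.cmu * (1 - M.cc) ^ 2) * x ^ 2) •
      outer (θ ε).1 = M.decayC ^ 4 • (A + χ (ε, x) • outer e) := by
    rw [hC, hz, outer_smul, smul_add, smul_smul, smul_smul, smul_smul, smul_add, smul_smul,
      add_assoc, ← add_smul]
    congr 2
    · ring
    · simp only [hχ]
      field_simp
      rw [← hγ]
      ring
  have hl := h.leadsTo_rest hm4 p hr
  dsimp only at hm4 hl hmem
  rw [hfin] at hl hm4 hmem
  have hAχ : A + χ (ε, x) • outer e ∈ posDefCone d := by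
    have h1 := posDefCone_smul hm4 (inv_pos.2 (pow_pos hκ 4))
    rwa [smul_smul, inv_mul_cancel₀ (pow_pos hκ 4).ne', one_smul] at h1
  rw [h.rest_smul hAχ (pow_pos hκ 4)] at hl
  exact leadsTo_of_mem_reach hmem hl

/-- Any multiple of `e eᵀ` can be added at rest, by continuous induction. -/
theorem DynamicsOK.leadsTo_rest_add (h : M.DynamicsOK) {A : Sym d} (hA : A ∈ posDefCone d)
    (e : Vec d) : M.LeadsTo (M.rest A) (M.rest (A + outer e)) := by
  have hmem : ∀ t : ℝ, 0 ≤ t → A + t • outer e ∈ posDefCone d :=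
    fun t ht => posDefCone_add_smul_outer hA ht e
  set s : Set ℝ := {t | M.LeadsTo (M.rest A) (M.rest (A + t • outer e))} with hs
  have hclosed : IsClosed (s ∩ Icc 0 1) := by
    refine isClosed_of_closure_subset fun t ht => ?_
    have htI : t ∈ Icc (0 : ℝ) 1 :=
      closure_minimal inter_subset_right isClosed_Icc ht
    refine ⟨leadsTo_of_closure fun U hU => ?_, htI⟩
    have hc : Tendsto (fun t : ℝ => M.rest (A + t • outer e)) (𝓝[s ∩ Icc 0 1] t)
        (𝓝[M.X] (M.rest (A + t • outer e))) := by
      refine tendsto_nhdsWithin_iff.2 ⟨?_, ?_⟩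
      · refine ContinuousAt.continuousWithinAt ?_
        exact ContinuousAt.comp (f := fun t : ℝ => A + t • outer e)
          (h.continuousAt_rest (hmem t htI.1)) (by fun_prop)
      · filter_upwards [self_mem_nhdsWithin] with x hx
        exact h.rest_mem (hmem x hx.2.1)
    have hne : (𝓝[s ∩ Icc 0 1] t).NeBot := mem_closure_iff_nhdsWithin_neBot.1 ht
    obtain ⟨x, hx, hxs⟩ := ((hc.eventually hU).and self_mem_nhdsWithin).exists
    exact ⟨_, hx, h.rest_mem (hmem x hxs.2.1), hxs.1⟩
  have h0 : (0 : ℝ) ∈ s := by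
    intro U hU
    refine ⟨1, fun k hk => ?_⟩
    have h1 := h.leadsTo_rest hA 0 h.hyper.decayC_pos U (by simpa using hU)
    -- the control `0` keeps the state at rest
    have hF : M.F (M.rest A) (diag mu 0) = M.rest A := by
      have h1 := h.F_normalize_diag (θ := (0, 0, 0, A)) hA h.hyper.decayC_pos 0
      rw [smul_zero, dstep_zero, smul_zero, h.rnorm.homogeneous _ hA _ h.hyper.decayC_pos,
        mul_div_cancel_right₀ _ (h.rnorm.pos _ hA).ne',
        h.normalize_smul hA h.hyper.decayC_pos] at h1
      exact h1
    refine ⟨M.rest A, ?_, mem_of_mem_nhdsWithin (h.rest_mem hA) (by simpa using hU)⟩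
    clear hk
    induction k with
    | zero => rfl
    | succ k ih => exact ⟨_, ih, 0, hF.symm⟩
  have hsub := hclosed.Icc_subset_of_forall_exists_gt h0 (by
    rintro x ⟨hx, hx0, hx1⟩ y hy
    obtain ⟨χ, hχ0, hχ, hl⟩ := h.exists_rest_add_small (hmem x hx0) e (sub_pos.2 hy)
    refine ⟨x + χ, h.leadsTo_trans (h.rest_mem (hmem x hx0)) hx ?_, by linarith, by linarith⟩
    rwa [add_assoc, ← add_smul] at hl)
  have h1 := hsub (right_mem_Icc.2 zero_le_one)
  simpa [hs] using h1

theorem DynamicsOK.leadsTo_rest_add_sum (h : M.DynamicsOK) {A : Sym d} (hA : A ∈ posDefCone d)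
    {ι : Type*} (x : ι → Vec d) (s : Finset ι) :
    A + ∑ i ∈ s, outer (x i) ∈ posDefCone d ∧
      M.LeadsTo (M.rest A) (M.rest (A + ∑ i ∈ s, outer (x i))) := by
  classical
  induction s using Finset.induction_on with
  | empty =>
    have h1 := h.leadsTo_rest_add hA 0
    rw [outer_zero] at h1
    simpa using ⟨hA, by simpa using h1⟩
  | insert i s hi ih =>
    rw [Finset.sum_insert hi, add_comm (outer (x i)), ← add_assoc]
    exact ⟨posDefCone_add ih.1 (outer_posSemidef _),
      h.leadsTo_trans (h.rest_mem ih.1) ih.2 (h.leadsTo_rest_add ih.1 (x i))⟩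

/-- Any rest point leads to any other one: by adding a large multiple of the desired covariance
matrix, the original one becomes negligible. -/
theorem DynamicsOK.leadsTo_rest_rest (h : M.DynamicsOK) {A B : Sym d} (hA : A ∈ posDefCone d)
    (hB : B ∈ posDefCone d) : M.LeadsTo (M.rest A) (M.rest B) := by
  refine leadsTo_of_closure fun U hU => ?_
  have hmem : ∀ t : ℝ, 0 ≤ t → t • A + B ∈ posDefCone d := fun t ht => by
    rw [add_comm]
    exact posDefCone_add hB ((Matrix.PosDef.posSemidef hA).smul ht)
  have hc : Tendsto (fun t : ℝ => M.rest (t • A + B)) (𝓝[>] 0) (𝓝[M.X] (M.rest B)) := by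
    refine tendsto_nhdsWithin_iff.2 ⟨?_, ?_⟩
    · have h1 : ContinuousAt (fun t : ℝ => M.rest (t • A + B)) 0 :=
        ContinuousAt.comp (f := fun t : ℝ => t • A + B)
          (h.continuousAt_rest (hmem 0 le_rfl)) (by fun_prop)
      have h2 : M.rest B = M.rest ((0 : ℝ) • A + B) := by rw [zero_smul, zero_add]
      rw [h2]
      exact h1.mono_left nhdsWithin_le_nhds
    · filter_upwards [self_mem_nhdsWithin] with t ht
      exact h.rest_mem (hmem t (le_of_lt (mem_Ioi.1 ht)))
  obtain ⟨t, htU, ht⟩ := ((hc.eventually hU).and self_mem_nhdsWithin).exists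
  have hBt : (t⁻¹ • B) ∈ posDefCone d := posDefCone_smul hB (inv_pos.2 (mem_Ioi.1 ht))
  obtain ⟨x, hx⟩ := exists_sum_outer (Matrix.PosDef.posSemidef hBt)
  have h3 := (h.leadsTo_rest_add_sum hA x Finset.univ).2
  rw [← hx] at h3
  refine ⟨_, htU, h.rest_mem (hmem t ht.le), ?_⟩
  have h4 : t • A + B = t • (A + t⁻¹ • B) := by
    rw [smul_add, smul_smul, mul_inv_cancel₀ ht.ne', one_smul]
  rw [h4, h.rest_smul (posDefCone_add hA (Matrix.PosDef.posSemidef hBt)) ht]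
  exact h3

theorem DynamicsOK.steadilyAttracting_rest (h : M.DynamicsOK) (hf : M.ObjectiveOK)
    (hP : M.SamplingOK) {hle : mu ≤ lam} {p : State d → Ctrl d mu → ℝ}
    (hp : M.IsLscDensity hle p) {A : Sym d} (hA : A ∈ posDefCone d) :
    M.SteadilyAttracting p (M.rest A) :=
  h.steadilyAttracting hf hP hp (h.rest_mem hA) fun _ hθ =>
    let ⟨_, hB, hl⟩ := h.exists_leadsTo_rest hθ
    h.leadsTo_trans (h.rest_mem hB) hl (h.leadsTo_rest_rest hB hA)

end Data

/-! ### The derivative of the unnormalized update -/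

/-- At a zero of `g`, the product `f • g` is differentiable even if `f` is only continuous. -/
theorem hasFDerivAt_smul_of_eq_zero {E F : Type*} [NormedAddCommGroup E] [NormedSpace ℝ E]
    [NormedAddCommGroup F] [NormedSpace ℝ F] {f : E → ℝ} {g : E → F} {g' : E →L[ℝ] F} {x : E}
    (hf : ContinuousAt f x) (hg : HasFDerivAt g g' x) (h0 : g x = 0) :
    HasFDerivAt (fun y => f y • g y) (f x • g') x := by
  refine HasFDerivAt.of_isLittleO ?_
  have h1 : (fun y => f y • (g y - g x - g' (y - x))) =o[𝓝 x] fun y => y - x := by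
    have h2 := (hf.norm.isBoundedUnder_le).isBigO_one ℝ
    simpa using (h2.smul_isLittleO hg.isLittleO)
  have h3 : (fun y => (f y - f x) • g' (y - x)) =o[𝓝 x] fun y => y - x := by
    have h4 : (fun y => f y - f x) =o[𝓝 x] fun _ => (1 : ℝ) := by
      rw [Asymptotics.isLittleO_one_iff]
      simpa using Tendsto.sub_const hf (f x)
    simpa using h4.smul_isBigO (g'.isBigO_sub (𝓝 x) x)
  refine (h1.add h3).congr_left fun y => ?_
  simp only [h0, sub_zero, smul_zero, smul_apply]
  module

/-- Matrix-vector multiplication as a continuous bilinear map. -/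
def mulVecL (d : ℕ) : Matrix (Fin d) (Fin d) ℝ →L[ℝ] Vec d →L[ℝ] Vec d :=
  (Matrix.mulVecBilin ℝ ℝ).toContinuousBilinearMap

namespace Data

variable {d lam mu : ℕ} {M : Data d lam mu}

/-- The image of a tangent vector `(h, u, b)` under the derivative of
`(θ, w, B) ↦ stepWith θ w B`, where `N` is the derivative of `A ↦ coefP • A^{-1/2} w` and `L` is
the derivative of `Γ⁻¹` at the new path. -/
def stepTangent (M : Data d lam mu) (N : Sym d →L[ℝ] Vec d) (L : Vec d →L[ℝ] ℝ) (θ : TState d)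
    (w : Vec d) (h : TState d) (u : Vec d) (b : Sym d) : TState d :=
  ((M.Gam (M.stepP θ w))⁻¹ • (h.1 + M.cm • u) +
      L ((1 - M.cs) • h.2.1 + M.coefP • (invSqrt θ.2.2.2 *ᵥ u) + N h.2.2.2) • (θ.1 + M.cm • w),
    (1 - M.cs) • h.2.1 + M.coefP • (invSqrt θ.2.2.2 *ᵥ u) + N h.2.2.2,
    (1 - M.cc) • h.2.2.1 + M.coefQ • u,
    M.decayC • h.2.2.2 +
      M.c1 • symProd d (M.stepQ θ w) ((1 - M.cc) • h.2.2.1 + M.coefQ • u) + M.cmu • b)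

theorem exists_hasFDerivAt_stepP {θ : TState d} (hθ : θ.2.2.2 ∈ posDefCone d) (w : Vec d)
    (B : Sym d) :
    ∃ (N : Sym d →L[ℝ] Vec d) (D : TState d × Vec d × Sym d →L[ℝ] Vec d), (w = 0 → N = 0) ∧
      HasFDerivAt (fun x : TState d × Vec d × Sym d => M.stepP x.1 x.2.1) D (θ, w, B) ∧
      ∀ h u b, D (h, u, b) =
        (1 - M.cs) • h.2.1 + M.coefP • (invSqrt θ.2.2.2 *ᵥ u) + N h.2.2.2 := by
  obtain ⟨J, hJ⟩ := differentiableAt_invSqrt hθ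
  let T := TState d × Vec d × Sym d
  let π₁ : T →L[ℝ] TState d := .fst ℝ _ _
  let πw : T →L[ℝ] Vec d := .fst ℝ _ _ ∘L .snd ℝ _ _
  let πp : T →L[ℝ] Vec d := .fst ℝ _ _ ∘L .snd ℝ _ _ ∘L π₁
  let πC : T →L[ℝ] Sym d := .snd ℝ _ _ ∘L .snd ℝ _ _ ∘L .snd ℝ _ _ ∘L π₁
  have hA : HasFDerivAt (fun x : T => x.1.2.2.2) πC (θ, w, B) := πC.hasFDerivAt
  have hp : HasFDerivAt (fun x : T => x.1.2.1) πp (θ, w, B) := πp.hasFDerivAt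
  have hw : HasFDerivAt (fun x : T => x.2.1) πw (θ, w, B) := πw.hasFDerivAt
  have hi := HasFDerivAt.comp (θ, w, B) (g := invSqrt (d := d)) hJ hA
  have hm := (mulVecL d).hasFDerivAt_of_bilinear hi hw
  refine ⟨M.coefP • ((mulVecL d).flip w ∘L J), _, ?_,
    (hp.const_smul (1 - M.cs)).add (hm.const_smul M.coefP), ?_⟩
  · rintro rfl
    refine ContinuousLinearMap.ext fun E => ?_
    change M.coefP • (J E *ᵥ (0 : Vec d)) = 0
    rw [Matrix.mulVec_zero, smul_zero]
  · intro h u b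
    change (1 - M.cs) • h.2.1 + M.coefP • (invSqrt θ.2.2.2 *ᵥ u + J h.2.2.2 *ᵥ w) =
      (1 - M.cs) • h.2.1 + M.coefP • (invSqrt θ.2.2.2 *ᵥ u) + M.coefP • (J h.2.2.2 *ᵥ w)
    rw [smul_add, add_assoc]

theorem DynamicsOK.exists_hasFDerivAt_stepWith (h : M.DynamicsOK) {θ : TState d}
    (hθ : θ.2.2.2 ∈ posDefCone d) {w : Vec d}
    (hΓ : M.stepP θ w ≠ 0 ∨ θ.1 + M.cm • w = 0) (B : Sym d) :
    ∃ (N : Sym d →L[ℝ] Vec d) (L : Vec d →L[ℝ] ℝ)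
      (D : TState d × Vec d × Sym d →L[ℝ] TState d), (w = 0 → N = 0) ∧
      HasFDerivAt (fun x : TState d × Vec d × Sym d => M.stepWith x.1 x.2.1 x.2.2) D (θ, w, B) ∧
      ∀ h u b, D (h, u, b) = M.stepTangent N L θ w h u b := by
  obtain ⟨N, DP, hN, hP, hDP⟩ := exists_hasFDerivAt_stepP (M := M) hθ w B
  let T := TState d × Vec d × Sym d
  let π₁ : T →L[ℝ] TState d := .fst ℝ _ _
  let πw : T →L[ℝ] Vec d := .fst ℝ _ _ ∘L .snd ℝ _ _
  let πB : T →L[ℝ] Sym d := .snd ℝ _ _ ∘L .snd ℝ _ _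
  let πz : T →L[ℝ] Vec d := .fst ℝ _ _ ∘L π₁
  let πq : T →L[ℝ] Vec d := .fst ℝ _ _ ∘L .snd ℝ _ _ ∘L .snd ℝ _ _ ∘L π₁
  let πC : T →L[ℝ] Sym d := .snd ℝ _ _ ∘L .snd ℝ _ _ ∘L .snd ℝ _ _ ∘L π₁
  have hz : HasFDerivAt (fun x : T => x.1.1 + M.cm • x.2.1) (πz + M.cm • πw) (θ, w, B) :=
    (πz + M.cm • πw).hasFDerivAt
  have hq : HasFDerivAt (fun x : T => M.stepQ x.1 x.2.1) ((1 - M.cc) • πq + M.coefQ • πw)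
      (θ, w, B) := ((1 - M.cc) • πq + M.coefQ • πw).hasFDerivAt
  have hC : HasFDerivAt (fun x : T =>
      M.decayC • x.1.2.2.2 + M.c1 • outer (M.stepQ x.1 x.2.1) + M.cmu • x.2.2) _ (θ, w, B) :=
    ((M.decayC • πC).hasFDerivAt.add
      ((HasFDerivAt.comp (θ, w, B) (hasFDerivAt_outer _) hq).const_smul M.c1)).add
      (M.cmu • πB).hasFDerivAt
  obtain ⟨L, Dz, hDz, hL⟩ : ∃ (L : Vec d →L[ℝ] ℝ) (Dz : TState d × Vec d × Sym d →L[ℝ] Vec d),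
      HasFDerivAt (fun x : TState d × Vec d × Sym d =>
        (M.Gam (M.stepP x.1 x.2.1))⁻¹ • (x.1.1 + M.cm • x.2.1)) Dz (θ, w, B) ∧
      ∀ h u b, Dz (h, u, b) = (M.Gam (M.stepP θ w))⁻¹ • (h.1 + M.cm • u) +
        L (DP (h, u, b)) • (θ.1 + M.cm • w) := by
    have hpos := (h.stepsize.pos (M.stepP θ w)).ne'
    by_cases h0 : θ.1 + M.cm • w = 0
    · have hc : ContinuousAt (fun x : TState d × Vec d × Sym d =>
          (M.Gam (M.stepP x.1 x.2.1))⁻¹) (θ, w, B) :=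
        ContinuousAt.inv₀ (ContinuousAt.comp' (g := M.Gam) h.stepsize.continuous.continuousAt
          hP.continuousAt) hpos
      refine ⟨0, _, hasFDerivAt_smul_of_eq_zero hc hz h0, fun h u b => ?_⟩
      rw [h0, smul_zero, add_zero]
      rfl
    · have hΓ' : DifferentiableAt ℝ (fun p => (M.Gam p)⁻¹) (M.stepP θ w) :=
        (h.stepsize.differentiable _ (hΓ.resolve_right h0)).inv hpos
      have h1 := HasFDerivAt.comp (θ, w, B) (g := fun p => (M.Gam p)⁻¹) hΓ'.hasFDerivAt hP
      exact ⟨_, _, h1.smul hz, fun h u b => rfl⟩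
  refine ⟨N, L, _, hN, hDz.prodMk (hP.prodMk (hq.prodMk hC)), fun h u b => ?_⟩
  refine Prod.ext ?_ (Prod.ext (hDP h u b) (Prod.ext rfl rfl))
  refine (hL h u b).trans ?_
  rw [hDP]
  rfl

/-! ### Tangent directions along trajectories -/

/-- `recomb` as a continuous linear map. -/
def recombL (M : Data d lam mu) : Ctrl d mu →L[ℝ] Vec d :=
  ∑ i, M.wm i • ContinuousLinearMap.proj i

theorem recombL_apply (v : Ctrl d mu) : M.recombL v = M.recomb v := by
  simp [recombL, recomb]

/-- The derivative of `outerSum` at the control `(w, …, w)`. -/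
def outerSumL (M : Data d lam mu) (w : Vec d) : Ctrl d mu →L[ℝ] Sym d :=
  ∑ i, M.wc i • (symProdL w ∘L ContinuousLinearMap.proj i)

theorem hasFDerivAt_outer_apply (w : Vec d) (i : Fin mu) :
    HasFDerivAt (fun v : Ctrl d mu => outer (v i))
      (symProdL w ∘L (ContinuousLinearMap.proj i : Ctrl d mu →L[ℝ] Vec d)) (diag mu w) := by
  have h2 : HasFDerivAt (fun v : Ctrl d mu => v i) (ContinuousLinearMap.proj i) (diag mu w) :=
    hasFDerivAt_apply (𝕜 := ℝ) i _
  exact HasFDerivAt.comp (diag mu w) (g := outer) (hasFDerivAt_outer w) h2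

theorem hasFDerivAt_outerSum (w : Vec d) :
    HasFDerivAt M.outerSum (M.outerSumL w) (diag mu w) :=
  HasFDerivAt.fun_sum (u := Finset.univ) fun i _ =>
    (hasFDerivAt_outer_apply w i).const_smul (M.wc i)

theorem Hyper.outerSumL_diag (h : M.Hyper) (w u : Vec d) :
    M.outerSumL w (diag mu u) = symProd d w u := by
  have h1 : M.outerSumL w (diag mu u) = ∑ i, M.wc i • symProd d w u := by
    rw [outerSumL, sum_apply]
    rfl
  rw [h1, ← Finset.sum_smul, h.wc_sum, one_smul]

theorem DynamicsOK.exists_hasFDerivAt_tstep (h : M.DynamicsOK) {θ : TState d}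
    (hθ : θ.2.2.2 ∈ posDefCone d) {w : Vec d}
    (hΓ : M.stepP θ w ≠ 0 ∨ θ.1 + M.cm • w = 0) :
    ∃ (N : Sym d →L[ℝ] Vec d) (L : Vec d →L[ℝ] ℝ)
      (D : TState d × Ctrl d mu →L[ℝ] TState d), (w = 0 → N = 0) ∧
      HasFDerivAt (fun x : TState d × Ctrl d mu => M.tstep x.1 x.2) D (θ, diag mu w) ∧
      ∀ h u, D (h, diag mu u) = M.stepTangent N L θ w h u (symProd d w u) := by
  obtain ⟨N, L, D, hN, hD, hD'⟩ := h.exists_hasFDerivAt_stepWith hθ hΓ (outer w)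
  have hD₁ := hasFDerivAt_outerSum (M := M) w
  have h1 : HasFDerivAt (fun x : TState d × Ctrl d mu => (x.1, M.recombL x.2, M.outerSum x.2))
      _ (θ, diag mu w) :=
    hasFDerivAt_fst.prodMk ((M.recombL.hasFDerivAt.comp (θ, diag mu w) hasFDerivAt_snd).prodMk
      (HasFDerivAt.comp (θ, diag mu w) (g := M.outerSum) hD₁ hasFDerivAt_snd))
  have he : (θ, M.recombL (diag mu w), M.outerSum (diag mu w)) = (θ, w, outer w) := by
    rw [recombL_apply, h.hyper.recomb_diag, h.hyper.outerSum_diag]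
  rw [← he] at hD
  have h2 := HasFDerivAt.comp (θ, diag mu w) hD h1
  refine ⟨N, L, _, hN, h2.congr_of_eventuallyEq (Eventually.of_forall fun x => ?_),
    fun η u => ?_⟩
  · simp only [Function.comp_apply, recombL_apply, tstep]
  · change D (η, M.recombL (diag mu u), M.outerSumL w (diag mu u)) = _
    rw [h.hyper.outerSumL_diag, hD', recombL_apply, h.hyper.recomb_diag]

/-- The state `θ` of the unnormalized system is reached from `θ₀` in `k` steps along a control all
whose components are equal, and the tangent directions in `V` are attained there by varying the
control. The last component of the normalized state is not tracked: it does not influence the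
subsequent unnormalized states. -/
def Traj (M : Data d lam mu) (θ₀ : State d) (k : ℕ) (θ : TState d)
    (V : Submodule ℝ (TState d)) : Prop :=
  ∃ (w : Fin k → Vec d) (G : (Fin k → Ctrl d mu) → TState d)
    (G' : (Fin k → Ctrl d mu) →L[ℝ] TState d),
    (∀ u, (G u).2.2.2 ∈ posDefCone d ∧ ∃ r, 0 < r ∧ M.S θ₀ k u = M.normalize (G u) r) ∧
    G (fun i => diag mu (w i)) = θ ∧ HasFDerivAt G G' (fun i => diag mu (w i)) ∧
    V ≤ LinearMap.range G'.toLinearMap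

theorem DynamicsOK.traj_rest (h : M.DynamicsOK) {A : Sym d} (hA : A ∈ posDefCone d) :
    M.Traj (M.rest A) 0 (0, 0, 0, A) ⊥ :=
  ⟨fun _ => 0, fun _ => (0, 0, 0, A), 0, fun _ => ⟨hA, M.decayC, h.hyper.decayC_pos, rfl⟩, rfl,
    hasFDerivAt_const _ _, bot_le⟩

theorem Traj.mem {θ₀ : State d} {k : ℕ} {θ : TState d} {V : Submodule ℝ (TState d)}
    (hT : M.Traj θ₀ k θ V) : θ.2.2.2 ∈ posDefCone d := by
  obtain ⟨w, G, G', h1, rfl, -⟩ := hT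
  exact (h1 _).1

/-- The chain rule for one more step, read by an observable `Ψ`. -/
theorem Traj.comp (hM : M.DynamicsOK) {θ₀ : State d} {k : ℕ} {θ : TState d}
    {V : Submodule ℝ (TState d)} (hT : M.Traj θ₀ k θ V) (hC : DifferentiableAt ℝ M.R θ.2.2.2)
    {E : Type*} [NormedAddCommGroup E] [NormedSpace ℝ E] {Ψ : TState d × Ctrl d mu → E}
    {D : TState d × Ctrl d mu →L[ℝ] E} {w : Vec d} (hΨ : HasFDerivAt Ψ D (θ, diag mu w)) :
    ∃ (w' : Fin (k + 1) → Vec d) (G : (Fin (k + 1) → Ctrl d mu) → TState d × Ctrl d mu)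
      (D' : (Fin (k + 1) → Ctrl d mu) →L[ℝ] E),
      G (fun i => diag mu (w' i)) = (θ, diag mu w) ∧
      (∀ u, (G u).1.2.2.2 ∈ posDefCone d ∧ M.S θ₀ (k + 1) u =
        M.normalize (M.tstep (G u).1 (G u).2)
          (M.R (M.tstep (G u).1 (G u).2).2.2.2 / M.R (G u).1.2.2.2)) ∧
      HasFDerivAt (fun u => Ψ (G u)) D' (fun i => diag mu (w' i)) ∧
      ∀ h ∈ V, ∀ u, D (h, diag mu u) ∈ LinearMap.range D'.toLinearMap := by
  obtain ⟨w₀, G₀, G₀', hG₀, rfl, hG₀', hV⟩ := hT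
  set v₀ : Fin k → Ctrl d mu := fun i => diag mu (w₀ i) with hv₀
  have hRpos := hM.rnorm.pos _ (hG₀ v₀).1
  set s := Real.sqrt (M.R (G₀ v₀).2.2.2) with hs
  have hs0 : 0 < s := Real.sqrt_pos.2 hRpos
  -- the scaling factor of the control, as a function of the preceding controls
  obtain ⟨s', hs'⟩ : DifferentiableAt ℝ (fun u => Real.sqrt (M.R (G₀ u).2.2.2)) v₀ := by
    refine DifferentiableAt.sqrt ?_ hRpos.ne'
    exact DifferentiableAt.comp v₀ (f := fun u => (G₀ u).2.2.2) hC
      hG₀'.snd.snd.snd.differentiableAt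
  let I : (Fin (k + 1) → Ctrl d mu) →L[ℝ] (Fin k → Ctrl d mu) :=
    ContinuousLinearMap.pi fun i => ContinuousLinearMap.proj i.castSucc
  let w' : Fin (k + 1) → Vec d := Fin.snoc (α := fun _ => Vec d) w₀ (s⁻¹ • w)
  let v' : Fin (k + 1) → Ctrl d mu := fun i => diag mu (w' i)
  have hI : I v' = v₀ := by
    funext i
    change diag mu (Fin.snoc (α := fun _ => Vec d) w₀ (s⁻¹ • w) i.castSucc) = _
    rw [Fin.snoc_castSucc]
  have hlast : v' (Fin.last k) = diag mu (s⁻¹ • w) := by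
    change diag mu (Fin.snoc (α := fun _ => Vec d) w₀ (s⁻¹ • w) (Fin.last k)) = _
    rw [Fin.snoc_last]
  let G : (Fin (k + 1) → Ctrl d mu) → TState d × Ctrl d mu := fun u =>
    (G₀ (I u), Real.sqrt (M.R (G₀ (I u)).2.2.2) • u (Fin.last k))
  have hGv : G v' = (G₀ v₀, diag mu w) := by
    simp only [G, hI, hlast]
    refine Prod.ext rfl ?_
    funext i
    change s • s⁻¹ • w = w
    rw [smul_smul, mul_inv_cancel₀ hs0.ne', one_smul]
  have hGI : HasFDerivAt (fun u => G₀ (I u)) (G₀' ∘L I) v' := by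
    refine HasFDerivAt.comp v' (f := I) ?_ I.hasFDerivAt
    rw [hI]
    exact hG₀'
  have hsI : HasFDerivAt (fun u => Real.sqrt (M.R (G₀ (I u)).2.2.2)) (s' ∘L I) v' := by
    refine HasFDerivAt.comp v' (f := I)
      (g := fun u => Real.sqrt (M.R (G₀ u).2.2.2)) ?_ I.hasFDerivAt
    rw [hI]
    exact hs'
  have hG' := hGI.prodMk (hsI.smul (hasFDerivAt_apply (𝕜 := ℝ) (Fin.last k) v'))
  rw [← hGv] at hΨ
  refine ⟨w', G, _, hGv, fun u => ⟨(hG₀ _).1, ?_⟩, HasFDerivAt.comp v' hΨ hG', fun h hh u => ?_⟩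
  · obtain ⟨r, hr, he⟩ := (hG₀ (I u)).2
    change M.F (M.S θ₀ k (I u)) (u (Fin.last k)) = _
    rw [he, hM.F_normalize (hG₀ _).1 hr]
  · obtain ⟨η, hη⟩ := hV hh
    have hη' : G₀' η = h := hη
    let ζ : Fin (k + 1) → Ctrl d mu := Fin.snoc (α := fun _ => Ctrl d mu) η
      (s⁻¹ • (diag mu u - s' η • v' (Fin.last k)))
    have hIζ : I ζ = η := by
      funext i
      change Fin.snoc (α := fun _ => Ctrl d mu) η _ i.castSucc = _
      rw [Fin.snoc_castSucc]
    have hlζ : ζ (Fin.last k) = s⁻¹ • (diag mu u - s' η • v' (Fin.last k)) := by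
      change Fin.snoc (α := fun _ => Ctrl d mu) η _ (Fin.last k) = _
      rw [Fin.snoc_last]
    refine ⟨ζ, ?_⟩
    change D (G₀' (I ζ), Real.sqrt (M.R (G₀ (I v')).2.2.2) • ζ (Fin.last k) +
      s' (I ζ) • v' (Fin.last k)) = _
    rw [hIζ, hη', hI, hlζ, ← hs, smul_smul, mul_inv_cancel₀ hs0.ne', one_smul, sub_add_cancel]

/-- One more step of a trajectory: the tangent directions are transported by the derivative of the
update, and all directions of the new step become available. -/
theorem Traj.step (hM : M.DynamicsOK) {θ₀ : State d} {k : ℕ} {θ : TState d}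
    {V : Submodule ℝ (TState d)} (hT : M.Traj θ₀ k θ V) (hC : DifferentiableAt ℝ M.R θ.2.2.2)
    {w : Vec d} (hΓ : M.stepP θ w ≠ 0 ∨ θ.1 + M.cm • w = 0) :
    ∃ (N : Sym d →L[ℝ] Vec d) (L : Vec d →L[ℝ] ℝ) (V' : Submodule ℝ (TState d)),
      (w = 0 → N = 0) ∧ M.Traj θ₀ (k + 1) (M.dstep θ w) V' ∧
      ∀ h ∈ V, ∀ u, M.stepTangent N L θ w h u (symProd d w u) ∈ V' := by
  obtain ⟨N, L, D, hN, hD, hD'⟩ := hM.exists_hasFDerivAt_tstep hT.mem hΓ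
  obtain ⟨w', G, D', hG, hS, hGD, hr⟩ := hT.comp hM hC hD
  refine ⟨N, L, LinearMap.range D'.toLinearMap, hN, ⟨w', _, D', fun u => ⟨?_, ?_⟩, ?_, hGD, le_rfl⟩,
    fun h hh u => ?_⟩
  · exact hM.hyper.tstep_mem (hS u).1 _
  · obtain ⟨hmem, he⟩ := hS u
    exact ⟨_, div_pos (hM.rnorm.pos _ (hM.hyper.tstep_mem hmem _)) (hM.rnorm.pos _ hmem), he⟩
  · rw [hG]
    exact hM.hyper.tstep_diag θ w
  · rw [← hD']
    exact hr h hh u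

end Data

namespace Data

variable {d lam mu : ℕ} {M : Data d lam mu}

/-! ### The derivative of the extended transition map -/

theorem fderiv_self_of_homogeneous {E : Type*} [NormedAddCommGroup E] [NormedSpace ℝ E]
    {φ : E → ℝ} {x : E} (hd : DifferentiableAt ℝ φ x)
    (hφ : ∀ s : ℝ, 0 < s → φ (s • x) = s * φ x) : fderiv ℝ φ x x = φ x := by
  have h1 : HasDerivAt (fun s : ℝ => s • x) x 1 := by
    simpa using (hasDerivAt_id (1 : ℝ)).smul_const x
  have h2 : HasDerivAt (fun s : ℝ => φ (s • x)) (fderiv ℝ φ x x) 1 := by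
    refine HasFDerivAt.comp_hasDerivAt (1 : ℝ) (f := fun s : ℝ => s • x) ?_ h1
    rw [one_smul]
    exact hd.hasFDerivAt
  have h3 : HasDerivAt (fun s : ℝ => s * φ x) (φ x) 1 := by
    simpa using (hasDerivAt_id (1 : ℝ)).mul_const (φ x)
  refine h2.unique (h3.congr_of_eventuallyEq ?_)
  filter_upwards [lt_mem_nhds one_pos] with s hs using hφ s hs

theorem DynamicsOK.fderiv_R_self (h : M.DynamicsOK) {A : Sym d} (hA : A ∈ posDefCone d)
    (hd : DifferentiableAt ℝ M.R A) : fderiv ℝ M.R A A = M.R A :=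
  fderiv_self_of_homogeneous hd (h.rnorm.homogeneous A hA)

theorem DynamicsOK.fderiv_rho_self (h : M.DynamicsOK) {A : Sym d} (hA : A ∈ posDefCone d) :
    fderiv ℝ M.rho A A = M.rho A :=
  fderiv_self_of_homogeneous (h.rho.differentiableAt hA) (h.rho.homogeneous A hA)

/-- The derivative of a function that is homogeneous of degree one has degree zero. -/
theorem DynamicsOK.fderiv_rho_smul (h : M.DynamicsOK) {A : Sym d} (hA : A ∈ posDefCone d) {s : ℝ}
    (hs : 0 < s) : fderiv ℝ M.rho (s • A) = fderiv ℝ M.rho A := by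
  have h1 : HasFDerivAt (fun B => M.rho (s • B)) (s • fderiv ℝ M.rho (s • A)) A := by
    have h2 := HasFDerivAt.comp A (f := fun B : Sym d => s • B)
      (h.rho.differentiableAt (posDefCone_smul hA hs)).hasFDerivAt
      ((hasFDerivAt_id A).const_smul s)
    refine h2.congr_fderiv ?_
    refine ContinuousLinearMap.ext fun B => ?_
    change fderiv ℝ M.rho (s • A) (s • B) = s • fderiv ℝ M.rho (s • A) B
    rw [map_smul]
  have h3 : HasFDerivAt (fun B => s * M.rho B) (s • fderiv ℝ M.rho A) A :=
    (h.rho.differentiableAt hA).hasFDerivAt.const_mul s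
  have h4 := h1.unique (h3.congr_of_eventuallyEq (by
    filter_upwards [isOpen_posDefCone.mem_nhds hA] with B hB using h.rho.homogeneous B hB s hs))
  exact smul_right_injective _ hs.ne' h4

theorem DynamicsOK.exists_hasFDerivAt_inv_sqrt (h : M.DynamicsOK) {A : Sym d}
    (hA : A ∈ posDefCone d) (hd : DifferentiableAt ℝ M.R A) :
    ∃ m : ℝ, HasFDerivAt (fun B => (Real.sqrt (M.R B))⁻¹) (m • fderiv ℝ M.R A) A := by
  have hpos := h.rnorm.pos A hA
  have h1 : DifferentiableAt ℝ (fun x : ℝ => (Real.sqrt x)⁻¹) (M.R A) :=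
    (differentiableAt_id.sqrt hpos.ne').inv (Real.sqrt_pos.2 hpos).ne'
  exact ⟨_, h1.hasDerivAt.comp_hasFDerivAt A hd.hasFDerivAt⟩

/-- The normalized state after a step of the unnormalized system from covariance `A` to `ψ`. -/
def normalizeStep (M : Data d lam mu) (A : Sym d) (ψ : TState d) : State d :=
  ((Real.sqrt (M.R ψ.2.2.2))⁻¹ • ψ.1, ψ.2.1, (Real.sqrt (M.R A))⁻¹ • ψ.2.2.1,
    (M.rho ψ.2.2.2)⁻¹ • ψ.2.2.2, M.R ψ.2.2.2 * (M.R A)⁻¹)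

theorem DynamicsOK.normalizeStep_eq (h : M.DynamicsOK) {A : Sym d} {ψ : TState d}
    (hA : A ∈ posDefCone d) (hψ : ψ.2.2.2 ∈ posDefCone d) :
    M.normalizeStep A ψ = M.normalize ψ (M.R ψ.2.2.2 / M.R A) := by
  have h1 := Real.sqrt_pos.2 (h.rnorm.pos _ hψ)
  have h2 := Real.sqrt_pos.2 (h.rnorm.pos _ hA)
  refine Prod.ext rfl (Prod.ext rfl (Prod.ext ?_ (Prod.ext rfl (div_eq_mul_inv _ _).symm)))
  simp only [normalizeStep, normalize, Real.sqrt_div (h.rnorm.pos _ hψ).le]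
  congr 1
  field_simp

theorem DynamicsOK.exists_hasFDerivAt_normalizeStep (h : M.DynamicsOK) {A : Sym d} {ψ : TState d}
    (hA : A ∈ posDefCone d) (hψ : ψ.2.2.2 ∈ posDefCone d) (hdA : DifferentiableAt ℝ M.R A)
    (hdψ : DifferentiableAt ℝ M.R ψ.2.2.2) :
    ∃ (m₁ m₂ : ℝ) (D : Sym d × TState d →L[ℝ] State d),
      HasFDerivAt (fun x : Sym d × TState d => M.normalizeStep x.1 x.2) D (A, ψ) ∧
      ∀ E t, D (E, t) =
        ((Real.sqrt (M.R ψ.2.2.2))⁻¹ • t.1 + (m₁ * fderiv ℝ M.R ψ.2.2.2 t.2.2.2) • ψ.1,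
          t.2.1, (Real.sqrt (M.R A))⁻¹ • t.2.2.1 + (m₂ * fderiv ℝ M.R A E) • ψ.2.2.1,
          (M.rho ψ.2.2.2)⁻¹ • t.2.2.2 -
            ((M.rho ψ.2.2.2 ^ 2)⁻¹ * fderiv ℝ M.rho ψ.2.2.2 t.2.2.2) • ψ.2.2.2,
          (M.R A)⁻¹ * fderiv ℝ M.R ψ.2.2.2 t.2.2.2 -
            M.R ψ.2.2.2 * (M.R A ^ 2)⁻¹ * fderiv ℝ M.R A E) := by
  obtain ⟨m₁, h₁⟩ := h.exists_hasFDerivAt_inv_sqrt hψ hdψ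
  obtain ⟨m₂, h₂⟩ := h.exists_hasFDerivAt_inv_sqrt hA hdA
  let T := Sym d × TState d
  let πA : T →L[ℝ] Sym d := .fst ℝ _ _
  let πψ : T →L[ℝ] TState d := .snd ℝ _ _
  let πz : T →L[ℝ] Vec d := .fst ℝ _ _ ∘L πψ
  let πp : T →L[ℝ] Vec d := .fst ℝ _ _ ∘L .snd ℝ _ _ ∘L πψ
  let πq : T →L[ℝ] Vec d := .fst ℝ _ _ ∘L .snd ℝ _ _ ∘L .snd ℝ _ _ ∘L πψ
  let πC : T →L[ℝ] Sym d := .snd ℝ _ _ ∘L .snd ℝ _ _ ∘L .snd ℝ _ _ ∘L πψ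
  have hsψ : HasFDerivAt (fun x : T => (Real.sqrt (M.R x.2.2.2.2))⁻¹)
      ((m₁ • fderiv ℝ M.R ψ.2.2.2) ∘L πC) (A, ψ) :=
    HasFDerivAt.comp (A, ψ) (f := πC) h₁ πC.hasFDerivAt
  have hsA : HasFDerivAt (fun x : T => (Real.sqrt (M.R x.1))⁻¹)
      ((m₂ • fderiv ℝ M.R A) ∘L πA) (A, ψ) :=
    HasFDerivAt.comp (A, ψ) (f := πA) h₂ πA.hasFDerivAt
  have hρ : HasFDerivAt (fun x : T => (M.rho x.2.2.2.2)⁻¹)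
      ((-(M.rho ψ.2.2.2 ^ 2)⁻¹) • fderiv ℝ M.rho ψ.2.2.2 ∘L πC) (A, ψ) :=
    HasDerivAt.comp_hasFDerivAt (A, ψ) (f := fun x : T => M.rho x.2.2.2.2)
      (hasDerivAt_inv (h.rho.pos _ hψ).ne')
      (HasFDerivAt.comp (A, ψ) (f := πC) (h.rho.differentiableAt hψ).hasFDerivAt πC.hasFDerivAt)
  have hRψ : HasFDerivAt (fun x : T => M.R x.2.2.2.2) (fderiv ℝ M.R ψ.2.2.2 ∘L πC) (A, ψ) :=
    HasFDerivAt.comp (A, ψ) (f := πC) hdψ.hasFDerivAt πC.hasFDerivAt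
  have hRA : HasFDerivAt (fun x : T => (M.R x.1)⁻¹)
      ((-(M.R A ^ 2)⁻¹) • fderiv ℝ M.R A ∘L πA) (A, ψ) :=
    HasDerivAt.comp_hasFDerivAt (A, ψ) (f := fun x : T => M.R x.1)
      (hasDerivAt_inv (h.rnorm.pos _ hA).ne')
      (HasFDerivAt.comp (A, ψ) (f := πA) hdA.hasFDerivAt πA.hasFDerivAt)
  refine ⟨m₁, m₂, _, (hsψ.smul πz.hasFDerivAt).prodMk (πp.hasFDerivAt.prodMk
    ((hsA.smul πq.hasFDerivAt).prodMk ((hρ.smul πC.hasFDerivAt).prodMk (hRψ.mul hRA)))),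
    fun E t => Prod.ext rfl (Prod.ext rfl (Prod.ext rfl (Prod.ext ?_ ?_)))⟩
  · change (M.rho ψ.2.2.2)⁻¹ • t.2.2.2 +
      (-(M.rho ψ.2.2.2 ^ 2)⁻¹ * fderiv ℝ M.rho ψ.2.2.2 t.2.2.2) • ψ.2.2.2 = _
    module
  · change M.R ψ.2.2.2 * (-(M.R A ^ 2)⁻¹ * fderiv ℝ M.R A E) +
      (M.R A)⁻¹ * fderiv ℝ M.R ψ.2.2.2 t.2.2.2 = _
    ring

/-- The derivative of the extended transition map along a trajectory. -/
theorem Traj.exists_hasFDerivAt_S (hM : M.DynamicsOK) {θ₀ : State d} {k : ℕ} {θ : TState d}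
    {V : Submodule ℝ (TState d)} (hT : M.Traj θ₀ k θ V) (hC : DifferentiableAt ℝ M.R θ.2.2.2)
    {w : Vec d} (hC' : DifferentiableAt ℝ M.R (M.dstep θ w).2.2.2)
    (hΓ : M.stepP θ w ≠ 0 ∨ θ.1 + M.cm • w = 0) :
    ∃ (N : Sym d →L[ℝ] Vec d) (L : Vec d →L[ℝ] ℝ) (m₁ m₂ : ℝ) (w' : Fin (k + 1) → Vec d)
      (D : (Fin (k + 1) → Ctrl d mu) →L[ℝ] State d),
      HasFDerivAt (M.S θ₀ (k + 1)) D (fun i => diag mu (w' i)) ∧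
      M.S θ₀ (k + 1) (fun i => diag mu (w' i)) = M.normalizeStep θ.2.2.2 (M.dstep θ w) ∧
      ∀ h ∈ V, ∀ u t, t = M.stepTangent N L θ w h u (symProd d w u) →
        ((Real.sqrt (M.R (M.dstep θ w).2.2.2))⁻¹ • t.1 +
            (m₁ * fderiv ℝ M.R (M.dstep θ w).2.2.2 t.2.2.2) • (M.dstep θ w).1,
          t.2.1, (Real.sqrt (M.R θ.2.2.2))⁻¹ • t.2.2.1 +
            (m₂ * fderiv ℝ M.R θ.2.2.2 h.2.2.2) • (M.dstep θ w).2.2.1,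
          (M.rho (M.dstep θ w).2.2.2)⁻¹ • t.2.2.2 -
            ((M.rho (M.dstep θ w).2.2.2 ^ 2)⁻¹ *
              fderiv ℝ M.rho (M.dstep θ w).2.2.2 t.2.2.2) • (M.dstep θ w).2.2.2,
          (M.R θ.2.2.2)⁻¹ * fderiv ℝ M.R (M.dstep θ w).2.2.2 t.2.2.2 -
            M.R (M.dstep θ w).2.2.2 * (M.R θ.2.2.2 ^ 2)⁻¹ *
              fderiv ℝ M.R θ.2.2.2 h.2.2.2) ∈ LinearMap.range D.toLinearMap := by
  obtain ⟨N, L, D, -, hD, hD'⟩ := hM.exists_hasFDerivAt_tstep hT.mem hΓ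
  have hmem := hM.hyper.dstep_mem hT.mem w
  obtain ⟨m₁, m₂, DN, hDN, hDN'⟩ := hM.exists_hasFDerivAt_normalizeStep hT.mem hmem hC hC'
  let πC : TState d × Ctrl d mu →L[ℝ] Sym d :=
    .snd ℝ _ _ ∘L .snd ℝ _ _ ∘L .snd ℝ _ _ ∘L .fst ℝ _ _
  have hpair : HasFDerivAt (fun x : TState d × Ctrl d mu => (x.1.2.2.2, M.tstep x.1 x.2))
      (πC.prod D) (θ, diag mu w) := πC.hasFDerivAt.prodMk hD
  have hΨ : HasFDerivAt (fun x : TState d × Ctrl d mu =>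
      M.normalizeStep x.1.2.2.2 (M.tstep x.1 x.2)) (DN ∘L πC.prod D) (θ, diag mu w) := by
    refine HasFDerivAt.comp (θ, diag mu w)
      (f := fun x : TState d × Ctrl d mu => (x.1.2.2.2, M.tstep x.1 x.2))
      (g := fun x : Sym d × TState d => M.normalizeStep x.1 x.2) ?_ hpair
    rw [hM.hyper.tstep_diag]
    exact hDN
  obtain ⟨w', G, D', hG, hS, hGD, hr⟩ := hT.comp hM hC hΨ
  have hSG : M.S θ₀ (k + 1) = fun u => M.normalizeStep (G u).1.2.2.2 (M.tstep (G u).1 (G u).2) := by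
    funext u
    rw [(hS u).2, hM.normalizeStep_eq (hS u).1 (hM.hyper.tstep_mem (hS u).1 _)]
  refine ⟨N, L, m₁, m₂, w', D', by rw [hSG]; exact hGD, ?_, ?_⟩
  · rw [hSG]
    dsimp only
    rw [hG, hM.hyper.tstep_diag]
  · rintro h hh u t rfl
    have h1 : DN (h.2.2.2, D (h, diag mu u)) ∈ LinearMap.range D'.toLinearMap := hr h hh u
    rw [hD', hDN'] at h1
    exact h1

/-- `V` contains all tangent directions, except that the directions of the paths `p` and `q` are
not prescribed in those cases where these paths have no memory. -/
def FullTangent (M : Data d lam mu) (V : Submodule ℝ (TState d)) : Prop :=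
  ∀ (z p q : Vec d) (E : Sym d), ∃ h ∈ V, h.1 = z ∧ h.2.2.2 = E ∧ (M.cs ≠ 1 → h.2.1 = p) ∧
    (M.cc ≠ 1 → h.2.2.1 = q)

theorem FullTangent.exists_stepTangent (hM : M.DynamicsOK) {V : Submodule ℝ (TState d)}
    (hV : M.FullTangent V) (N : Sym d →L[ℝ] Vec d) (L : Vec d →L[ℝ] ℝ) (θ : TState d)
    (w z p q : Vec d) (E : Sym d) (u : Vec d) (b : Sym d) :
    ∃ h ∈ V, h.2.2.2 = E ∧ (1 - M.cc) • h.2.2.1 = (1 - M.cc) • q ∧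
      (M.stepTangent N L θ w h u b).1 = z ∧
      (M.cs ≠ 1 → (M.stepTangent N L θ w h u b).2.1 = p) := by
  set P := (1 - M.cs)⁻¹ • (p - (M.coefP • (invSqrt θ.2.2.2 *ᵥ u) + N E)) with hP
  set dp := (1 - M.cs) • P + M.coefP • (invSqrt θ.2.2.2 *ᵥ u) + N E with hdp
  have hΓ := (hM.stepsize.pos (M.stepP θ w)).ne'
  obtain ⟨h, hh, h1, h2, h3, h4⟩ := hV
    (M.Gam (M.stepP θ w) • (z - L dp • (θ.1 + M.cm • w)) - M.cm • u) P q E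
  have h5 : (1 - M.cs) • h.2.1 = (1 - M.cs) • P := by
    by_cases hcs : M.cs = 1
    · rw [hcs, sub_self, zero_smul, zero_smul]
    · rw [h3 hcs]
  have h6 : (1 - M.cs) • h.2.1 + M.coefP • (invSqrt θ.2.2.2 *ᵥ u) + N h.2.2.2 = dp := by
    rw [h5, h2]
  refine ⟨h, hh, h2, ?_, ?_, fun hcs => ?_⟩
  · by_cases hcc : M.cc = 1
    · rw [hcc, sub_self, zero_smul, zero_smul]
    · rw [h4 hcc]
  · simp only [stepTangent]
    rw [h6, h1, sub_add_cancel, smul_smul, inv_mul_cancel₀ hΓ, one_smul, sub_add_cancel]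
  · simp only [stepTangent]
    rw [h6, hdp, hP, smul_smul, mul_inv_cancel₀ (sub_ne_zero.2 (Ne.symm hcs)), one_smul]
    abel

/-- From a point with all tangent directions, one more step provides the tangent directions of the
normalized system, the direction of `r` included if the new step can compensate the change of
`R`. -/
theorem Traj.exists_range_S (hM : M.DynamicsOK) {θ₀ : State d} {k : ℕ} {θ : TState d}
    {V : Submodule ℝ (TState d)} (hT : M.Traj θ₀ k θ V) (hV : M.FullTangent V)
    (hC : DifferentiableAt ℝ M.R θ.2.2.2) {w : Vec d}
    (hC' : DifferentiableAt ℝ M.R (M.dstep θ w).2.2.2)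
    (hΓ : M.stepP θ w ≠ 0 ∨ θ.1 + M.cm • w = 0)
    {y : Vec d} (hy : fderiv ℝ M.R θ.2.2.2 (symProd d w y) ≠ 0) :
    ∃ (w' : Fin (k + 1) → Vec d) (D : (Fin (k + 1) → Ctrl d mu) →L[ℝ] State d),
      HasFDerivAt (M.S θ₀ (k + 1)) D (fun i => diag mu (w' i)) ∧
      (M.cc ≠ 1 → 0 < M.cmu → ∀ (z p q : Vec d),
        ∀ A ∈ M.tangentCov (M.S θ₀ (k + 1) fun i => diag mu (w' i)).2.2.2.1, ∀ r : ℝ,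
        ∃ p', (M.cs ≠ 1 → p' = p) ∧ (z, p', q, A, r) ∈ LinearMap.range D.toLinearMap) ∧
      (M.cc = 1 → ∀ (z p : Vec d),
        ∀ A ∈ M.tangentCov (M.S θ₀ (k + 1) fun i => diag mu (w' i)).2.2.2.1,
        ∃ p' q r, (M.cs ≠ 1 → p' = p) ∧ (z, p', q, A, r) ∈ LinearMap.range D.toLinearMap) := by
  obtain ⟨N, L, m₁, m₂, w', D, hD, hS, hr⟩ := hT.exists_hasFDerivAt_S hM hC hC' hΓ
  have hmem := hM.hyper.dstep_mem hT.mem w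
  have hκ := hM.hyper.decayC_pos
  have hR0 := hM.rnorm.pos _ hT.mem
  set ψ := M.dstep θ w with hψ
  have hR1 := hM.rnorm.pos _ hmem
  have hρ := hM.rho.pos _ hmem
  have hs0 := Real.sqrt_pos.2 hR0
  have hs1 := Real.sqrt_pos.2 hR1
  have hker : ∀ A ∈ M.tangentCov (M.S θ₀ (k + 1) fun i => diag mu (w' i)).2.2.2.1,
      fderiv ℝ M.rho ψ.2.2.2 A = 0 := by
    intro A hA
    rw [hS] at hA
    have h1 : fderiv ℝ M.rho ((M.rho ψ.2.2.2)⁻¹ • ψ.2.2.2) A = 0 := hA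
    rwa [hM.fderiv_rho_smul hmem (inv_pos.2 hρ)] at h1
  refine ⟨w', D, hD, fun hcc hcmu z p q A hA r => ?_, fun hcc z p A hA => ?_⟩
  · have hγ : 1 - M.cc ≠ 0 := sub_ne_zero.2 (Ne.symm hcc)
    set τ := (r * M.R θ.2.2.2 - M.rho ψ.2.2.2 * fderiv ℝ M.R ψ.2.2.2 A) / M.R ψ.2.2.2 with hτ
    set dC := M.rho ψ.2.2.2 • A + τ • ψ.2.2.2 with hdC
    set dq := Real.sqrt (M.R θ.2.2.2) • q with hdq
    -- the multiple of `y` that makes the preceding change of `R` vanish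
    set σ := fderiv ℝ M.R θ.2.2.2 (dC - M.c1 • symProd d (M.stepQ θ w) dq) /
      (M.cmu * fderiv ℝ M.R θ.2.2.2 (symProd d w y)) with hσ
    set E := M.decayC⁻¹ • (dC - M.c1 • symProd d (M.stepQ θ w) dq -
      M.cmu • symProd d w (σ • y)) with hE
    have hE0 : fderiv ℝ M.R θ.2.2.2 E = 0 := by
      rw [hE, map_smul, map_sub, map_smul (fderiv ℝ M.R θ.2.2.2) M.cmu, map_smul (symProd d w),
        map_smul (fderiv ℝ M.R θ.2.2.2) σ, hσ, smul_eq_mul, smul_eq_mul, smul_eq_mul]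
      have := hcmu.ne'
      field_simp
      ring
    obtain ⟨h, hh, h1, h2, h3, h4⟩ := hV.exists_stepTangent hM N L θ w
      (Real.sqrt (M.R ψ.2.2.2) • (z - (m₁ * fderiv ℝ M.R ψ.2.2.2 dC) • ψ.1)) p
      ((1 - M.cc)⁻¹ • (dq - M.coefQ • σ • y)) E (σ • y) (symProd d w (σ • y))
    have h5 := hr h hh (σ • y) _ rfl
    set t := M.stepTangent N L θ w h (σ • y) (symProd d w (σ • y)) with ht
    have htq : t.2.2.1 = dq := by
      change (1 - M.cc) • h.2.2.1 + M.coefQ • σ • y = dq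
      rw [h2, smul_smul, mul_inv_cancel₀ hγ, one_smul, sub_add_cancel]
    have htC : t.2.2.2 = dC := by
      change M.decayC • h.2.2.2 + M.c1 • symProd d (M.stepQ θ w) t.2.2.1 +
        M.cmu • symProd d w (σ • y) = dC
      rw [h1, htq, hE, smul_smul, mul_inv_cancel₀ hκ.ne', one_smul]
      abel
    refine ⟨t.2.1, h4, ?_⟩
    rw [htC, htq, h1, h3, hE0] at h5
    convert h5 using 1
    refine Prod.ext ?_ (Prod.ext rfl (Prod.ext ?_ (Prod.ext ?_ ?_)))
    · dsimp only
      rw [smul_smul, inv_mul_cancel₀ hs1.ne', one_smul, sub_add_cancel]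
    · dsimp only
      rw [mul_zero, zero_smul, add_zero, hdq, smul_smul, inv_mul_cancel₀ hs0.ne', one_smul]
    · dsimp only
      rw [hdC, map_add, map_smul, map_smul, hker A hA, hM.fderiv_rho_self hmem, smul_zero,
        zero_add, smul_add, smul_smul, inv_mul_cancel₀ hρ.ne', one_smul, smul_smul, add_sub_assoc,
        ← sub_smul]
      rw [show (M.rho ψ.2.2.2)⁻¹ * τ - (M.rho ψ.2.2.2 ^ 2)⁻¹ * τ • M.rho ψ.2.2.2 = 0 by
        rw [smul_eq_mul]
        field_simp
        ring]
      rw [zero_smul, add_zero]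
    · dsimp only
      rw [hdC, map_add, map_smul, map_smul, hM.fderiv_R_self hmem hC', hτ, smul_eq_mul,
        smul_eq_mul]
      field_simp
      ring
  · set E := (M.decayC⁻¹ * M.rho ψ.2.2.2) • A with hE
    obtain ⟨h, hh, h1, h2, h3, h4⟩ := hV.exists_stepTangent hM N L θ w
      (Real.sqrt (M.R ψ.2.2.2) • (z - (m₁ * fderiv ℝ M.R ψ.2.2.2 (M.rho ψ.2.2.2 • A)) • ψ.1)) p
      0 E 0 (symProd d w 0)
    have h5 := hr h hh 0 _ rfl
    set t := M.stepTangent N L θ w h 0 (symProd d w 0) with ht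
    have htq : t.2.2.1 = 0 := by
      change (1 - M.cc) • h.2.2.1 + M.coefQ • 0 = 0
      rw [h2, smul_zero, smul_zero, add_zero]
    have htC : t.2.2.2 = M.rho ψ.2.2.2 • A := by
      change M.decayC • h.2.2.2 + M.c1 • symProd d (M.stepQ θ w) t.2.2.1 +
        M.cmu • symProd d w 0 = _
      rw [h1, htq, hE, smul_smul, map_zero, map_zero, smul_zero, smul_zero, add_zero, add_zero,
        mul_inv_cancel_left₀ hκ.ne']
    rw [htC, h3] at h5
    rw [smul_smul, inv_mul_cancel₀ hs1.ne', one_smul, sub_add_cancel, map_smul, map_smul, hker A hA,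
      smul_zero, mul_zero, zero_smul, sub_zero, smul_smul, inv_mul_cancel₀ hρ.ne', one_smul] at h5
    exact ⟨t.2.1, _, _, h4, h5⟩

end Data

namespace Data

variable {d lam mu : ℕ} {M : Data d lam mu}

/-! ### Generating the tangent directions of the covariance matrix -/

/-- The positive definite matrices near which `R` is differentiable. By homogeneity of `R`, they
form a cone. -/
def smoothCone (M : Data d lam mu) : Set (Sym d) :=
  {A | A ∈ posDefCone d ∧ ∀ᶠ B in 𝓝 A, DifferentiableAt ℝ M.R B}

theorem isOpen_smoothCone : IsOpen M.smoothCone :=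
  isOpen_posDefCone.inter isOpen_setOfPred_eventually_nhds

theorem differentiableAt_of_mem_smoothCone {A : Sym d} (hA : A ∈ M.smoothCone) :
    DifferentiableAt ℝ M.R A := hA.2.self_of_nhds

theorem RNormOK.smoothCone_nonempty (hR : M.RNormOK) : M.smoothCone.Nonempty := by
  obtain ⟨O, hO, ⟨A, hA⟩, hpos, hd⟩ := hR.differentiable
  refine ⟨A, hpos hA, ?_⟩
  filter_upwards [hO.mem_nhds hA] with B hB using hd.differentiableAt (hO.mem_nhds hB)

theorem RNormOK.smoothCone_smul (hR : M.RNormOK) {A : Sym d} (hA : A ∈ M.smoothCone) {s : ℝ}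
    (hs : 0 < s) : s • A ∈ M.smoothCone := by
  refine ⟨posDefCone_smul hA.1 hs, ?_⟩
  have hc : Tendsto (fun B : Sym d => s⁻¹ • B) (𝓝 (s • A)) (𝓝 A) := by
    have h1 : Continuous fun B : Sym d => s⁻¹ • B := by fun_prop
    have h2 := h1.tendsto (s • A)
    rwa [smul_smul, inv_mul_cancel₀ hs.ne', one_smul] at h2
  filter_upwards [hc.eventually hA.2, isOpen_posDefCone.mem_nhds (posDefCone_smul hA.1 hs)]
    with B hB hB'
  have h3 : DifferentiableAt ℝ (fun B : Sym d => s * M.R (s⁻¹ • B)) B :=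
    (DifferentiableAt.comp B (g := M.R) (f := fun B : Sym d => s⁻¹ • B) hB
      (differentiableAt_id.const_smul s⁻¹)).const_mul s
  refine h3.congr_of_eventuallyEq ?_
  filter_upwards [isOpen_posDefCone.mem_nhds hB'] with B' hB''
  rw [hR.homogeneous _ hB'' _ (inv_pos.2 hs), mul_inv_cancel_left₀ hs.ne']

/-- The direction `E` of the covariance matrix is attained in `V`, together with a direction of `q`
that has no influence on the next step. -/
def CovTangent (M : Data d lam mu) (V : Submodule ℝ (TState d)) (E : Sym d) : Prop :=
  ∃ h ∈ V, h.2.2.2 = E ∧ (1 - M.cc) • h.2.2.1 = 0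

/-- If the new step `w` is not varied, no direction of the covariance matrix is lost. -/
theorem Traj.step_covTangent (hM : M.DynamicsOK) {θ₀ : State d} {k : ℕ} {θ : TState d}
    {V : Submodule ℝ (TState d)} (hT : M.Traj θ₀ k θ V) (hC : θ.2.2.2 ∈ M.smoothCone)
    {w : Vec d} (hΓ : M.stepP θ w ≠ 0 ∨ θ.1 + M.cm • w = 0) (hE : ∀ E, M.CovTangent V E) :
    ∃ V', M.Traj θ₀ (k + 1) (M.dstep θ w) V' ∧ ∀ E, M.CovTangent V' E := by
  obtain ⟨N, L, V', -, hT', hV'⟩ := hT.step hM (differentiableAt_of_mem_smoothCone hC) hΓ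
  refine ⟨V', hT', fun E => ?_⟩
  obtain ⟨h, hh, h1, h2⟩ := hE (M.decayC⁻¹ • E)
  have hq : (1 - M.cc) • h.2.2.1 + M.coefQ • (0 : Vec d) = 0 := by rw [h2, smul_zero, add_zero]
  refine ⟨_, hV' h hh 0, ?_, ?_⟩
  · simp only [stepTangent]
    rw [hq, h1, map_zero, map_zero, smul_zero, smul_zero, add_zero, add_zero, smul_smul,
      mul_inv_cancel₀ hM.hyper.decayC_pos.ne', one_smul]
  · simp only [stepTangent]
    rw [hq, smul_zero]

/-- Varying the two steps of a block by `y` and `-(1 - c_c) y` leaves `q` without influence and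
changes the covariance matrix in the direction `w yᵀ + y wᵀ`. -/
theorem Traj.blockStep (hM : M.DynamicsOK) {θ₀ : State d} {k : ℕ} {θ : TState d}
    {V : Submodule ℝ (TState d)} (hT : M.Traj θ₀ k θ V) {s : ℝ}
    (hs : (1 - M.cc) * (1 - M.cc - s) = 0) (hq : (1 - M.cc) • θ.2.2.1 = 0) {w : Vec d}
    (hC : θ.2.2.2 ∈ M.smoothCone) (hC' : (M.dstep θ w).2.2.2 ∈ M.smoothCone)
    (hp : M.stepP θ w ≠ 0) (hp' : (M.blockStep s θ w).2.1 ≠ 0) :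
    ∃ V', M.Traj θ₀ (k + 1 + 1) (M.blockStep s θ w) V' ∧
      (1 - M.cc) • (M.blockStep s θ w).2.2.1 = 0 ∧
      ∀ E, M.CovTangent V E → ∀ y, M.CovTangent V' (M.decayC ^ 2 • E +
        (M.decayC * (M.c1 * M.coefQ ^ 2 + M.cmu) + M.cmu * (s * (1 - M.cc))) •
          symProd d w y) := by
  obtain ⟨N₁, L₁, V₁, -, hT₁, hV₁⟩ := hT.step hM (differentiableAt_of_mem_smoothCone hC) (.inl hp)
  obtain ⟨N₂, L₂, V₂, -, hT₂, hV₂⟩ := hT₁.step hM (w := -s • w)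
    (differentiableAt_of_mem_smoothCone hC') (.inl hp')
  have hq₁ : M.stepQ θ w = M.coefQ • w := by rw [stepQ, hq, zero_add]
  refine ⟨V₂, hT₂, ?_, ?_⟩
  · change (1 - M.cc) • ((1 - M.cc) • M.stepQ θ w + M.coefQ • (-s • w)) = 0
    rw [hq₁]
    have h1 : (1 - M.cc) • ((1 - M.cc) • M.coefQ • w + M.coefQ • (-s • w)) =
        (((1 - M.cc) * (1 - M.cc - s)) * M.coefQ) • w := by module
    rw [h1, hs, zero_mul, zero_smul]
  · rintro E ⟨h, hh, rfl, h2⟩ y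
    have h3 := hV₁ h hh y
    have h4 := hV₂ _ h3 (-(1 - M.cc) • y)
    have h5 : (1 - M.cc) • ((1 - M.cc) • h.2.2.1 + M.coefQ • y) +
        M.coefQ • (-(1 - M.cc) • y) = 0 := by
      rw [h2]
      module
    refine ⟨_, h4, ?_, ?_⟩
    · simp only [stepTangent]
      rw [h5, h2, hq₁, zero_add, map_zero, smul_zero, add_zero]
      simp only [map_smul, LinearMap.smul_apply]
      module
    · simp only [stepTangent]
      rw [h5, smul_zero]

theorem dstep_zero_cov {θ : TState d} (hq : (1 - M.cc) • θ.2.2.1 = 0) :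
    (M.dstep θ 0).2.2.2 = M.decayC • θ.2.2.2 := by
  change M.decayC • θ.2.2.2 + M.c1 • outer ((1 - M.cc) • θ.2.2.1 + M.coefQ • (0 : Vec d)) +
    M.cmu • outer 0 = _
  rw [hq, smul_zero, add_zero, outer_zero, smul_zero, smul_zero, add_zero, add_zero]

theorem continuousAt_invSqrt_mulVec {f : ℝ → Sym d} {t : ℝ} (hf : ContinuousAt f t)
    (ht : f t ∈ posDefCone d) (e : Vec d) : ContinuousAt (fun τ => invSqrt (f τ) *ᵥ e) t := by
  have h1 : ContinuousAt (fun τ => invSqrt (f τ)) t :=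
    ContinuousAt.comp' (g := invSqrt (d := d)) (f := f) (continuousAt_invSqrt ht) hf
  have h2 : Continuous fun X : Matrix (Fin d) (Fin d) ℝ => X *ᵥ e :=
    continuous_id.matrix_mulVec continuous_const
  exact ContinuousAt.comp' (g := fun X : Matrix (Fin d) (Fin d) ℝ => X *ᵥ e) h2.continuousAt h1

/-- The path `p` does not vanish along a generic small block. -/
theorem DynamicsOK.eventually_blockStep_ne (hM : M.DynamicsOK) {θ : TState d}
    (hθ : θ.2.2.2 ∈ posDefCone d) (hq : (1 - M.cc) • θ.2.2.1 = 0) {s : ℝ}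
    (hs : s ≠ (1 - M.cs) * Real.sqrt M.decayC) {e : Vec d} (he : e ≠ 0) :
    ∀ᶠ τ in 𝓝[≠] (0 : ℝ), M.stepP θ (τ • e) ≠ 0 ∧ (M.blockStep s θ (τ • e)).2.1 ≠ 0 := by
  have hκ := hM.hyper.decayC_pos
  have ha := hM.hyper.coefP_pos
  set n : Vec d := invSqrt θ.2.2.2 *ᵥ e with hn
  have hn0 : n ≠ 0 := invSqrt_mulVec_ne_zero hθ he
  set P : Vec d := (1 - M.cs) • θ.2.1 with hP
  have hp1 : ∀ τ : ℝ, M.stepP θ (τ • e) = P + τ • M.coefP • n := by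
    intro τ
    rw [stepP, Matrix.mulVec_smul, smul_comm]
  set m : ℝ → Vec d := fun τ => invSqrt (M.dstep θ (τ • e)).2.2.2 *ᵥ e with hm
  have hp2 : ∀ τ : ℝ, (M.blockStep s θ (τ • e)).2.1 =
      (1 - M.cs) • P + τ • M.coefP • ((1 - M.cs) • n - s • m τ) := by
    intro τ
    change (1 - M.cs) • M.stepP θ (τ • e) +
      M.coefP • (invSqrt (M.dstep θ (τ • e)).2.2.2 *ᵥ (-s • τ • e)) = _
    rw [hp1, Matrix.mulVec_smul, Matrix.mulVec_smul]
    change _ + M.coefP • (-s • τ • m τ) = _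
    module
  have hmc : ContinuousAt m 0 := by
    have h1 : ContinuousAt (fun τ : ℝ => (M.dstep θ (τ • e)).2.2.2) 0 := by
      have h2 := hM.continuousAt_dstep hθ ((0 : ℝ) • e)
      have h3 : ContinuousAt (fun τ : ℝ => M.dstep θ (τ • e)) 0 :=
        ContinuousAt.comp' (g := fun x : TState d × Vec d => M.dstep x.1 x.2)
          (f := fun τ : ℝ => (θ, τ • e)) h2 (by fun_prop)
      exact h3.snd.snd.snd
    exact continuousAt_invSqrt_mulVec h1 (hM.hyper.dstep_mem hθ _) e
  have hm0 : m 0 = (Real.sqrt M.decayC)⁻¹ • n := by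
    simp only [hm, zero_smul]
    rw [dstep_zero_cov hq, invSqrt_smul hθ hκ, Matrix.smul_mulVec]
  simp only [hp1, hp2]
  by_cases hP0 : P = 0
  · simp only [hP0, smul_zero, zero_add]
    have hb : ContinuousAt (fun τ => (1 - M.cs) • n - s • m τ) 0 :=
      continuousAt_const.sub (hmc.const_smul s)
    have hb0 : (1 - M.cs) • n - s • m 0 ≠ 0 := by
      rw [hm0, smul_smul, ← sub_smul]
      refine smul_ne_zero (fun h => hs ?_) hn0
      have h1 := Real.sqrt_pos.2 hκ
      field_simp at h
      linarith
    filter_upwards [nhdsWithin_le_nhds (hb.eventually_ne hb0), self_mem_nhdsWithin] with τ h1 h2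
    exact ⟨smul_ne_zero h2 (smul_ne_zero ha.ne' hn0), smul_ne_zero h2 (smul_ne_zero ha.ne' h1)⟩
  · have hcs : 1 - M.cs ≠ 0 := by
      intro h
      rw [hP, h, zero_smul] at hP0
      exact hP0 rfl
    have c1 : ContinuousAt (fun τ : ℝ => P + τ • M.coefP • n) 0 := by fun_prop
    have c2 : ContinuousAt (fun τ : ℝ => (1 - M.cs) • P +
        τ • M.coefP • ((1 - M.cs) • n - s • m τ)) 0 :=
      continuousAt_const.add (continuousAt_id.smul
        ((continuousAt_const.sub (hmc.const_smul s)).const_smul M.coefP))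
    refine nhdsWithin_le_nhds ((c1.eventually_ne ?_).and (c2.eventually_ne ?_))
    · rwa [zero_smul, add_zero]
    · rw [zero_smul, add_zero]
      exact smul_ne_zero hcs hP0

/-- Small blocks along the basis vectors, starting from a rest point, provide all directions of the
covariance matrix. -/
theorem DynamicsOK.exists_traj_covTangent (hM : M.DynamicsOK) {A : Sym d} (hA : A ∈ M.smoothCone)
    {s : ℝ} (hs0 : 0 ≤ s) (hs : (1 - M.cc) * (1 - M.cc - s) = 0)
    (hs' : s ≠ (1 - M.cs) * Real.sqrt M.decayC) (S : Finset (Fin d)) :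
    ∀ U ∈ 𝓝 ((0, 0, 0, M.decayC ^ (2 * S.card) • A) : TState d), ∃ k θ V, θ ∈ U ∧
      M.Traj (M.rest A) k θ V ∧ (1 - M.cc) • θ.2.2.1 = 0 ∧
      ∀ y : Fin d → Vec d, M.CovTangent V (∑ i ∈ S, symProd d (Pi.single i 1) (y i)) := by
  have hκ := hM.hyper.decayC_pos
  induction S using Finset.induction_on with
  | empty =>
    intro U hU
    rw [Finset.card_empty, mul_zero, pow_zero, one_smul] at hU
    refine ⟨0, _, ⊥, mem_of_mem_nhds hU, hM.traj_rest hA.1, smul_zero _, fun y => ?_⟩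
    exact ⟨0, Submodule.zero_mem _, by simp, smul_zero _⟩
  | insert i S hi ih =>
    intro U hU
    rw [Finset.card_insert_of_notMem hi] at hU
    set e : Vec d := Pi.single i 1 with he
    have he0 : e ≠ 0 := by simp [he]
    set θ₁ : TState d := (0, 0, 0, M.decayC ^ (2 * S.card) • A) with hθ₁
    have hθ₁m : θ₁.2.2.2 ∈ M.smoothCone := hM.rnorm.smoothCone_smul hA (pow_pos hκ _)
    have cτ : ContinuousAt (fun x : TState d × ℝ => (x.1, x.2 • e)) (θ₁, 0) := by fun_prop
    have c1 : ContinuousAt (fun x : TState d × ℝ => M.dstep x.1 (x.2 • e)) (θ₁, 0) :=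
      ContinuousAt.comp' (g := fun x : TState d × Vec d => M.dstep x.1 x.2)
        (f := fun x : TState d × ℝ => (x.1, x.2 • e)) (hM.continuousAt_dstep hθ₁m.1 _) cτ
    have c2 : ContinuousAt (fun x : TState d × ℝ => M.blockStep s x.1 (x.2 • e)) (θ₁, 0) :=
      ContinuousAt.comp' (g := fun x : TState d × Vec d => M.blockStep s x.1 x.2)
        (f := fun x : TState d × ℝ => (x.1, x.2 • e)) (hM.continuousAt_blockStep s hθ₁m.1 _) cτ
    have hev1 : ∀ᶠ x : TState d × ℝ in 𝓝 (θ₁, 0), x.1.2.2.2 ∈ M.smoothCone := by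
      have : ContinuousAt (fun x : TState d × ℝ => x.1.2.2.2) (θ₁, 0) := by fun_prop
      exact this (isOpen_smoothCone.mem_nhds hθ₁m)
    have hev2 : ∀ᶠ x : TState d × ℝ in 𝓝 (θ₁, 0),
        (M.dstep x.1 (x.2 • e)).2.2.2 ∈ M.smoothCone := by
      refine c1.snd.snd.snd (isOpen_smoothCone.mem_nhds ?_)
      dsimp only
      rw [zero_smul, dstep_zero_cov (smul_zero _)]
      exact hM.rnorm.smoothCone_smul hθ₁m hκ
    have hev3 : ∀ᶠ x : TState d × ℝ in 𝓝 (θ₁, 0), M.blockStep s x.1 (x.2 • e) ∈ U := by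
      refine c2 ?_
      dsimp only
      rw [zero_smul, hθ₁, blockStep_zero, smul_zero, smul_smul, ← pow_add]
      rwa [mul_add, mul_one, add_comm] at hU
    have hev := (hev1.and (hev2.and hev3))
    rw [nhds_prod_eq] at hev
    obtain ⟨k, θ, V, hθ, hT, hq, hV⟩ := ih _ hev.curry
    have hmem := hT.mem
    obtain ⟨τ, ⟨⟨hC, hC', hτU⟩, hp, hp'⟩, hτ⟩ := (((hθ.filter_mono nhdsWithin_le_nhds).and
      (hM.eventually_blockStep_ne hmem hq hs' he0)).and self_mem_nhdsWithin).exists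
    obtain ⟨V', hT', hq', hV'⟩ := hT.blockStep hM hs hq hC hC' hp hp'
    refine ⟨_, _, V', hτU, hT', hq', fun y => ?_⟩
    set g := M.decayC * (M.c1 * M.coefQ ^ 2 + M.cmu) + M.cmu * (s * (1 - M.cc)) with hg
    have hg0 : 0 < g := by
      have h1 := hM.hyper.gain_pos
      have h2 := hM.hyper.cmu_nonneg
      have h3 : 0 ≤ 1 - M.cc := by linarith [hM.hyper.cc_le]
      positivity
    convert hV' _ (hV fun j => (M.decayC ^ 2)⁻¹ • y j) ((g * τ)⁻¹ • y i) using 1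
    rw [Finset.sum_insert hi, add_comm]
    congr 1
    · simp only [map_smul, ← Finset.smul_sum]
      rw [smul_smul, mul_inv_cancel₀ (pow_pos hκ 2).ne', one_smul]
    · rw [map_smul, map_smul, LinearMap.smul_apply, smul_smul, smul_smul]
      have hτ0 : τ ≠ 0 := hτ
      have h1 : g * (g * τ)⁻¹ * τ = 1 := by field_simp
      rw [h1, one_smul]

end Data

namespace Data

variable {d lam mu : ℕ} {M : Data d lam mu}

/-! ### Returning to `z = 0` -/

/-- The leading coefficient of the path `p` after a small block, started at rest, and one zeroing
step with the coefficient `x` for which `p` would have to vanish. -/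
theorem zeroing_coeff_ne_zero {b r s γ G c x : ℝ} (hb0 : 0 ≤ b) (hb1 : b < 1) (hr0 : 0 < r)
    (hr1 : r < 1) (hs0 : 0 ≤ s) (hs1 : s < 1) (hγ1 : γ < 1) (hγs : γ * (γ - s) = 0)
    (hG0 : 0 < G) (hG1 : G < 1) (hc : 0 < c) (hx : (γ * G - 1) * x = 1 / c) :
    b * (b - s * r⁻¹) + x * (G⁻¹ * (c * (G⁻¹ - s))) * (r ^ 2)⁻¹ ≠ 0 := by
  have hg : 1 < G⁻¹ := (one_lt_inv₀ hG0).2 hG1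
  set g := G⁻¹ with hgdef
  have hG : G = g⁻¹ := by rw [hgdef, inv_inv]
  have hg0 : 0 < g := by linarith
  have hgγ : 0 < g - γ := by linarith
  have hx' : x = -(g / (c * (g - γ))) := by
    rw [hG] at hx
    field_simp at hx ⊢
    linarith
  have hβ0 : 0 ≤ b * r := by positivity
  have hβ1 : b * r < 1 := by nlinarith
  have key : (b * r) * (b * r - s) - g ^ 2 * (g - s) / (g - γ) < 0 := by
    rcases mul_eq_zero.1 hγs with h | h
    · have h1 : g ^ 2 * (g - s) / (g - γ) = g * (g - s) := by
        rw [h, sub_zero]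
        field_simp
      rw [h1]
      nlinarith
    · rw [sub_eq_zero.1 h, mul_div_assoc, div_self (by linarith)]
      nlinarith
  intro h
  have h2 : b * (b - s * r⁻¹) + x * (g * (c * (g - s))) * (r ^ 2)⁻¹ =
      ((b * r) * (b * r - s) - g ^ 2 * (g - s) / (g - γ)) * (r ^ 2)⁻¹ := by
    rw [hx']
    field_simp
    ring
  rw [h2] at h
  exact (mul_ne_zero key.ne (inv_pos.2 (pow_pos hr0 2)).ne') h

theorem DynamicsOK.continuousAt_blockStep_smul (hM : M.DynamicsOK) (s : ℝ) {θ : TState d}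
    (hθ : θ.2.2.2 ∈ posDefCone d) (e : Vec d) (t : ℝ) :
    ContinuousAt (fun τ : ℝ => M.blockStep s θ (τ • e)) t :=
  ContinuousAt.comp' (g := fun x : TState d × Vec d => M.blockStep s x.1 x.2)
    (f := fun τ : ℝ => (θ, τ • e)) (hM.continuousAt_blockStep s hθ _) (by fun_prop)

/-- After a small block, started at rest, the path `p` does not vanish in the zeroing step. -/
theorem DynamicsOK.eventually_stepP_zeroing_ne (hM : M.DynamicsOK) {A : Sym d}
    (hA : A ∈ posDefCone d) {s : ℝ} (hs0 : 0 ≤ s) (hs1 : s < 1)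
    (hs : (1 - M.cc) * (1 - M.cc - s) = 0) {e : Vec d} (he : e ≠ 0) {x : ℝ}
    (hx : ((1 - M.cc) * M.Gam 0 - 1) * x = 1 / M.cm) :
    ∀ᶠ ε in 𝓝[≠] (0 : ℝ), M.stepP (M.blockStep s (0, 0, 0, A) (ε • e))
      (x • (M.blockStep s (0, 0, 0, A) (ε • e)).1) ≠ 0 := by
  have hκ := hM.hyper.decayC_pos
  have ha := hM.hyper.coefP_pos
  set θ : TState d := (0, 0, 0, A) with hθ
  set n : Vec d := invSqrt A *ᵥ e with hn
  have hn0 : n ≠ 0 := invSqrt_mulVec_ne_zero hA he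
  set B : ℝ → TState d := fun ε => M.blockStep s θ (ε • e) with hB
  have hB0 : B 0 = (0, 0, 0, M.decayC ^ 2 • A) := by
    simp only [hB, zero_smul, hθ, blockStep_zero, smul_zero]
  have cB : ContinuousAt B 0 := hM.continuousAt_blockStep_smul s hA e 0
  have cD : ContinuousAt (fun ε : ℝ => M.dstep θ (ε • e)) 0 :=
    ContinuousAt.comp' (g := fun x : TState d × Vec d => M.dstep x.1 x.2)
      (f := fun τ : ℝ => (θ, τ • e)) (hM.continuousAt_dstep hA _) (by fun_prop)
  set m : ℝ → Vec d := fun ε => invSqrt (M.dstep θ (ε • e)).2.2.2 *ᵥ e with hm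
  have cm' : ContinuousAt m 0 :=
    continuousAt_invSqrt_mulVec cD.snd.snd.snd (hM.hyper.dstep_mem hA _) e
  have hm0 : m 0 = (Real.sqrt M.decayC)⁻¹ • n := by
    simp only [hm, zero_smul]
    rw [dstep_zero_cov (smul_zero _), invSqrt_smul hA hκ, Matrix.smul_mulVec]
  set l : ℝ → Vec d := fun ε => invSqrt (B ε).2.2.2 *ᵥ e with hl
  have cl : ContinuousAt l 0 := continuousAt_invSqrt_mulVec cB.snd.snd.snd
    (hM.hyper.dstep_mem (hM.hyper.dstep_mem hA _) _) e
  have hl0 : l 0 = M.decayC⁻¹ • n := by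
    simp only [hl, hB0]
    rw [invSqrt_smul hA (pow_pos hκ 2), Real.sqrt_sq hκ.le, Matrix.smul_mulVec]
  set ζ : ℝ → ℝ := fun ε => (M.Gam (B ε).2.1)⁻¹ *
    (M.cm * ((M.Gam (M.dstep θ (ε • e)).2.1)⁻¹ - s)) with hζ
  have cζ : ContinuousAt ζ 0 := by
    have c1 : ContinuousAt (fun ε => M.Gam (B ε).2.1) 0 :=
      ContinuousAt.comp' (g := M.Gam) hM.stepsize.continuous.continuousAt cB.snd.fst
    have c2 : ContinuousAt (fun ε : ℝ => M.Gam (M.dstep θ (ε • e)).2.1) 0 :=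
      ContinuousAt.comp' (g := M.Gam) hM.stepsize.continuous.continuousAt cD.snd.fst
    exact (c1.inv₀ (hM.stepsize.pos _).ne').mul
      (((c2.inv₀ (hM.stepsize.pos _).ne').sub continuousAt_const).const_mul _)
  have hζ0 : ζ 0 = (M.Gam 0)⁻¹ * (M.cm * ((M.Gam 0)⁻¹ - s)) := by
    simp only [hζ, hB0, zero_smul, hθ, dstep_zero, smul_zero]
  have hz : ∀ ε, (B ε).1 = (ζ ε * ε) • e := fun ε => by
    rw [mul_smul]
    exact (blockStep_eq (M := M) s 0 A (ε • e)).1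
  have hp1 : ∀ ε : ℝ, M.stepP θ (ε • e) = ε • M.coefP • n := by
    intro ε
    rw [stepP, Matrix.mulVec_smul, smul_comm]
    simp [hθ, hn]
  have hp2 : ∀ ε : ℝ, (B ε).2.1 = ε • M.coefP • ((1 - M.cs) • n - s • m ε) := by
    intro ε
    change (1 - M.cs) • M.stepP θ (ε • e) +
      M.coefP • (invSqrt (M.dstep θ (ε • e)).2.2.2 *ᵥ (-s • ε • e)) = _
    rw [hp1, Matrix.mulVec_smul, Matrix.mulVec_smul]
    change _ + M.coefP • (-s • ε • m ε) = _
    module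
  have hp3 : ∀ ε : ℝ, M.stepP (B ε) (x • (B ε).1) =
      ε • M.coefP • ((1 - M.cs) • ((1 - M.cs) • n - s • m ε) + (x * ζ ε) • l ε) := by
    intro ε
    rw [stepP, hp2, hz, Matrix.mulVec_smul, Matrix.mulVec_smul]
    change _ + M.coefP • x • (ζ ε * ε) • l ε = _
    module
  have hb : ContinuousAt (fun ε => (1 - M.cs) • ((1 - M.cs) • n - s • m ε) + (x * ζ ε) • l ε) 0 := by
    fun_prop
  have hb0 : (1 - M.cs) • ((1 - M.cs) • n - s • m 0) + (x * ζ 0) • l 0 ≠ 0 := by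
    have h1 : (1 - M.cs) • ((1 - M.cs) • n - s • m 0) + (x * ζ 0) • l 0 =
        ((1 - M.cs) * ((1 - M.cs) - s * (Real.sqrt M.decayC)⁻¹) +
          x * ((M.Gam 0)⁻¹ * (M.cm * ((M.Gam 0)⁻¹ - s))) * (Real.sqrt M.decayC ^ 2)⁻¹) • n := by
      rw [hm0, hl0, hζ0, Real.sq_sqrt hκ.le]
      module
    rw [h1]
    have hr : Real.sqrt M.decayC < 1 := by
      rw [Real.sqrt_lt' one_pos, one_pow]
      exact hM.hyper.decayC_lt
    have hy := hM.hyper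
    exact smul_ne_zero (zeroing_coeff_ne_zero (by linarith [hy.cs_le]) (by linarith [hy.cs_pos])
      (Real.sqrt_pos.2 hκ) hr hs0 hs1 (by linarith [hy.cc_pos]) hs
      (hM.stepsize.pos 0) hM.stepsize.zero_lt_one hy.cm_pos hx) hn0
  filter_upwards [nhdsWithin_le_nhds (hb.eventually_ne hb0), self_mem_nhdsWithin] with ε h1 h2
  change M.stepP (B ε) (x • (B ε).1) ≠ 0
  rw [hp3]
  exact smul_ne_zero h2 (smul_ne_zero ha.ne' h1)

/-- Once all directions of the covariance matrix are attained, one more block along `e` and the two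
zeroing steps lead to `z = q = 0`. The size `ε` of the block is fixed before the preceding blocks,
which only have to keep the state close enough to rest. -/
theorem DynamicsOK.exists_traj_zeroed (hM : M.DynamicsOK) {A : Sym d} (hA : A ∈ M.smoothCone)
    {s : ℝ} (hs0 : 0 ≤ s) (hs1 : s < 1) (hs : (1 - M.cc) * (1 - M.cc - s) = 0)
    (hs' : s ≠ (1 - M.cs) * Real.sqrt M.decayC) {U : Set (Vec d)} (hU : U ∈ 𝓝 0) :
    ∃ k p C V, p ∈ U ∧ C ∈ M.smoothCone ∧ M.Traj (M.rest A) k (0, p, 0, C) V ∧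
      ∀ E, M.CovTangent V E := by
  have hκ := hM.hyper.decayC_pos
  set e : Vec d := Pi.single ⟨0, hM.hyper.dim_pos⟩ 1 with he
  have he0 : e ≠ 0 := by simp [he]
  set K := 1 / (M.cm * M.cc) with hK
  set C₁ : Sym d := M.decayC ^ (2 * (Finset.univ : Finset (Fin d)).card) • A with hC₁
  have hC₁m : C₁ ∈ M.smoothCone := hM.rnorm.smoothCone_smul hA (pow_pos hκ _)
  set θ₁ : TState d := (0, 0, 0, C₁) with hθ₁
  set B : ℝ × TState d → TState d := fun y => M.blockStep s y.2 (y.1 • e) with hB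
  have hB0 : B (0, θ₁) = (0, 0, 0, M.decayC ^ 2 • C₁) := by
    simp only [hB, zero_smul, hθ₁, blockStep_zero, smul_zero]
  have hBm : (B (0, θ₁)).2.2.2 ∈ M.smoothCone := by
    rw [hB0]
    exact hM.rnorm.smoothCone_smul hC₁m (pow_pos hκ 2)
  have cw : ContinuousAt (fun y : ℝ × TState d => (y.2, y.1 • e)) (0, θ₁) := by fun_prop
  have cB : ContinuousAt B (0, θ₁) :=
    ContinuousAt.comp' (g := fun x : TState d × Vec d => M.blockStep s x.1 x.2)
      (f := fun y : ℝ × TState d => (y.2, y.1 • e)) (hM.continuousAt_blockStep s hC₁m.1 _) cw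
  have cD : ContinuousAt (fun y : ℝ × TState d => M.dstep y.2 (y.1 • e)) (0, θ₁) :=
    ContinuousAt.comp' (g := fun x : TState d × Vec d => M.dstep x.1 x.2)
      (f := fun y : ℝ × TState d => (y.2, y.1 • e)) (hM.continuousAt_dstep hC₁m.1 _) cw
  -- the two zeroing steps with coefficient `x`
  set Ψ : (ℝ × TState d) × ℝ → TState d := fun y => M.dstep (B y.1) (y.2 • (B y.1).1) with hΨ
  set Φ : (ℝ × TState d) × ℝ → TState d := fun y =>
    M.dstep (Ψ y) (-((1 - M.cc) * y.2) • (B y.1).1) with hΦ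
  have cB' : ∀ x : ℝ, ContinuousAt (fun y : (ℝ × TState d) × ℝ => B y.1) ((0, θ₁), x) := fun x =>
    ContinuousAt.comp' (g := B) (f := fun y : (ℝ × TState d) × ℝ => y.1) cB continuousAt_fst
  have cΨ : ∀ x : ℝ, ContinuousAt Ψ ((0, θ₁), x) := fun x =>
    ContinuousAt.comp' (g := fun y : TState d × Vec d => M.dstep y.1 y.2)
      (f := fun y : (ℝ × TState d) × ℝ => (B y.1, y.2 • (B y.1).1))
      (hM.continuousAt_dstep hBm.1 _) ((cB' x).prodMk (continuousAt_snd.smul (cB' x).fst))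
  have hΨ0 : ∀ x : ℝ, Ψ ((0, θ₁), x) = (0, 0, 0, M.decayC ^ 3 • C₁) := by
    intro x
    simp only [hΨ, hB0, smul_zero, dstep_zero, smul_smul]
    rw [← pow_succ']
  have hΨm : ∀ x : ℝ, (Ψ ((0, θ₁), x)).2.2.2 ∈ M.smoothCone := by
    intro x
    rw [hΨ0]
    exact hM.rnorm.smoothCone_smul hC₁m (pow_pos hκ 3)
  have cΦ : ∀ x : ℝ, ContinuousAt Φ ((0, θ₁), x) := fun x =>
    ContinuousAt.comp' (g := fun y : TState d × Vec d => M.dstep y.1 y.2)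
      (f := fun y : (ℝ × TState d) × ℝ => (Ψ y, -((1 - M.cc) * y.2) • (B y.1).1))
      (hM.continuousAt_dstep (hΨm x).1 _) ((cΨ x).prodMk
        (((continuousAt_snd.const_mul _).neg).smul (cB' x).fst))
  have hΦ0 : ∀ x : ℝ, Φ ((0, θ₁), x) = (0, 0, 0, M.decayC ^ 4 • C₁) := by
    intro x
    simp only [hΦ, hΨ0, hB0, smul_zero, dstep_zero, smul_smul]
    rw [← pow_succ']
  have hev : ∀ᶠ y : ℝ × TState d in 𝓝 (0, θ₁), (y.2.2.2.2 ∈ M.smoothCone ∧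
      (M.dstep y.2 (y.1 • e)).2.2.2 ∈ M.smoothCone ∧ (B y).2.2.2 ∈ M.smoothCone) ∧
      ∀ x ∈ Icc (-K) 0, ((Ψ (y, x)).2.2.2 ∈ M.smoothCone ∧ M.Gam (Ψ (y, x)).2.1 < 1) ∧
        (Φ (y, x)).2.2.2 ∈ M.smoothCone ∧ (Φ (y, x)).2.1 ∈ U := by
    refine Eventually.and ?_ ?_
    · have c1 : ContinuousAt (fun y : ℝ × TState d => y.2.2.2.2) (0, θ₁) := by fun_prop
      refine Eventually.and (c1 (isOpen_smoothCone.mem_nhds hC₁m)) (Eventually.and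
        (cD.snd.snd.snd (isOpen_smoothCone.mem_nhds ?_))
        (cB.snd.snd.snd (isOpen_smoothCone.mem_nhds hBm)))
      dsimp only
      rw [zero_smul, dstep_zero_cov (smul_zero _)]
      exact hM.rnorm.smoothCone_smul hC₁m hκ
    · refine isCompact_Icc.eventually_forall_of_forall_eventually fun x _ => ?_
      refine Eventually.and (Eventually.and
        ((cΨ x).snd.snd.snd (isOpen_smoothCone.mem_nhds (hΨm x))) ?_)
        (Eventually.and ((cΦ x).snd.snd.snd (isOpen_smoothCone.mem_nhds ?_))
          ((cΦ x).snd.fst ?_))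
      · have c1 : ContinuousAt (fun y => M.Gam (Ψ y).2.1) ((0, θ₁), x) :=
          ContinuousAt.comp' (g := M.Gam) hM.stepsize.continuous.continuousAt (cΨ x).snd.fst
        refine c1.eventually (gt_mem_nhds ?_)
        change M.Gam (Ψ ((0, θ₁), x)).2.1 < 1
        rw [hΨ0]
        exact hM.stepsize.zero_lt_one
      · change (Φ ((0, θ₁), x)).2.2.2 ∈ _
        rw [hΦ0]
        exact hM.rnorm.smoothCone_smul hC₁m (pow_pos hκ 4)
      · change U ∈ 𝓝 (Φ ((0, θ₁), x)).2.1
        rw [hΦ0]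
        exact hU
  have hγΓ : (1 - M.cc) * M.Gam 0 - 1 < 0 := by
    have h1 := hM.stepsize.pos 0
    have h2 := hM.stepsize.zero_lt_one
    have h3 := hM.hyper.cc_pos
    nlinarith
  set x₀ := 1 / M.cm / ((1 - M.cc) * M.Gam 0 - 1) with hx₀
  have hx₀' : ((1 - M.cc) * M.Gam 0 - 1) * x₀ = 1 / M.cm := mul_div_cancel₀ _ hγΓ.ne
  rw [nhds_prod_eq] at hev
  obtain ⟨ε, ⟨⟨hε, hp1, hp2⟩, hp3⟩⟩ := (((hev.curry.filter_mono nhdsWithin_le_nhds).and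
    (hM.eventually_blockStep_ne (θ := θ₁) hC₁m.1 (smul_zero _) hs' he0)).and
    (hM.eventually_stepP_zeroing_ne hC₁m.1 hs0 hs1 hs he0 hx₀')).exists
  -- the generic conditions persist near the rest point
  have cBε : ContinuousAt (fun θ => M.blockStep s θ (ε • e)) θ₁ :=
    ContinuousAt.comp' (g := fun x : TState d × Vec d => M.blockStep s x.1 x.2)
      (f := fun θ : TState d => (θ, ε • e)) (hM.continuousAt_blockStep s hC₁m.1 _) (by fun_prop)
  have hev1 : ∀ᶠ θ in 𝓝 θ₁, M.stepP θ (ε • e) ≠ 0 := by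
    have c1 : ContinuousAt (fun θ => M.stepP θ (ε • e)) θ₁ :=
      ContinuousAt.comp' (g := fun x : TState d × Vec d => M.stepP x.1 x.2)
        (f := fun θ : TState d => (θ, ε • e)) (DynamicsOK.continuousAt_stepP hC₁m.1 _)
        (by fun_prop)
    exact c1.eventually_ne hp1
  have hev2 : ∀ᶠ θ in 𝓝 θ₁, (M.blockStep s θ (ε • e)).2.1 ≠ 0 := cBε.snd.fst.eventually_ne hp2
  have hev3 : ∀ᶠ θ in 𝓝 θ₁, M.stepP (M.blockStep s θ (ε • e))
      (x₀ • (M.blockStep s θ (ε • e)).1) ≠ 0 := by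
    have c1 : ContinuousAt (fun θ => M.stepP (M.blockStep s θ (ε • e))
        (x₀ • (M.blockStep s θ (ε • e)).1)) θ₁ :=
      ContinuousAt.comp' (g := fun x : TState d × Vec d => M.stepP x.1 x.2)
        (f := fun θ : TState d => (M.blockStep s θ (ε • e), x₀ • (M.blockStep s θ (ε • e)).1))
        (DynamicsOK.continuousAt_stepP (hM.hyper.dstep_mem (hM.hyper.dstep_mem hC₁m.1 _) _) _)
        (cBε.prodMk (cBε.fst.const_smul x₀))
    exact c1.eventually_ne hp3
  obtain ⟨k, θ, V, ⟨⟨⟨hC, hD, hBC⟩, hx⟩, h1, h2, h3⟩, hT, hq, hV⟩ :=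
    hM.exists_traj_covTangent hA hs0 hs hs' Finset.univ _ (hε.and (hev1.and (hev2.and hev3)))
  obtain ⟨V₁, hT₁, hq₁, hV₁⟩ := hT.blockStep hM hs hq hC hD h1 h2
  have hE₁ : ∀ E, M.CovTangent V₁ E := by
    intro E
    have h4 := hV fun i => (1 / 2 : ℝ) • fun j =>
      (((M.decayC ^ 2)⁻¹ • E : Sym d) : Matrix (Fin d) (Fin d) ℝ) i j
    rw [sum_symProd_single] at h4
    have h5 := hV₁ _ h4 0
    rwa [map_zero, smul_zero, add_zero, smul_smul, mul_inv_cancel₀ (pow_pos hκ 2).ne',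
      one_smul] at h5
  set θ₂ := M.blockStep s θ (ε • e) with hθ₂
  obtain ⟨x, hxm, hxz⟩ := hM.exists_isZeroing_small (θ := θ₂) fun x hx' => (hx x hx').1.2.le
  have hpx : M.stepP θ₂ (x • θ₂.1) ≠ 0 := by
    intro h0
    have h4 : x = x₀ := by
      have h5 := hxz
      rw [IsZeroing, h0] at h5
      exact mul_left_cancel₀ hγΓ.ne (h5.trans hx₀'.symm)
    exact h3 (h4 ▸ h0)
  obtain ⟨V₂, hT₂, hE₂⟩ := hT₁.step_covTangent hM hBC (.inl hpx) hE₁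
  obtain ⟨V₃, hT₃, hE₃⟩ := hT₂.step_covTangent hM (hx x hxm).1.1 (.inr (hxz.cancel hM)) hE₂
  obtain ⟨p, hp⟩ := hxz.dstep_dstep hM hq₁
  have hfin := (hx x hxm).2
  change (M.dstep (M.dstep θ₂ (x • θ₂.1)) (-((1 - M.cc) * x) • θ₂.1)).2.2.2 ∈ _ ∧
    (M.dstep (M.dstep θ₂ (x • θ₂.1)) (-((1 - M.cc) * x) • θ₂.1)).2.1 ∈ U at hfin
  rw [hp] at hT₃ hfin
  exact ⟨_, _, _, V₃, hfin.2, hfin.1, hT₃, hE₃⟩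

end Data

namespace Data

variable {d lam mu : ℕ} {M : Data d lam mu}

/-! ### Generating the remaining tangent directions -/

theorem exists_invSqrt_mulVec_eq {C : Sym d} (hC : C ∈ posDefCone d) (y : Vec d) :
    ∃ x, invSqrt C *ᵥ x = y := by
  refine ⟨sqrtMat (C : Matrix (Fin d) (Fin d) ℝ) *ᵥ y, ?_⟩
  rw [invSqrt, Matrix.mulVec_mulVec, Matrix.nonsing_inv_mul _ (sqrtMat_isUnit_det hC),
    Matrix.one_mulVec]

/-- The linear system for three consecutive steps. Its determinant is `s - β` times the number in
the hypothesis `hdet`. -/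
theorem exists_three_steps {E : Type*} [AddCommGroup E] [Module ℝ E] {s β g₁ g₂ : ℝ}
    (hs : s ≠ β) (hdet : g₂ * (g₁ - s - β) + s * β ≠ 0) (P Q Z : E) :
    ∃ u₁ u₂ u₃ : E, s ^ 2 • u₁ + s • u₂ + u₃ = Q ∧ β ^ 2 • u₁ + β • u₂ + u₃ = P ∧
      (g₁ * g₂) • u₁ + g₂ • u₂ + u₃ = Z := by
  set X := (s - β)⁻¹ • (Q - P) with hX
  set u := (g₂ * (g₁ - s - β) + s * β)⁻¹ • (Z - P - (g₂ - β) • X) with hu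
  have hX' : (s - β) • X = Q - P := by
    rw [hX, smul_smul, mul_inv_cancel₀ (sub_ne_zero.2 hs), one_smul]
  have hu' : (g₂ * (g₁ - s - β) + s * β) • u = Z - P - (g₂ - β) • X := by
    rw [hu, smul_smul, mul_inv_cancel₀ hdet, one_smul]
  refine ⟨u, X - (s + β) • u, P - β • X + (s * β) • u, ?_, ?_, ?_⟩
  · have h1 : s ^ 2 • u + s • (X - (s + β) • u) + (P - β • X + (s * β) • u) =
        (s - β) • X + P := by module
    rw [h1, hX', sub_add_cancel]
  · module
  · have h1 : (g₁ * g₂) • u + g₂ • (X - (s + β) • u) + (P - β • X + (s * β) • u) =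
        (g₂ * (g₁ - s - β) + s * β) • u + (g₂ - β) • X + P := by module
    rw [h1, hu']
    abel

theorem Traj.zero_step (hM : M.DynamicsOK) {θ₀ : State d} {k : ℕ} {p : Vec d} {C : Sym d}
    {V : Submodule ℝ (TState d)} (hT : M.Traj θ₀ k (0, p, 0, C) V) (hC : C ∈ M.smoothCone) :
    ∃ V', M.Traj θ₀ (k + 1) (0, (1 - M.cs) • p, 0, M.decayC • C) V' ∧ ∀ h ∈ V, ∀ u : Vec d,
      (((M.Gam ((1 - M.cs) • p))⁻¹ • (h.1 + M.cm • u),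
        (1 - M.cs) • h.2.1 + M.coefP • (invSqrt C *ᵥ u), (1 - M.cc) • h.2.2.1 + M.coefQ • u,
        M.decayC • h.2.2.2) : TState d) ∈ V' := by
  obtain ⟨N, L, V', hN, hT', hV'⟩ := hT.step hM (w := 0) (differentiableAt_of_mem_smoothCone hC)
    (.inr (by rw [smul_zero, add_zero]))
  rw [dstep_zero] at hT'
  refine ⟨V', hT', fun h hh u => ?_⟩
  have h1 := hV' h hh u
  have hp : M.stepP (0, p, 0, C) 0 = (1 - M.cs) • p := by simp [stepP]
  have hq : M.stepQ (0, p, 0, C) 0 = 0 := by simp [stepQ]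
  rw [stepTangent, hN rfl, hp, hq] at h1
  simpa using h1

/-- Three steps `0` with `z = q = 0` complete the directions of the covariance matrix to all
directions. -/
theorem Traj.exists_fullTangent (hM : M.DynamicsOK) {θ₀ : State d} {k : ℕ} {p : Vec d} {C : Sym d}
    {V : Submodule ℝ (TState d)} (hT : M.Traj θ₀ k (0, p, 0, C) V) (hC : C ∈ M.smoothCone)
    (hV : ∀ E, M.CovTangent V E) {s : ℝ} (hs : s ≠ (1 - M.cs) * Real.sqrt M.decayC)
    (hcc : M.cc ≠ 1 → s = 1 - M.cc)
    (hdet : (M.Gam ((1 - M.cs) • (1 - M.cs) • p))⁻¹ * ((M.Gam ((1 - M.cs) • p))⁻¹ - s -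
      (1 - M.cs) * Real.sqrt M.decayC) + s * ((1 - M.cs) * Real.sqrt M.decayC) ≠ 0) :
    ∃ p' C' V', C' ∈ M.smoothCone ∧ M.Traj θ₀ (k + 3) (0, p', 0, C') V' ∧ M.FullTangent V' := by
  have hκ := hM.hyper.decayC_pos
  have hR := hM.rnorm
  obtain ⟨V₁, hT₁, hV₁⟩ := hT.zero_step hM hC
  have hC₁ := hR.smoothCone_smul hC hκ
  obtain ⟨V₂, hT₂, hV₂⟩ := hT₁.zero_step hM hC₁
  have hC₂ := hR.smoothCone_smul hC₁ hκ
  obtain ⟨V₃, hT₃, hV₃⟩ := hT₂.zero_step hM hC₂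
  refine ⟨_, _, V₃, hR.smoothCone_smul hC₂ hκ, hT₃, fun z P Q E => ?_⟩
  set r := Real.sqrt M.decayC with hr
  have hr0 : 0 < r := Real.sqrt_pos.2 hκ
  set g₁ := (M.Gam ((1 - M.cs) • p))⁻¹
  set g₂ := (M.Gam ((1 - M.cs) • (1 - M.cs) • p))⁻¹
  set g₃ := (M.Gam ((1 - M.cs) • (1 - M.cs) • (1 - M.cs) • p))⁻¹
  have hg₃ : g₃ ≠ 0 := inv_ne_zero (hM.stepsize.pos _).ne'
  have hc := hM.hyper.cm_pos.ne'
  have ha := hM.hyper.coefP_pos.ne'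
  have hb := hM.hyper.coefQ_pos.ne'
  obtain ⟨h, hh, hhC, hhq⟩ := hV ((M.decayC ^ 3)⁻¹ • E)
  obtain ⟨X, hX⟩ := exists_invSqrt_mulVec_eq hC.1
    ((M.coefP⁻¹ * r ^ 2) • (P - (1 - M.cs) ^ 3 • h.2.1))
  obtain ⟨u₁, u₂, u₃, hQ, hP, hZ⟩ := exists_three_steps hs hdet X (M.coefQ⁻¹ • Q)
    ((M.cm * g₃)⁻¹ • (z - (g₁ * g₂ * g₃) • h.1))
  refine ⟨_, hV₃ _ (hV₂ _ (hV₁ h hh u₁) u₂) u₃, ?_, ?_, fun hcs => ?_, fun hcc' => ?_⟩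
  · dsimp only
    have h1 : g₃ • (g₂ • (g₁ • (h.1 + M.cm • u₁) + M.cm • u₂) + M.cm • u₃) =
        (g₁ * g₂ * g₃) • h.1 + (M.cm * g₃) • ((g₁ * g₂) • u₁ + g₂ • u₂ + u₃) := by module
    rw [h1, hZ, smul_smul, mul_inv_cancel₀ (mul_ne_zero hc hg₃), one_smul, add_sub_cancel]
  · dsimp only
    rw [hhC, smul_smul, smul_smul, smul_smul]
    rw [show M.decayC * M.decayC * M.decayC * (M.decayC ^ 3)⁻¹ = 1 by field_simp, one_smul]
  · dsimp only
    rw [invSqrt_smul hC₁.1 hκ, invSqrt_smul hC.1 hκ, ← hr]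
    simp only [Matrix.smul_mulVec]
    have h1 : (1 - M.cs) • ((1 - M.cs) • ((1 - M.cs) • h.2.1 + M.coefP • (invSqrt C *ᵥ u₁)) +
        M.coefP • r⁻¹ • (invSqrt C *ᵥ u₂)) + M.coefP • r⁻¹ • r⁻¹ • (invSqrt C *ᵥ u₃) =
        (1 - M.cs) ^ 3 • h.2.1 + (M.coefP * (r ^ 2)⁻¹) • (invSqrt C *ᵥ
          (((1 - M.cs) * r) ^ 2 • u₁ + ((1 - M.cs) * r) • u₂ + u₃)) := by
      simp only [Matrix.mulVec_add, Matrix.mulVec_smul]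
      match_scalars <;> field_simp
    rw [h1, hP, hX, smul_smul]
    rw [show M.coefP * (r ^ 2)⁻¹ * (M.coefP⁻¹ * r ^ 2) = 1 by field_simp, one_smul,
      add_sub_cancel]
  · dsimp only
    have h1 : (1 - M.cc) • ((1 - M.cc) • ((1 - M.cc) • h.2.2.1 + M.coefQ • u₁) + M.coefQ • u₂) +
        M.coefQ • u₃ = (1 - M.cc) ^ 2 • (1 - M.cc) • h.2.2.1 +
          M.coefQ • ((1 - M.cc) ^ 2 • u₁ + (1 - M.cc) • u₂ + u₃) := by module
    rw [hcc hcc'] at hQ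
    rw [h1, hhq, hQ, smul_zero, zero_add, smul_smul, mul_inv_cancel₀ hb, one_smul]

/-- A continuous linear form with `φ C ≠ 0` is nonzero on some symmetric product with a basis
vector. -/
theorem exists_symProd_ne_zero (φ : Sym d →L[ℝ] ℝ) {C : Sym d} (hφ : φ C ≠ 0) :
    ∃ (i : Fin d) (y : Vec d), φ (symProd d (Pi.single i 1) y) ≠ 0 := by
  by_contra! h
  refine hφ ?_
  rw [← sum_symProd_single C, map_sum]
  exact Finset.sum_eq_zero fun i _ => h i _

/-- Starting at rest, the derivative of some extended transition map covers all tangent directions,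
except those of paths without memory and, if `c_c = 1`, that of `r`. -/
theorem DynamicsOK.exists_range_S (hM : M.DynamicsOK) {A : Sym d} (hA : A ∈ M.smoothCone)
    (hcc : M.cc = 1 ∨ 1 - M.cc ≠ (1 - M.cs) * Real.sqrt M.decayC) :
    ∃ (k : ℕ) (w' : Fin (k + 1) → Vec d) (D : (Fin (k + 1) → Ctrl d mu) →L[ℝ] State d),
      HasFDerivAt (M.S (M.rest A) (k + 1)) D (fun i => diag mu (w' i)) ∧
      (M.cc ≠ 1 → 0 < M.cmu → ∀ (z p q : Vec d),
        ∀ B ∈ M.tangentCov (M.S (M.rest A) (k + 1) fun i => diag mu (w' i)).2.2.2.1, ∀ r : ℝ,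
        ∃ p', (M.cs ≠ 1 → p' = p) ∧ (z, p', q, B, r) ∈ LinearMap.range D.toLinearMap) ∧
      (M.cc = 1 → ∀ (z p : Vec d),
        ∀ B ∈ M.tangentCov (M.S (M.rest A) (k + 1) fun i => diag mu (w' i)).2.2.2.1,
        ∃ p' q r, (M.cs ≠ 1 → p' = p) ∧ (z, p', q, B, r) ∈ LinearMap.range D.toLinearMap) := by
  have hy := hM.hyper
  have hκ := hy.decayC_pos
  set β := (1 - M.cs) * Real.sqrt M.decayC with hβ
  have hr1 : Real.sqrt M.decayC < 1 := by
    rw [Real.sqrt_lt' one_pos, one_pow]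
    exact hy.decayC_lt
  have hβ1 : β < 1 := by
    have h1 := Real.sqrt_nonneg M.decayC
    have h2 := hy.cs_pos
    have h3 := hy.cs_le
    nlinarith
  -- if `q` has no memory, then the ratio of the steps in a block may be chosen freely
  obtain ⟨s, hs0, hs1, hsc, hs, hsβ⟩ : ∃ s : ℝ, 0 ≤ s ∧ s < 1 ∧ (M.cc ≠ 1 → s = 1 - M.cc) ∧
      (1 - M.cc) * (1 - M.cc - s) = 0 ∧ s ≠ β := by
    by_cases h1 : M.cc = 1
    · by_cases h2 : β = 0
      · exact ⟨1 / 2, by norm_num, by norm_num, fun h => absurd h1 h, by rw [h1]; ring,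
          by rw [h2]; norm_num⟩
      · exact ⟨0, le_rfl, one_pos, fun h => absurd h1 h, by rw [h1]; ring, Ne.symm h2⟩
    · exact ⟨1 - M.cc, by linarith [hy.cc_le], by linarith [hy.cc_pos], fun _ => rfl, by ring,
        hcc.resolve_left h1⟩
  have hU : {p : Vec d | (M.Gam ((1 - M.cs) • (1 - M.cs) • p))⁻¹ *
      ((M.Gam ((1 - M.cs) • p))⁻¹ - s - β) + s * β ≠ 0} ∈ 𝓝 0 := by
    have hc := hM.stepsize.continuous
    have c1 : Continuous fun p : Vec d => (M.Gam ((1 - M.cs) • p))⁻¹ :=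
      (hc.comp (continuous_const_smul _)).inv₀ fun p => (hM.stepsize.pos _).ne'
    have c2 : Continuous fun p : Vec d => (M.Gam ((1 - M.cs) • (1 - M.cs) • p))⁻¹ :=
      c1.comp (continuous_const_smul (1 - M.cs))
    have c3 : Continuous fun p : Vec d => (M.Gam ((1 - M.cs) • (1 - M.cs) • p))⁻¹ *
        ((M.Gam ((1 - M.cs) • p))⁻¹ - s - β) + s * β := by fun_prop
    refine c3.continuousAt.eventually_ne ?_
    rw [smul_zero, smul_zero]
    have hg : 1 < (M.Gam 0)⁻¹ := (one_lt_inv₀ (hM.stepsize.pos 0)).2 hM.stepsize.zero_lt_one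
    have h1 : (M.Gam 0)⁻¹ * ((M.Gam 0)⁻¹ - s - β) + s * β =
        ((M.Gam 0)⁻¹ - s) * ((M.Gam 0)⁻¹ - β) := by ring
    rw [h1]
    exact (mul_pos (by linarith) (by linarith)).ne'
  obtain ⟨k, p, C, V, hp, hC, hT, hV⟩ := hM.exists_traj_zeroed hA hs0 hs1 hs hsβ hU
  obtain ⟨p', C', V', hC', hT', hV'⟩ := hT.exists_fullTangent hM hC hV hsβ hsc hp
  have hd := differentiableAt_of_mem_smoothCone hC'
  obtain ⟨i, y, hiy⟩ := exists_symProd_ne_zero (fderiv ℝ M.R C') (C := C')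
    (by rw [hM.fderiv_R_self hC'.1 hd]; exact (hM.rnorm.pos _ hC'.1).ne')
  set θ : TState d := (0, p', 0, C') with hθ
  have hev : ∀ᶠ τ : ℝ in 𝓝 0,
      (M.dstep θ (τ • (Pi.single i 1 : Vec d))).2.2.2 ∈ M.smoothCone := by
    have c1 : ContinuousAt (fun τ : ℝ => M.dstep θ (τ • (Pi.single i 1 : Vec d))) 0 :=
      ContinuousAt.comp' (g := fun x : TState d × Vec d => M.dstep x.1 x.2)
        (f := fun τ : ℝ => (θ, τ • (Pi.single i 1 : Vec d))) (hM.continuousAt_dstep hC'.1 _)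
        (by fun_prop)
    refine c1.snd.snd.snd (isOpen_smoothCone.mem_nhds ?_)
    dsimp only
    rw [zero_smul, dstep_zero_cov (smul_zero _)]
    exact hM.rnorm.smoothCone_smul hC' hκ
  have hne := hM.eventually_blockStep_ne (θ := θ) hC'.1 (smul_zero _) hsβ
    (e := Pi.single i 1) (by simp)
  obtain ⟨τ, ⟨hτC, hτp, -⟩, hτ⟩ := (((hev.filter_mono nhdsWithin_le_nhds).and hne).and
    self_mem_nhdsWithin).exists
  refine ⟨_, hT'.exists_range_S hM hV' hd (differentiableAt_of_mem_smoothCone hτC) (.inl hτp)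
    (y := y) ?_⟩
  rw [map_smul, LinearMap.smul_apply, map_smul]
  exact smul_ne_zero hτ hiy

/-- The derivative of the extended transition map takes values in the tangent space of `X`. -/
theorem DynamicsOK.range_fderiv_S_le (hM : M.DynamicsOK) {θ : State d} (hθ : θ ∈ M.X) {k : ℕ}
    {v : Fin k → Ctrl d mu} {D : (Fin k → Ctrl d mu) →L[ℝ] State d}
    (hD : HasFDerivAt (M.S θ k) D v) :
    LinearMap.range D.toLinearMap ≤ M.tangentX (M.S θ k v) := by
  rintro _ ⟨η, rfl⟩
  refine ⟨trivial, trivial, trivial, ?_, trivial⟩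
  have h1 : HasFDerivAt (fun u => M.rho (M.S θ k u).2.2.2.1) _ v :=
    HasFDerivAt.comp v (g := M.rho)
      (hM.rho.differentiableAt (hM.S_mem hθ k v).1).hasFDerivAt hD.snd.snd.snd.fst
  have h2 : (fun u => M.rho (M.S θ k u).2.2.2.1) = fun _ => 1 := by
    funext u
    exact (hM.S_mem hθ k u).2.1
  rw [h2] at h1
  have h3 := DFunLike.congr_fun (h1.unique (hasFDerivAt_const 1 v)) η
  exact h3

end Data

end CMAES

end

theorem proposition5p10 {d lam mu : ℕ} (M : CMAES.Data d lam mu)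
    (hH : M.Hyper) (hf : M.ObjectiveOK) (hR : M.RNormOK) (hrho : M.RhoOK)
    (hG : M.StepsizeOK) (hP : M.SamplingOK) :
    -- the control sets are well defined: a lower semicontinuous density exists
    (∃ p : CMAES.State d → CMAES.Ctrl d mu → ℝ, M.IsLscDensity hH.mu_le p) ∧
    -- and the assertion holds for each choice of it
    ∀ p : CMAES.State d → CMAES.Ctrl d mu → ℝ, M.IsLscDensity hH.mu_le p →
      ∃ θ₀ : CMAES.State d, M.SteadilyAttracting p θ₀ ∧
      ∃ T : ℕ, 0 < T ∧ ∃ v ∈ closure (M.controlSet p θ₀ T),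
      ∃ D : (Fin T → CMAES.Ctrl d mu) →L[ℝ] CMAES.State d,
        HasFDerivAt (M.S θ₀ T) D v ∧
        -- (a)
        (M.cc ≠ 1 → M.cs ≠ 1 →
          1 - M.cc ≠ (1 - M.cs) * Real.sqrt (1 - M.c1 - M.cmu) → 0 < M.cmu →
          Module.finrank ℝ (LinearMap.range D.toLinearMap) =
            Module.finrank ℝ (M.tangentX (M.S θ₀ T v))) ∧
        -- (b)
        (M.cc = 1 → M.cs ≠ 1 →
          ∀ (z p' : CMAES.Vec d), ∀ A ∈ M.tangentCov (M.S θ₀ T v).2.2.2.1,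
            ∃ (q : CMAES.Vec d) (r : ℝ), (z, p', q, A, r) ∈ LinearMap.range D.toLinearMap) ∧
        -- (c)
        (M.cc ≠ 1 → M.cs = 1 → 0 < M.cmu →
          ∀ (z q : CMAES.Vec d), ∀ A ∈ M.tangentCov (M.S θ₀ T v).2.2.2.1, ∀ r : ℝ,
            ∃ p' : CMAES.Vec d, (z, p', q, A, r) ∈ LinearMap.range D.toLinearMap) ∧
        -- (d)
        (M.cc = 1 → M.cs = 1 →
          ∀ z : CMAES.Vec d, ∀ A ∈ M.tangentCov (M.S θ₀ T v).2.2.2.1,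
            ∃ (p' q : CMAES.Vec d) (r : ℝ),
              (z, p', q, A, r) ∈ LinearMap.range D.toLinearMap) := by
  have hM : M.DynamicsOK := ⟨hH, hR, hrho, hG⟩
  refine ⟨CMAES.Data.exists_isLscDensity hM hf hP hH.mu_le, fun p hp => ?_⟩
  obtain ⟨A, hA⟩ := hR.smoothCone_nonempty
  refine ⟨M.rest A, hM.steadilyAttracting_rest hf hP hp hA.1, ?_⟩
  have hmem := hM.rest_mem hA.1
  by_cases hcase : M.cc = 1 ∨ 1 - M.cc ≠ (1 - M.cs) * Real.sqrt M.decayC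
  · obtain ⟨k, w, D, hD, h1, h2⟩ := hM.exists_range_S hA hcase
    refine ⟨k + 1, Nat.succ_pos k, _,
      CMAES.Data.diag_mem_closure_controlSet hM hf hP hp hmem (k + 1) w, D, hD, ?_, ?_, ?_, ?_⟩
    · intro hcc hcs _ hcmu
      suffices LinearMap.range D.toLinearMap = M.tangentX (M.S (M.rest A) (k + 1) fun i =>
          CMAES.Data.diag mu (w i)) by rw [this]
      refine le_antisymm (hM.range_fderiv_S_le hmem hD) ?_
      rintro ⟨z, p', q, B, r⟩ ⟨-, -, -, hB, -⟩
      obtain ⟨p'', hp', hr⟩ := h1 hcc hcmu z p' q B hB r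
      rwa [hp' hcs] at hr
    · intro hcc hcs z p' B hB
      obtain ⟨p'', q, r, hp', hr⟩ := h2 hcc z p' B hB
      rw [hp' hcs] at hr
      exact ⟨q, r, hr⟩
    · intro hcc _ hcmu z q B hB r
      obtain ⟨p'', -, hr⟩ := h1 hcc hcmu z 0 q B hB r
      exact ⟨p'', hr⟩
    · intro hcc _ z B hB
      obtain ⟨p'', q, r, -, hr⟩ := h2 hcc z 0 B hB
      exact ⟨p'', q, r, hr⟩
  · -- none of the four cases occurs, so that differentiability at any control is enough
    push Not at hcase
    obtain ⟨hcc, hβ⟩ := hcase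
    have hd := CMAES.Data.differentiableAt_of_mem_smoothCone hA
    have hd' : DifferentiableAt ℝ M.R (M.dstep (0, 0, 0, A) 0).2.2.2 := by
      rw [CMAES.Data.dstep_zero]
      exact CMAES.Data.differentiableAt_of_mem_smoothCone
        (hR.smoothCone_smul hA hH.decayC_pos)
    obtain ⟨-, -, -, -, w, D, hD, -⟩ := (hM.traj_rest hA.1).exists_hasFDerivAt_S hM hd hd'
      (.inr (by rw [smul_zero, add_zero]))
    refine ⟨1, one_pos, _, CMAES.Data.diag_mem_closure_controlSet hM hf hP hp hmem 1 w, D, hD,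
      fun _ _ h => absurd hβ h, fun h => absurd h hcc, fun _ hcs => ?_, fun h => absurd h hcc⟩
    rw [hcs, sub_self, zero_mul] at hβ
    exact absurd (sub_eq_zero.1 hβ).symm hcc
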